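/- Maps are planar maps (connected multigraphs embedded in the sphere, up to orientation-preserving homeomorphism), rooted at a corner (equivalently, a half-edge) whose incident face is the outer face; a map "with a boundary of length $p$" is a rooted map whose outer face has degree $p$. A \emph{rigid loop configuration} on a quadrangulation with a boundary (every inner face has degree $4$) is a collection of disjoint simple cycles of the dual map ("loops") which do not visit the outer face and which, in every face they visit, enter and exit through opposite edges. For real numbers $n,g,h\ge 0$ and $p\ge 2$ even, let $$Z_p=\sum_m n^{L(m)}g^{f_u(m)}h^{f_v(m)}\in[0,\infty],$$ where the sum is over all quadrangulations $m$ with a boundary of length $p$ endowed with a rigid loop configuration, and $L(m)$, $f_u(m)$, $f_v(m)$ are the numbers of loops, of inner faces not visited by a loop, and of faces visited by a loop (with $0^0=1$). The triple $(n,g,h)$ is \emph{admissible} (for $p$) if $Z_p<\infty$. For a sequence $(g_{2k})_{k\ge1}$ in $[0,\infty]$ let $$\mathcal F_p(g_2,g_4,g_6,\dots)=\sum_m\ \prod_{f \text{ inner face of } m} g_{\deg f}\in[0,\infty],$$ where the sum is over all rooted bipartite maps $m$ with a boundary of length $p$. (In $[0,\infty]$ one sets $0\cdot\infty=0$.) The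 \emph{gasket} of a loop-decorated quadrangulation is the rooted map obtained by erasing all loops together with their interiors (all vertices and edges on the side of a loop not containing the outer face) and all the edges crossed by loops. \textbf{Theorem.} Let $n,g,h\ge 0$ be real numbers. (i) For every even $p\ge 2$, $$Z_p=\mathcal F_p(z_2,z_4,z_6,\dots),\qquad\text{where } z_k=g\,\delta_{k,4}+n\,h^k Z_k .$$ (ii) Let $p\ge2$ be even with $Z_p<\infty$. Then $0<Z_p<\infty$ and $0<\mathcal F_p(z_2,z_4,\dots)<\infty$, and if a loop-decorated quadrangulation with a boundary of length $p$ is drawn with probability $n^{L(m)}g^{f_u(m)}h^{f_v(m)}/Z_p$, then its gasket is distributed as a Boltzmann bipartite map with a boundary of length $p$ and weight sequence $(z_k)$: it is almost surely a rooted bipartite planar map with a boundary of length $p$, and it equals a given such map $m$ with probability $$\frac{1}{\mathcal F_p(z_2,z_4,\dots)}\prod_{f\text{ inner face of }m} z_{\deg f}.$$ -/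

import Mathlib

open scoped ENNReal NNReal

noncomputable section

/-! ### Rooted maps as rotation systems -/

/-- The data of a rooted map drawn on an oriented closed surface, in its standard combinatorial
encoding: a finite set of half-edges (darts), the permutation `rot` sending a dart to the next one
around its origin vertex, the fixed-point-free involution `flip` exchanging the two darts of an edge,
and a distinguished dart `root`. Connectedness and planarity are the predicate
`RootedMap.IsPlanar` below. -/
structure RootedMap : Type 1 where
  Dart : Type
  finite_dart : Finite Dart
  rot : Equiv.Perm Dart
  flip : Equiv.Perm Dart
  flip_flip : ∀ d, flip (flip d) = d
  flip_ne : ∀ d, flip d ≠ d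
  root : Dart

attribute [instance] RootedMap.finite_dart

namespace RootedMap

variable (M : RootedMap)

/-- The permutation whose cycles are the contours of the faces: follow the edge of a dart, then
turn at its endpoint. -/
def next : Equiv.Perm M.Dart := M.rot * M.flip

/-- Vertices, edges and faces are the cycles (fixed points included) of the three permutations. -/
def Vertex : Type := Quotient (Equiv.Perm.SameCycle.setoid M.rot)

def Edge : Type := Quotient (Equiv.Perm.SameCycle.setoid M.flip)

def Face : Type := Quotient (Equiv.Perm.SameCycle.setoid M.next)

/-- The vertex a dart originates from. -/
def vertexOf (d : M.Dart) : M.Vertex := Quotient.mk _ d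

/-- The face incident to a dart (equivalently, to a corner). -/
def faceOf (d : M.Dart) : M.Face := Quotient.mk _ d

theorem faceOf_eq_iff_sameCycle (a b : M.Dart) :
    M.faceOf a = M.faceOf b ↔ M.next.SameCycle a b := Quotient.eq (r := Equiv.Perm.SameCycle.setoid M.next)

/-- The outer face (the boundary) is the face of the root. -/
def outerFace : M.Face := M.faceOf M.root

def InnerFace : Type := {f : M.Face // f ≠ M.outerFace}

/-- The degree of a face is its number of incident corners. -/
def degree (f : M.Face) : ℕ := Nat.card {d : M.Dart // M.faceOf d = f}

def boundaryLength : ℕ := M.degree M.outerFace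

def IsConnected : Prop :=
  ∀ a b : M.Dart, ∃ s ∈ Subgroup.closure {M.rot, M.flip}, s a = b

/-- A planar map: connected and of genus zero (Euler's relation). -/
def IsPlanar : Prop :=
  M.IsConnected ∧ Nat.card M.Vertex + Nat.card M.Face = Nat.card M.Edge + 2

/-- The vertices can be coloured with two colours so that no edge is monochromatic. -/
def IsBipartite : Prop :=
  ∃ color : M.Vertex → Bool, ∀ d, color (M.vertexOf (M.flip d)) ≠ color (M.vertexOf d)

/-- The face-weighted Boltzmann weight of a map with a boundary, the outer face being unweighted. -/
def boltzmannWeight (z : ℕ → ℝ≥0∞) : ℝ≥0∞ := ∏ᶠ f : M.InnerFace, z (M.degree f.1)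

/-- Isomorphisms of rooted maps (orientation-preserving and root-preserving). -/
structure Iso (M N : RootedMap) where
  toEquiv : M.Dart ≃ N.Dart
  map_rot : ∀ d, toEquiv (M.rot d) = N.rot (toEquiv d)
  map_flip : ∀ d, toEquiv (M.flip d) = N.flip (toEquiv d)
  map_root : toEquiv M.root = N.root

namespace Iso

variable {M} {N P : RootedMap}

def refl (M : RootedMap) : Iso M M := ⟨Equiv.refl _, fun _ => rfl, fun _ => rfl, rfl⟩

def symm (e : Iso M N) : Iso N M where
  toEquiv := e.toEquiv.symm
  map_rot d := by rw [Equiv.symm_apply_eq, e.map_rot, Equiv.apply_symm_apply]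
  map_flip d := by rw [Equiv.symm_apply_eq, e.map_flip, Equiv.apply_symm_apply]
  map_root := by rw [Equiv.symm_apply_eq, e.map_root]

def trans (e : Iso M N) (e' : Iso N P) : Iso M P where
  toEquiv := e.toEquiv.trans e'.toEquiv
  map_rot d := by simp [e.map_rot, e'.map_rot]
  map_flip d := by simp [e.map_flip, e'.map_flip]
  map_root := by simp [e.map_root, e'.map_root]

theorem map_next (e : Iso M N) (d : M.Dart) : e.toEquiv (M.next d) = N.next (e.toEquiv d) := by
  simp [next, e.map_rot, e.map_flip]

theorem faceOf_eq_iff (e : Iso M N) (a b : M.Dart) :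
    N.faceOf (e.toEquiv a) = N.faceOf (e.toEquiv b) ↔ M.faceOf a = M.faceOf b := by
  have h : ∀ (k : ℤ) (d : M.Dart), e.toEquiv ((M.next ^ k) d) = (N.next ^ k) (e.toEquiv d) := by
    have hc : N.next = (e.toEquiv.symm.trans M.next).trans e.toEquiv := by
      ext d; simp [e.map_next]
    intro k d
    have hp : N.next = e.toEquiv.permCongrHom M.next := by
      rw [hc]; ext d; simp
    rw [hp, ← map_zpow]
    simp
  rw [faceOf_eq_iff_sameCycle, faceOf_eq_iff_sameCycle]
  constructor
  · rintro ⟨k, hk⟩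
    exact ⟨k, e.toEquiv.injective (by rw [h, hk])⟩
  · rintro ⟨k, hk⟩
    exact ⟨k, by rw [← h, hk]⟩

def face (e : Iso M N) : M.Face ≃ N.Face :=
  Quotient.congr e.toEquiv fun a b => by
    have := e.faceOf_eq_iff a b
    rw [faceOf_eq_iff_sameCycle, faceOf_eq_iff_sameCycle] at this
    exact this.symm

theorem face_faceOf (e : Iso M N) (d : M.Dart) :
    e.face (M.faceOf d) = N.faceOf (e.toEquiv d) := rfl

theorem face_outerFace (e : Iso M N) : e.face M.outerFace = N.outerFace := by
  rw [outerFace, e.face_faceOf, e.map_root, outerFace]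

theorem degree_face (e : Iso M N) (f : M.Face) : N.degree (e.face f) = M.degree f := by
  refine (Nat.card_congr (e.toEquiv.subtypeEquiv fun d => ?_)).symm
  rw [← e.face_faceOf, e.face.apply_eq_iff_eq]

def innerFace (e : Iso M N) : M.InnerFace ≃ N.InnerFace :=
  e.face.subtypeEquiv fun f => by
    rw [← e.face_outerFace, Ne, Ne, e.face.apply_eq_iff_eq]

theorem boltzmannWeight_eq (e : Iso M N) (z : ℕ → ℝ≥0∞) :
    M.boltzmannWeight z = N.boltzmannWeight z :=
  finprod_eq_of_bijective e.innerFace e.innerFace.bijective fun f =>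
    congrArg z (e.degree_face f.1).symm

end Iso

instance setoid : Setoid RootedMap where
  r M N := Nonempty (Iso M N)
  iseqv := ⟨fun M => ⟨Iso.refl M⟩, fun ⟨e⟩ => ⟨e.symm⟩, fun ⟨e⟩ ⟨e'⟩ => ⟨e.trans e'⟩⟩

end RootedMap

/-- Rooted maps up to isomorphism (with no condition of connectedness or planarity). -/
def RootedMapClass : Type 1 := Quotient RootedMap.setoid

/-! ### Boltzmann bipartite maps with a boundary -/

/-- A rooted bipartite planar map with a boundary of length `p`. -/
structure BipartiteDisk (p : ℕ) : Type 1 where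
  map : RootedMap
  planar : map.IsPlanar
  bipartite : map.IsBipartite
  boundary : map.boundaryLength = p

instance BipartiteDisk.setoid (p : ℕ) : Setoid (BipartiteDisk p) :=
  RootedMap.setoid.comap BipartiteDisk.map

/-- Rooted bipartite planar maps with a boundary of length `p`, up to isomorphism. -/
def BipartiteDiskClass (p : ℕ) : Type 1 := Quotient (BipartiteDisk.setoid p)

namespace BipartiteDiskClass

variable {p : ℕ}

/-- Boltzmann weight of a map with a boundary, for the weight sequence `z`. -/
def weight (z : ℕ → ℝ≥0∞) : BipartiteDiskClass p → ℝ≥0∞ :=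
  Quotient.lift (fun B => B.map.boltzmannWeight z) fun _ _ ⟨e⟩ => e.boltzmannWeight_eq z

def toRootedMapClass : BipartiteDiskClass p → RootedMapClass :=
  Quotient.map BipartiteDisk.map fun _ _ h => h

end BipartiteDiskClass

/-- The generating function of rooted bipartite maps with a boundary of length `p`. -/
def boltzmannF (z : ℕ → ℝ≥0∞) (p : ℕ) : ℝ≥0∞ := ∑' B : BipartiteDiskClass p, B.weight z

/-! ### Quadrangulations with a boundary endowed with a rigid loop configuration -/

/-- A rooted quadrangulation with a boundary of length `p`, endowed with a rigid loop
configuration. Loops are cycles on the dual map, and a collection of disjoint cycles on the dual map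
is given by the set of the (dual) edges it uses: every face is incident to zero or two crossed darts.
-/
structure LoopQuadrangulation (p : ℕ) : Type 1 where
  map : RootedMap
  planar : map.IsPlanar
  quad : ∀ f : map.InnerFace, map.degree f.1 = 4
  boundary : map.boundaryLength = p
  /-- The darts of the edges that are crossed by the loops. -/
  crossed : Set map.Dart
  crossed_flip : ∀ d ∈ crossed, map.flip d ∈ crossed
  /-- A face visited by a loop is entered once and exited once. -/
  crossed_two : ∀ d ∈ crossed, Nat.card {e // e ∈ crossed ∧ map.faceOf e = map.faceOf d} = 2
  /-- No loop visits the outer face. -/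
  crossed_inner : ∀ d ∈ crossed, map.faceOf d ≠ map.outerFace
  /-- In each visited face, the loop enters and exits through opposite edges. -/
  rigid : ∀ d ∈ crossed, map.next (map.next d) ∈ crossed

namespace LoopQuadrangulation

variable {p : ℕ} (Q : LoopQuadrangulation p)

/-- Two crossed darts follow each other along a loop if they belong to the same edge, or to the
same face. -/
def loopStep (a b : {d // d ∈ Q.crossed}) : Prop :=
  b.1 = Q.map.flip a.1 ∨ Q.map.faceOf b.1 = Q.map.faceOf a.1

/-- The loops of the configuration. -/
def Loop : Type := Quot Q.loopStep

/-- The darts of the edges crossed by a given loop. -/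
def loopDarts (l : Q.Loop) : Set Q.map.Dart := {d | ∃ h : d ∈ Q.crossed, Quot.mk _ ⟨d, h⟩ = l}

def IsVisited (f : Q.map.Face) : Prop := ∃ d ∈ Q.crossed, Q.map.faceOf d = f

def numLoops : ℕ := Nat.card Q.Loop

def numUnvisited : ℕ := Nat.card {f : Q.map.InnerFace // ¬ Q.IsVisited f.1}

def numVisited : ℕ := Nat.card {f : Q.map.Face // Q.IsVisited f}

def weight (n g h : ℝ≥0) : ℝ≥0∞ :=
  (n : ℝ≥0∞) ^ Q.numLoops * (g : ℝ≥0∞) ^ Q.numUnvisited * (h : ℝ≥0∞) ^ Q.numVisited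

/-- Move from a dart to another one with the same origin, or along an edge not crossed by `l`. -/
def avoidStep (l : Q.Loop) (a b : Q.map.Dart) : Prop :=
  b = Q.map.rot a ∨ (a ∉ Q.loopDarts l ∧ b = Q.map.flip a)

/-- The origin of `d` lies in the interior of the loop `l`: it cannot be connected to the root
vertex, which is incident to the outer face, without crossing `l`. -/
def IsInterior (l : Q.Loop) (d : Q.map.Dart) : Prop :=
  Quot.mk (Q.avoidStep l) d ≠ Quot.mk (Q.avoidStep l) Q.map.root

/-- The darts which remain when all the loops, their interiors and the edges they cross are
erased. -/
def gasketDarts : Set Q.map.Dart := {d | d ∉ Q.crossed ∧ ∀ l, ¬ Q.IsInterior l d}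

theorem flip_mem_crossed_iff (d : Q.map.Dart) : Q.map.flip d ∈ Q.crossed ↔ d ∈ Q.crossed :=
  ⟨fun h => by simpa [Q.map.flip_flip] using Q.crossed_flip _ h, Q.crossed_flip d⟩

theorem flip_mem_gasketDarts (d : Q.map.Dart) :
    d ∈ Q.gasketDarts ↔ Q.map.flip d ∈ Q.gasketDarts := by
  have key : d ∉ Q.crossed → ∀ l, Quot.mk (Q.avoidStep l) (Q.map.flip d)
      = Quot.mk (Q.avoidStep l) d := fun hd l =>
    have hs : Q.avoidStep l d (Q.map.flip d) := Or.inr ⟨fun ⟨h, _⟩ => hd h, rfl⟩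
    (Quot.sound hs).symm
  constructor
  · rintro ⟨h1, h2⟩
    exact ⟨by rwa [Q.flip_mem_crossed_iff], fun l h => h2 l (by
      rw [IsInterior, key h1] at h; exact h)⟩
  · rintro ⟨h1, h2⟩
    rw [Q.flip_mem_crossed_iff] at h1
    exact ⟨h1, fun l h => h2 l (by rw [IsInterior, key h1]; exact h)⟩

theorem root_mem_gasketDarts : Q.map.root ∈ Q.gasketDarts :=
  ⟨fun h => Q.crossed_inner _ h rfl, fun _ h => h rfl⟩

end LoopQuadrangulation

/-! ### Restriction of a permutation to a subset (first return) -/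

section FirstReturn

variable {D : Type} [Finite D] (s : Equiv.Perm D) (K : Set D)

theorem exists_return (x : K) : ∃ k : ℕ, 0 < k ∧ (s ^ k) x.1 ∈ K :=
  ⟨orderOf s, orderOf_pos s, by rw [pow_orderOf_eq_one]; exact x.2⟩

open Classical in
def returnTime (x : K) : ℕ := Nat.find (exists_return s K x)

theorem returnTime_pos (x : K) : 0 < returnTime s K x := by
  classical exact (Nat.find_spec (exists_return s K x)).1

theorem returnTime_mem (x : K) : (s ^ returnTime s K x) x.1 ∈ K := by
  classical exact (Nat.find_spec (exists_return s K x)).2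

theorem returnTime_le (x : K) {k : ℕ} (hk : 0 < k) (h : (s ^ k) x.1 ∈ K) :
    returnTime s K x ≤ k := by
  classical exact Nat.find_min' (exists_return s K x) ⟨hk, h⟩

/-- The first element of `K` met when applying `s` repeatedly to `x`. -/
def firstReturn (x : K) : K := ⟨(s ^ returnTime s K x) x.1, returnTime_mem s K x⟩

theorem firstReturn_aux (x y : K) (hle : returnTime s K x ≤ returnTime s K y)
    (h : (s ^ returnTime s K x) x.1 = (s ^ returnTime s K y) y.1) : x = y := by
  obtain ⟨m, hm⟩ := Nat.exists_eq_add_of_le hle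
  rw [hm, pow_add, Equiv.Perm.mul_apply] at h
  have h' := (s ^ returnTime s K x).injective h
  rcases Nat.eq_zero_or_pos m with rfl | hm0
  · exact Subtype.ext (by simpa using h')
  · have h1 := returnTime_le s K y hm0 (h' ▸ x.2)
    have h2 := returnTime_pos s K x
    omega

theorem firstReturn_injective : Function.Injective (firstReturn s K) := by
  intro x y h
  have h' := congrArg Subtype.val h
  rcases le_total (returnTime s K x) (returnTime s K y) with hle | hle
  · exact firstReturn_aux s K x y hle h'
  · exact (firstReturn_aux s K y x hle h'.symm).symm

/-- The permutation of `K` obtained by erasing the elements outside `K` from the cycles of `s`. -/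
def restrictCycles : Equiv.Perm K :=
  Equiv.ofBijective (firstReturn s K) (Finite.injective_iff_bijective.mp (firstReturn_injective s K))

theorem restrictCycles_conj {D' : Type} [Finite D'] (s' : Equiv.Perm D') (K' : Set D')
    (e : D ≃ D') (he : ∀ d, e (s d) = s' (e d)) (hK : ∀ d, d ∈ K ↔ e d ∈ K') (x : K) :
    e.subtypeEquiv hK (restrictCycles s K x)
      = restrictCycles s' K' (e.subtypeEquiv hK x) := by
  have hp : ∀ (k : ℕ) (d : D), e ((s ^ k) d) = (s' ^ k) (e d) := by
    intro k
    induction k with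
    | zero => intro d; simp
    | succ k ih => intro d; rw [pow_succ, pow_succ, Equiv.Perm.mul_apply, ih, he]; rfl
  have ht : returnTime s K x = returnTime s' K' (e.subtypeEquiv hK x) := by
    apply le_antisymm
    · refine returnTime_le s K x (returnTime_pos s' K' _) ?_
      rw [hK, hp]
      exact returnTime_mem s' K' (e.subtypeEquiv hK x)
    · refine returnTime_le s' K' _ (returnTime_pos s K x) ?_
      have := (hK _).mp (returnTime_mem s K x)
      rw [hp] at this
      exact this
  apply Subtype.ext
  change e ((s ^ returnTime s K x) x.1) = (s' ^ returnTime s' K' (e.subtypeEquiv hK x)) (e x.1)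
  rw [hp, ht]

end FirstReturn

namespace LoopQuadrangulation

variable {p : ℕ} (Q : LoopQuadrangulation p)

/-- The gasket: erase the loops, their interiors and the edges they cross. The remaining edges keep
their cyclic order around each vertex, and the root is unchanged. -/
def gasket : RootedMap where
  Dart := Q.gasketDarts
  finite_dart := inferInstance
  rot := restrictCycles Q.map.rot Q.gasketDarts
  flip := Q.map.flip.subtypeEquiv Q.flip_mem_gasketDarts
  flip_flip d := Subtype.ext (Q.map.flip_flip d.1)
  flip_ne d h := Q.map.flip_ne d.1 (congrArg Subtype.val h)
  root := ⟨Q.map.root, Q.root_mem_gasketDarts⟩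

/-- Isomorphisms of loop-decorated quadrangulations. -/
structure Iso (Q R : LoopQuadrangulation p) extends RootedMap.Iso Q.map R.map where
  map_crossed : ∀ d, d ∈ Q.crossed ↔ toEquiv d ∈ R.crossed

namespace Iso

variable {Q} {R S : LoopQuadrangulation p}

def refl (Q : LoopQuadrangulation p) : Iso Q Q := ⟨RootedMap.Iso.refl _, fun _ => Iff.rfl⟩

def symm (e : Iso Q R) : Iso R Q :=
  ⟨e.toIso.symm, fun d => by
    rw [e.map_crossed]
    exact iff_of_eq (congrArg (· ∈ R.crossed) (e.toEquiv.apply_symm_apply d).symm)⟩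

def trans (e : Iso Q R) (e' : Iso R S) : Iso Q S :=
  ⟨e.toIso.trans e'.toIso, fun d => (e.map_crossed d).trans (e'.map_crossed _)⟩

def loop (e : Iso Q R) : Q.Loop ≃ R.Loop :=
  Quot.congr (e.toEquiv.subtypeEquiv e.map_crossed) fun a b => by
    unfold loopStep
    change _ ↔ e.toEquiv b.1 = R.map.flip (e.toEquiv a.1) ∨
      R.map.faceOf (e.toEquiv b.1) = R.map.faceOf (e.toEquiv a.1)
    rw [← e.map_flip, e.toEquiv.apply_eq_iff_eq, e.faceOf_eq_iff]

theorem mem_loopDarts (e : Iso Q R) (l : Q.Loop) (d : Q.map.Dart) :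
    d ∈ Q.loopDarts l ↔ e.toEquiv d ∈ R.loopDarts (e.loop l) := by
  constructor
  · rintro ⟨h, rfl⟩
    exact ⟨(e.map_crossed d).mp h, rfl⟩
  · rintro ⟨h, hl⟩
    exact ⟨(e.map_crossed d).mpr h, e.loop.injective hl⟩

theorem isVisited_iff (e : Iso Q R) (f : Q.map.Face) :
    Q.IsVisited f ↔ R.IsVisited (e.face f) := by
  constructor
  · rintro ⟨d, hd, rfl⟩
    exact ⟨e.toEquiv d, (e.map_crossed d).mp hd, rfl⟩
  · rintro ⟨d, hd, hf⟩
    refine ⟨e.toEquiv.symm d, ?_, ?_⟩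
    · rw [e.map_crossed, Equiv.apply_symm_apply]; exact hd
    · apply e.face.injective
      rw [e.face_faceOf, Equiv.apply_symm_apply, hf]

theorem weight_eq (e : Iso Q R) (n g h : ℝ≥0) : Q.weight n g h = R.weight n g h := by
  have h1 : Q.numLoops = R.numLoops := Nat.card_congr e.loop
  have h2 : Q.numUnvisited = R.numUnvisited :=
    Nat.card_congr (e.innerFace.subtypeEquiv fun f => not_congr (e.isVisited_iff f.1))
  have h3 : Q.numVisited = R.numVisited :=
    Nat.card_congr (e.face.subtypeEquiv fun f => e.isVisited_iff f)
  rw [weight, weight, h1, h2, h3]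

theorem isInterior_iff (e : Iso Q R) (l : Q.Loop) (d : Q.map.Dart) :
    Q.IsInterior l d ↔ R.IsInterior (e.loop l) (e.toEquiv d) := by
  let E : Quot (Q.avoidStep l) ≃ Quot (R.avoidStep (e.loop l)) :=
    Quot.congr e.toEquiv fun a b => by
      unfold avoidStep
      rw [← e.map_rot, ← e.map_flip, e.toEquiv.apply_eq_iff_eq, e.toEquiv.apply_eq_iff_eq,
        ← e.mem_loopDarts]
  have h : ∀ a, E (Quot.mk _ a) = Quot.mk _ (e.toEquiv a) := fun _ => rfl
  unfold IsInterior
  rw [← e.map_root, ← h, ← h, Ne, Ne, E.apply_eq_iff_eq]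

theorem mem_gasketDarts (e : Iso Q R) (d : Q.map.Dart) :
    d ∈ Q.gasketDarts ↔ e.toEquiv d ∈ R.gasketDarts :=
  and_congr (not_congr (e.map_crossed d))
    (e.loop.forall_congr fun l => not_congr (e.isInterior_iff l d))

def gasket (e : Iso Q R) : RootedMap.Iso Q.gasket R.gasket where
  toEquiv := e.toEquiv.subtypeEquiv e.mem_gasketDarts
  map_rot d := restrictCycles_conj _ _ _ _ e.toEquiv e.map_rot e.mem_gasketDarts d
  map_flip d := Subtype.ext (e.map_flip d.1)
  map_root := Subtype.ext e.map_root

end Iso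

instance setoid (p : ℕ) : Setoid (LoopQuadrangulation p) where
  r Q R := Nonempty (Iso Q R)
  iseqv := ⟨fun Q => ⟨Iso.refl Q⟩, fun ⟨e⟩ => ⟨e.symm⟩, fun ⟨e⟩ ⟨e'⟩ => ⟨e.trans e'⟩⟩

end LoopQuadrangulation

/-- Loop-decorated (rigid) quadrangulations with a boundary of length `p`, up to isomorphism. -/
def LoopQuadrangulationClass (p : ℕ) : Type 1 := Quotient (LoopQuadrangulation.setoid p)

namespace LoopQuadrangulationClass

variable {p : ℕ}

def weight (n g h : ℝ≥0) : LoopQuadrangulationClass p → ℝ≥0∞ :=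
  Quotient.lift (fun Q => Q.weight n g h) fun _ _ ⟨e⟩ => e.weight_eq n g h

def gasket : LoopQuadrangulationClass p → RootedMapClass :=
  Quotient.map LoopQuadrangulation.gasket fun _ _ ⟨e⟩ => ⟨e.gasket⟩

end LoopQuadrangulationClass

/-- The disk partition function of the rigid `O(n)` loop model: the sum of the weights of all
loop-decorated quadrangulations with a boundary of length `p`. -/
def diskZ (n g h : ℝ≥0) (p : ℕ) : ℝ≥0∞ :=
  ∑' Q : LoopQuadrangulationClass p, Q.weight n g h

/-- The triple `(n, g, h)` is admissible (for the boundary length `p`) if `Z_p` is finite. -/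
def IsAdmissible (n g h : ℝ≥0) (p : ℕ) : Prop := diskZ n g h p ≠ ∞

/-- The law of the random loop-decorated quadrangulation with a boundary of length `p`: the weights
divided by their sum. -/
def loopModelLaw (n g h : ℝ≥0) (p : ℕ) (h₀ : diskZ n g h p ≠ 0) (h₁ : diskZ n g h p ≠ ∞) :
    PMF (LoopQuadrangulationClass p) :=
  PMF.normalize (fun Q => Q.weight n g h) h₀ h₁

/-- The law of the Boltzmann bipartite map with a boundary of length `p`: the Boltzmann weights
divided by their sum. -/
def boltzmannLaw (z : ℕ → ℝ≥0∞) (p : ℕ) (h₀ : boltzmannF z p ≠ 0) (h₁ : boltzmannF z p ≠ ∞) :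
    PMF (BipartiteDiskClass p) :=
  PMF.normalize (fun B => B.weight z) h₀ h₁

/-- The effective face weights `z_k = g δ_{k,4} + n h ^ k Z_k`. -/
def effectiveWeight (n g h : ℝ≥0) (k : ℕ) : ℝ≥0∞ :=
  (if k = 4 then (g : ℝ≥0∞) else 0) + n * (h : ℝ≥0∞) ^ k * diskZ n g h k

end

noncomputable section

/-! ### Cycles of permutations -/

namespace Equiv.Perm

variable {D : Type*} {Y : Type*}

/-! The proof is the gasket decomposition. The gasket of a loop-decorated quadrangulation with
boundary `p` is a bipartite map `B` with boundary `p`. An inner face of `B` of degree `k` is either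
an unvisited quadrangle (`k = 4`, weight `g`) or follows a loop all along its contour. In the second
case rigidity puts exactly one visited quadrangle along each side of the face. These `k` quadrangles
form a rim, contributing one loop and `k` visited faces (weight `n h ^ k`), and the rim surrounds an
arbitrary loop-decorated quadrangulation with boundary `k` (total weight `Z_k`). The contents of
distinct faces are independent, so summing over all fillings of a fixed `B` gives the product of the
`z_{deg f}`.

Hence everything rests on a bijection, `fillClassMap_bijective`, between filled bipartite maps and
loop-decorated quadrangulations, which respects weights (`BipartiteDisk.weight_fill`) and gaskets
(`gasket_fillClassMap`). It yields `tsum_weight_eq`, with an arbitrary test function of the gasket: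
the constant 1 gives (i), and a normalised indicator gives the law in (ii). Positivity holds because
a plane tree is a quadrangulation without inner faces, of weight 1.

Topology enters through permutations of darts only. Gluing is explicit (`GlueData.glue`); its
vertices and faces are found by complete invariants of cycles, and Euler characteristics add up.
Conversely, cutting relies on linear algebra over `ZMod 2`: the coboundaries of vertices and of
faces are orthogonal in the space of edges, which gives Euler's inequality, and equality forces
exactness. Exactness is a discrete Jordan curve theorem (`exists_side_coloring`), separating the two
sides of a loop. Euler's inequality shows that the pieces of a planar map are planar
(`isPlanar_of_glue`).

Cut pieces reglue to the original map because a morphism to a connected map with a single dart above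
the root is an isomorphism. Uniqueness holds because an isomorphism of rooted maps propagates from
the root: it fixes the gasket, hence the holes, the seams and the contents. -/

theorem SameCycle.apply_eq {s : Equiv.Perm D} {f : D → Y} (hf : ∀ a, f (s a) = f a) {a b : D}
    (h : s.SameCycle a b) : f a = f b := by
  obtain ⟨k, rfl⟩ := h
  have hi : ∀ a, f (s⁻¹ a) = f a := fun a => by rw [← hf, ← mul_apply, mul_inv_cancel, one_apply]
  have hn : ∀ (t : Equiv.Perm D), (∀ a, f (t a) = f a) → ∀ (n : ℕ) a, f ((t ^ n) a) = f a := by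
    intro t ht n
    induction n with
    | zero => intro a; simp
    | succ n ih => intro a; rw [pow_succ, mul_apply, ih, ht]
  cases k with
  | ofNat n => simpa using (hn s hf n a).symm
  | negSucc n => simpa [zpow_negSucc, ← inv_pow] using (hn s⁻¹ hi (n + 1) a).symm

theorem SameCycle.map_sameCycle {D' : Type*} {s : Equiv.Perm D} {s' : Equiv.Perm D'} (i : D → D')
    (hi : ∀ a, s'.SameCycle (i a) (i (s a))) {a b : D} (h : s.SameCycle a b) :
    s'.SameCycle (i a) (i b) := by
  have := h.apply_eq (f := fun a => (Quotient.mk (SameCycle.setoid s') (i a)))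
    (fun a => (Quotient.sound (hi a)).symm)
  exact Quotient.exact this

theorem sameCycle_apply_self (s : Equiv.Perm D) (a : D) : s.SameCycle a (s a) := ⟨1, by simp⟩

/-- The cycles of a permutation, counted by a complete invariant. -/
def cyclesEquiv (s : Equiv.Perm D) (f : D → Y) (hs : Function.Surjective f)
    (hf : ∀ a, f (s a) = f a) (h : ∀ a b, f a = f b → s.SameCycle a b) :
    Quotient (SameCycle.setoid s) ≃ Y :=
  Equiv.ofBijective (Quotient.lift f fun _ _ hab => hab.apply_eq hf) <| by
    constructor
    · rintro ⟨a⟩ ⟨b⟩ hab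
      exact Quotient.sound (h a b hab)
    · intro y
      obtain ⟨a, rfl⟩ := hs y
      exact ⟨Quotient.mk _ a, rfl⟩

/-- The inverse of `s` is a nonnegative power of `s`, because `D` is finite. -/
theorem mem_of_apply_mem [Finite D] (s : Equiv.Perm D) {S : Set D} (hS : ∀ d ∈ S, s d ∈ S) {d : D}
    (hd : s d ∈ S) : d ∈ S := by
  have hn : ∀ (n : ℕ), ∀ d ∈ S, (s ^ n) d ∈ S := by
    intro n
    induction n with
    | zero => intro d hd; simpa using hd
    | succ n ih => intro d hd; rw [pow_succ, mul_apply]; exact ih _ (hS _ hd)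
  have h1 := hn (orderOf s - 1) _ hd
  rw [← mul_apply, ← pow_succ, Nat.sub_add_cancel (orderOf_pos s), pow_orderOf_eq_one] at h1
  simpa using h1

end Equiv.Perm

/-! ### Vertices, edges and faces of a rooted map. -/

namespace RootedMap

variable (M : RootedMap)

theorem next_apply (d : M.Dart) : M.next d = M.rot (M.flip d) := rfl

theorem rot_apply (d : M.Dart) : M.rot d = M.next (M.flip d) := by
  rw [next_apply, M.flip_flip]

theorem next_flip (d : M.Dart) : M.next (M.flip d) = M.rot d := (M.rot_apply d).symm

@[simp] theorem faceOf_next (d : M.Dart) : M.faceOf (M.next d) = M.faceOf d :=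
  (M.faceOf_eq_iff_sameCycle _ _).2 (Equiv.Perm.sameCycle_apply_self _ _).symm

@[simp] theorem faceOf_next_symm (d : M.Dart) : M.faceOf (M.next.symm d) = M.faceOf d := by
  rw [← M.faceOf_next, Equiv.apply_symm_apply]

@[simp] theorem vertexOf_rot (d : M.Dart) : M.vertexOf (M.rot d) = M.vertexOf d :=
  Quotient.sound (Equiv.Perm.sameCycle_apply_self M.rot d).symm

theorem vertexOf_next (d : M.Dart) : M.vertexOf (M.next d) = M.vertexOf (M.flip d) := by
  rw [next_apply, vertexOf_rot]

theorem vertexOf_eq_iff_sameCycle (a b : M.Dart) :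
    M.vertexOf a = M.vertexOf b ↔ M.rot.SameCycle a b :=
  Quotient.eq (r := Equiv.Perm.SameCycle.setoid M.rot)

theorem faceOf_surjective : Function.Surjective M.faceOf := Quotient.mk_surjective

theorem vertexOf_surjective : Function.Surjective M.vertexOf := Quotient.mk_surjective

instance : Finite M.Face := Finite.of_surjective _ M.faceOf_surjective

instance : Finite M.Vertex := Finite.of_surjective _ M.vertexOf_surjective

instance : Finite M.InnerFace := inferInstanceAs (Finite {f : M.Face // f ≠ M.outerFace})

def edgeOf (d : M.Dart) : M.Edge := Quotient.mk _ d

theorem edgeOf_surjective : Function.Surjective M.edgeOf := Quotient.mk_surjective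

instance : Finite M.Edge := Finite.of_surjective _ M.edgeOf_surjective

theorem edgeOf_eq_iff (a b : M.Dart) : M.edgeOf a = M.edgeOf b ↔ b = a ∨ b = M.flip a := by
  constructor
  · intro h
    have h' : M.flip.SameCycle a b := Quotient.exact h
    have := h'.apply_eq (f := fun x => ({x, M.flip x} : Set M.Dart))
      (fun x => by simp only [M.flip_flip]; exact Set.pair_comm _ _)
    have hb : b ∈ ({a, M.flip a} : Set M.Dart) := by rw [this]; simp
    simpa using hb
  · rintro (rfl | rfl)
    · rfl
    · exact Quotient.sound (Equiv.Perm.sameCycle_apply_self M.flip a)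

def edgeRep (e : M.Edge) : M.Dart := Quotient.out e

theorem edgeOf_edgeRep (e : M.Edge) : M.edgeOf (M.edgeRep e) = e := Quotient.out_eq e

theorem edgeOf_flip (d : M.Dart) : M.edgeOf (M.flip d) = M.edgeOf d :=
  (M.edgeOf_eq_iff _ _).2 (Or.inr (M.flip_flip d).symm)

theorem edgeRep_edgeOf (d : M.Dart) :
    M.edgeRep (M.edgeOf d) = d ∨ M.edgeRep (M.edgeOf d) = M.flip d :=
  (M.edgeOf_eq_iff d _).1 (M.edgeOf_edgeRep _).symm

/-- Each edge carries two darts. -/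
def edgeSumEdge : M.Edge ⊕ M.Edge ≃ M.Dart :=
  Equiv.ofBijective (Sum.elim M.edgeRep fun e => M.flip (M.edgeRep e)) <| by
    constructor
    · rintro (a | a) (b | b) h
      · simpa [edgeOf_edgeRep] using congrArg M.edgeOf h
      · exfalso
        simp only [Sum.elim_inl, Sum.elim_inr] at h
        have : a = b := by simpa [edgeOf_edgeRep, edgeOf_flip] using congrArg M.edgeOf h
        subst this
        exact M.flip_ne _ h.symm
      · exfalso
        simp only [Sum.elim_inl, Sum.elim_inr] at h
        have : a = b := by simpa [edgeOf_edgeRep, edgeOf_flip] using congrArg M.edgeOf h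
        subst this
        exact M.flip_ne _ h
      · simpa [edgeOf_edgeRep, edgeOf_flip] using congrArg M.edgeOf h
    · intro d
      rcases M.edgeRep_edgeOf d with h | h
      · exact ⟨Sum.inl (M.edgeOf d), h⟩
      · exact ⟨Sum.inr (M.edgeOf d), by simp [h, M.flip_flip]⟩

theorem card_dart : Nat.card M.Dart = 2 * Nat.card M.Edge := by
  rw [← Nat.card_congr M.edgeSumEdge, Nat.card_sum]; ring

variable {M}

/-! ### Connectedness -/

/-- Stability under `rot` and `flip` suffices: by finiteness `S` is then stable under their
inverses, hence under the group they generate. -/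
theorem IsConnected.induction (hM : M.IsConnected) {S : Set M.Dart} (a : M.Dart) (ha : a ∈ S)
    (hrot : ∀ d ∈ S, M.rot d ∈ S) (hflip : ∀ d ∈ S, M.flip d ∈ S) (d : M.Dart) : d ∈ S := by
  have key : ∀ s ∈ Subgroup.closure {M.rot, M.flip}, ∀ d, s d ∈ S ↔ d ∈ S := by
    intro s hs
    induction hs using Subgroup.closure_induction with
    | mem x hx =>
      rcases hx with rfl | rfl
      · exact fun d => ⟨M.rot.mem_of_apply_mem hrot, hrot d⟩
      · exact fun d => ⟨M.flip.mem_of_apply_mem hflip, hflip d⟩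
    | one => simp
    | mul x y _ _ hx hy => intro d; rw [Equiv.Perm.mul_apply, hx, hy]
    | inv x _ hx => intro d; rw [← hx, ← Equiv.Perm.mul_apply, mul_inv_cancel]; simp
  obtain ⟨s, hs, rfl⟩ := hM a d
  exact (key s hs a).2 ha

theorem IsConnected.induction_next (hM : M.IsConnected) {S : Set M.Dart} (a : M.Dart) (ha : a ∈ S)
    (hnext : ∀ d ∈ S, M.next d ∈ S) (hflip : ∀ d ∈ S, M.flip d ∈ S) (d : M.Dart) : d ∈ S :=
  hM.induction a ha (fun d hd => by rw [rot_apply]; exact hnext _ (hflip _ hd)) hflip d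

theorem isConnected_of (h : ∀ S : Set M.Dart, M.root ∈ S → (∀ d ∈ S, M.rot d ∈ S) →
    (∀ d ∈ S, M.flip d ∈ S) → ∀ d, d ∈ S) : M.IsConnected := by
  have key : ∀ b, ∃ s ∈ Subgroup.closure {M.rot, M.flip}, s M.root = b := by
    refine h {b | ∃ s ∈ Subgroup.closure {M.rot, M.flip}, s M.root = b} ⟨1, one_mem _, rfl⟩ ?_ ?_
    · rintro _ ⟨s, hs, rfl⟩
      exact ⟨M.rot * s, mul_mem (Subgroup.subset_closure (by simp)) hs, rfl⟩
    · rintro _ ⟨s, hs, rfl⟩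
      exact ⟨M.flip * s, mul_mem (Subgroup.subset_closure (by simp)) hs, rfl⟩
  intro a b
  obtain ⟨s, hs, rfl⟩ := key a
  obtain ⟨t, ht, rfl⟩ := key b
  exact ⟨t * s⁻¹, mul_mem ht (inv_mem hs), by simp⟩

/-- A morphism to a connected map such that the root has a single preimage is an isomorphism. -/
theorem bijective_of_root_fiber {M N : RootedMap} (hN : N.IsConnected) (φ : M.Dart → N.Dart)
    (hnext : ∀ d, φ (M.next d) = N.next (φ d)) (hflip : ∀ d, φ (M.flip d) = N.flip (φ d))
    (hroot : φ M.root = N.root) (hfib : ∀ d, φ d = N.root → d = M.root) :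
    Function.Bijective φ := by
  constructor
  -- Having at most one preimage passes from `b` to `N.next b` and `N.flip b`, since `φ` intertwines
  -- permutations of both sides; it holds at the root by `hfib`.
  · have := hN.induction_next (S := {b | ∀ a a', φ a = b → φ a' = b → a = a'}) N.root
      (fun a a' h h' => (hfib a h).trans (hfib a' h').symm) ?_ ?_
    · exact fun a a' h => this (φ a) a a' rfl h.symm
    · intro b hb a a' h h'
      have := hb (M.next.symm a) (M.next.symm a')
        (N.next.injective (by rw [← hnext, Equiv.apply_symm_apply, h]))
        (N.next.injective (by rw [← hnext, Equiv.apply_symm_apply, h']))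
      exact M.next.symm.injective this
    · intro b hb a a' h h'
      have := hb (M.flip a) (M.flip a')
        (N.flip.injective (by rw [← hflip, M.flip_flip, h]))
        (N.flip.injective (by rw [← hflip, M.flip_flip, h']))
      exact M.flip.injective this
  · refine hN.induction_next (S := Set.range φ) N.root ⟨_, hroot⟩ ?_ ?_
    · rintro _ ⟨a, rfl⟩
      exact ⟨_, hnext a⟩
    · rintro _ ⟨a, rfl⟩
      exact ⟨_, hflip a⟩

/-- A bijective morphism of rooted maps. -/
def isoOfBijective {M N : RootedMap} (φ : M.Dart → N.Dart) (hφ : Function.Bijective φ)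
    (hnext : ∀ d, φ (M.next d) = N.next (φ d)) (hflip : ∀ d, φ (M.flip d) = N.flip (φ d))
    (hroot : φ M.root = N.root) : Iso M N where
  toEquiv := Equiv.ofBijective φ hφ
  map_rot d := by
    simp only [Equiv.ofBijective_apply]
    rw [rot_apply, rot_apply, hnext, hflip]
  map_flip := hflip
  map_root := hroot

theorem Iso.isConnected {M N : RootedMap} (e : Iso M N) (hM : M.IsConnected) : N.IsConnected := by
  refine isConnected_of fun S h1 h2 h3 d => ?_
  have := hM.induction (S := {d | e.toEquiv d ∈ S}) M.root (by simpa [e.map_root] using h1)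
    (fun d hd => by simpa [e.map_rot] using h2 _ hd)
    (fun d hd => by simpa [e.map_flip] using h3 _ hd) (e.toEquiv.symm d)
  simpa using this

def Iso.vertex {M N : RootedMap} (e : Iso M N) : M.Vertex ≃ N.Vertex :=
  M.rot.cyclesEquiv (fun d => N.vertexOf (e.toEquiv d))
    (N.vertexOf_surjective.comp e.toEquiv.surjective) (fun d => by rw [e.map_rot, vertexOf_rot])
    (fun a b h => by
      rw [vertexOf_eq_iff_sameCycle] at h
      have := h.map_sameCycle (s' := M.rot) e.symm.toEquiv
        (fun d => by rw [e.symm.map_rot]; exact Equiv.Perm.sameCycle_apply_self _ _)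
      simpa [Iso.symm] using this)

theorem Iso.card_edge {M N : RootedMap} (e : Iso M N) : Nat.card M.Edge = Nat.card N.Edge := by
  have h1 := M.card_dart
  have h2 := N.card_dart
  have h3 := Nat.card_congr e.toEquiv
  omega

theorem Iso.isPlanar {M N : RootedMap} (e : Iso M N) (hM : M.IsPlanar) : N.IsPlanar :=
  ⟨e.isConnected hM.1, by
    rw [← e.card_edge, ← Nat.card_congr e.vertex, ← Nat.card_congr e.face, hM.2]⟩

theorem Iso.boundaryLength {M N : RootedMap} (e : Iso M N) :
    M.boundaryLength = N.boundaryLength := by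
  rw [RootedMap.boundaryLength, RootedMap.boundaryLength, ← e.face_outerFace, e.degree_face]

end RootedMap

/-! ### Euler's inequality and the homology of planar maps -/

section Orthogonal

variable {K V F E : Type*} [Field K] [Finite V] [Finite F] [Fintype E]

/-- Rank-nullity gives ranges of dimensions `|V| - 1` and `|F| - 1`. The range of `f` lies in the
orthogonal of the range of `g`, which has dimension `|E| - (|F| - 1)` because the dot product is
nondegenerate. Equality of dimensions makes the inclusion an equality, which is the exactness
statement. -/
theorem card_add_card_le_of_orthogonal (f : (V → K) →ₗ[K] (E → K)) (g : (F → K) →ₗ[K] (E → K))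
    (hfg : ∀ x y, ∑ e, g y e * f x e = 0) (hf : Module.finrank K (LinearMap.ker f) = 1)
    (hg : Module.finrank K (LinearMap.ker g) = 1) :
    Nat.card V + Nat.card F ≤ Nat.card E + 2 ∧
      (Nat.card V + Nat.card F = Nat.card E + 2 →
        ∀ w : E → K, (∀ y, ∑ e, g y e * w e = 0) → ∃ x, f x = w) := by
  have := Fintype.ofFinite V
  have := Fintype.ofFinite F
  let B : LinearMap.BilinForm K (E → K) := dotProductBilin K K
  have hker : LinearMap.ker B = ⊥ := by
    rw [LinearMap.ker_eq_bot']
    intro w hw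
    exact dotProduct_eq_zero w fun v => by simpa [B] using DFunLike.congr_fun hw v
  have h1 := LinearMap.BilinForm.finrank_add_finrank_orthogonal' (B := B) (LinearMap.range g)
  rw [hker, inf_bot_eq, finrank_bot, add_zero] at h1
  have hle : LinearMap.range f ≤ B.orthogonal (LinearMap.range g) := by
    rintro _ ⟨x, rfl⟩
    rw [LinearMap.BilinForm.mem_orthogonal_iff]
    rintro _ ⟨y, rfl⟩
    exact hfg x y
  have h2 := f.finrank_range_add_finrank_ker
  have h3 := g.finrank_range_add_finrank_ker
  rw [Module.finrank_fintype_fun_eq_card] at h1 h2 h3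
  have h4 := Submodule.finrank_mono hle
  simp only [Nat.card_eq_fintype_card]
  refine ⟨by omega, fun h w hw => ?_⟩
  have heq := Submodule.eq_of_le_of_finrank_eq hle (by omega)
  have : w ∈ B.orthogonal (LinearMap.range g) := by
    rw [LinearMap.BilinForm.mem_orthogonal_iff]
    rintro _ ⟨y, rfl⟩
    exact hw y
  rw [← heq] at this
  exact this

end Orthogonal

namespace RootedMap

variable (M : RootedMap)

/-- The coboundary of a function on the orbits of a family of darts. -/
def coboundary {X : Type*} (q : M.Dart → X) : (X → ZMod 2) →ₗ[ZMod 2] (M.Edge → ZMod 2) where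
  toFun x e := x (q (M.edgeRep e)) + x (q (M.flip (M.edgeRep e)))
  map_add' x y := by ext e; simp only [Pi.add_apply]; ring
  map_smul' a x := by ext e; simp only [Pi.smul_apply, smul_eq_mul, RingHom.id_apply]; ring

theorem coboundary_edgeOf {X : Type*} (q : M.Dart → X) (x : X → ZMod 2) (d : M.Dart) :
    M.coboundary q x (M.edgeOf d) = x (q d) + x (q (M.flip d)) := by
  change x (q (M.edgeRep _)) + x (q (M.flip (M.edgeRep _))) = _
  rcases M.edgeRep_edgeOf d with h | h
  · rw [h]
  · rw [h, M.flip_flip, add_comm]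

/-- In characteristic 2, a function in the kernel takes equal values at both ends of every edge;
connectedness, in the form `hc`, leaves only the constants. -/
theorem finrank_ker_coboundary {X : Type*} [Finite X] (q : M.Dart → X)
    (hq : Function.Surjective q)
    (hc : ∀ x : X → ZMod 2, (∀ d, x (q (M.flip d)) = x (q d)) → ∀ d, x (q d) = x (q M.root)) :
    Module.finrank (ZMod 2) (LinearMap.ker (M.coboundary q)) = 1 := by
  refine finrank_eq_one ⟨fun _ => 1, ?_⟩ ?_ ?_
  · rw [LinearMap.mem_ker]
    ext e
    exact CharTwo.add_self_eq_zero (1 : ZMod 2)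
  · intro h
    have := congrFun (congrArg Subtype.val h) (q M.root)
    simp at this
  · rintro ⟨x, hx⟩
    refine ⟨x (q M.root), Subtype.ext (funext fun y => ?_)⟩
    obtain ⟨d, rfl⟩ := hq y
    have := hc x (fun d => by
      have h := congrFun (LinearMap.mem_ker.1 hx) (M.edgeOf d)
      rw [coboundary_edgeOf] at h
      exact (CharTwo.add_eq_zero.1 h).symm) d
    simp [this]

variable {M}

theorem sum_edge_eq_sum_dart [Fintype M.Edge] [Fintype M.Dart] {A : Type*} [AddCommMonoid A]
    (g : M.Dart → A) : ∑ e, (g (M.edgeRep e) + g (M.flip (M.edgeRep e))) = ∑ d, g d := by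
  rw [← M.edgeSumEdge.sum_comp, Fintype.sum_sum_type, Finset.sum_add_distrib]
  rfl

theorem sum_coboundary_mul [Fintype M.Edge] [Fintype M.Dart] {X : Type*} (q : M.Dart → X)
    (y : X → ZMod 2) (w : M.Dart → ZMod 2) (hw : ∀ d, w (M.flip d) = w d) :
    ∑ e, M.coboundary q y e * w (M.edgeRep e) = ∑ d, y (q d) * w d := by
  rw [← sum_edge_eq_sum_dart]
  refine Finset.sum_congr rfl fun e _ => ?_
  rw [hw, ← add_mul]
  rfl

/-- Written over darts, the sum pairs the face of `d` with both ends of `d`. Turning along the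
contour by `next` replaces the far end by the near end without changing the face, so every term
occurs twice. -/
theorem coboundary_orthogonal [Fintype M.Edge] (x : M.Vertex → ZMod 2) (y : M.Face → ZMod 2) :
    ∑ e, M.coboundary M.faceOf y e * M.coboundary M.vertexOf x e = 0 := by
  have := Fintype.ofFinite M.Dart
  have h := sum_coboundary_mul M.faceOf y
    (fun d => x (M.vertexOf d) + x (M.vertexOf (M.flip d)))
    (fun d => by rw [M.flip_flip, add_comm])
  refine Eq.trans h ?_
  have h2 : ∑ d, y (M.faceOf d) * x (M.vertexOf (M.flip d)) =
      ∑ d, y (M.faceOf d) * x (M.vertexOf d) := by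
    rw [← Equiv.sum_comp M.next (fun d => y (M.faceOf d) * x (M.vertexOf d))]
    exact Finset.sum_congr rfl fun d _ => by rw [faceOf_next, vertexOf_next]
  simp only [mul_add, Finset.sum_add_distrib, h2]
  exact CharTwo.add_self_eq_zero _

theorem IsConnected.eq_root (hM : M.IsConnected) {Y : Type*} (u : M.Dart → Y)
    (hrot : ∀ d, u (M.rot d) = u d) (hflip : ∀ d, u (M.flip d) = u d) (d : M.Dart) :
    u d = u M.root :=
  hM.induction (S := {d | u d = u M.root}) M.root rfl (fun d hd => (hrot d).trans hd)
    (fun d hd => (hflip d).trans hd) d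

theorem IsConnected.card_le_and_exact (hM : M.IsConnected) [Fintype M.Edge] :
    Nat.card M.Vertex + Nat.card M.Face ≤ Nat.card M.Edge + 2 ∧
      (Nat.card M.Vertex + Nat.card M.Face = Nat.card M.Edge + 2 →
        ∀ w : M.Edge → ZMod 2, (∀ y, ∑ e, M.coboundary M.faceOf y e * w e = 0) →
          ∃ x, M.coboundary M.vertexOf x = w) :=
  card_add_card_le_of_orthogonal (M.coboundary M.vertexOf) (M.coboundary M.faceOf)
    coboundary_orthogonal
    (M.finrank_ker_coboundary _ M.vertexOf_surjective fun x h d =>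
      hM.eq_root (fun d => x (M.vertexOf d)) (fun d => by simp) h d)
    (M.finrank_ker_coboundary _ M.faceOf_surjective fun x h d =>
      hM.eq_root (fun d => x (M.faceOf d))
        (fun d => by rw [rot_apply, faceOf_next]; exact h _) h d)

/-- Euler's inequality: the genus is nonnegative. -/
theorem IsConnected.card_le (hM : M.IsConnected) :
    Nat.card M.Vertex + Nat.card M.Face ≤ Nat.card M.Edge + 2 := by
  have := Fintype.ofFinite M.Edge
  exact hM.card_le_and_exact.1

/-- On a planar map, a set of edges having an even number of sides in each face is the cut of a
two-colouring of the vertices. -/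
theorem IsPlanar.exists_coloring (hM : M.IsPlanar) [Fintype M.Dart] [DecidableEq M.Face]
    (w : M.Dart → ZMod 2)
    (hw : ∀ d, w (M.flip d) = w d) (hf : ∀ f, ∑ d with M.faceOf d = f, w d = 0) :
    ∃ c : M.Vertex → ZMod 2, ∀ d, c (M.vertexOf (M.flip d)) = c (M.vertexOf d) + w d := by
  classical
  have := Fintype.ofFinite M.Edge
  have := Fintype.ofFinite M.Face
  obtain ⟨x, hx⟩ := hM.1.card_le_and_exact.2 hM.2 (fun e => w (M.edgeRep e)) fun y => by
    rw [sum_coboundary_mul M.faceOf y w hw, ← Finset.sum_fiberwise_of_maps_to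
      (g := M.faceOf) (t := Finset.univ) (fun _ _ => Finset.mem_univ _)]
    refine Finset.sum_eq_zero fun f _ => ?_
    calc _ = ∑ d with M.faceOf d = f, y f * w d :=
          Finset.sum_congr rfl fun d hd => by rw [(Finset.mem_filter.1 hd).2]
      _ = 0 := by rw [← Finset.mul_sum, hf, mul_zero]
  refine ⟨x, fun d => ?_⟩
  have h := congrFun hx (M.edgeOf d)
  rw [coboundary_edgeOf] at h
  have h2 : w (M.edgeRep (M.edgeOf d)) = w d := by
    rcases M.edgeRep_edgeOf d with h | h
    · rw [h]
    · rw [h, hw]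
  rw [← h2, ← h, ← add_assoc, CharTwo.add_self_eq_zero, zero_add]

/-- A planar map all of whose faces have even degree is bipartite. -/
theorem IsPlanar.isBipartite (hM : M.IsPlanar) (h : ∀ f, Even (M.degree f)) : M.IsBipartite := by
  classical
  have := Fintype.ofFinite M.Dart
  obtain ⟨c, hc⟩ := hM.exists_coloring (fun _ => 1) (fun _ => rfl) fun f => by
    have := h f
    rw [degree, Nat.card_eq_fintype_card, Fintype.card_subtype] at this
    simpa using (ZMod.natCast_eq_zero_iff_even).2 this
  refine ⟨fun v => decide (c v = 0), fun d hd => ?_⟩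
  have h1 := hc d
  rw [decide_eq_decide] at hd
  rw [h1] at hd
  revert hd
  generalize c (M.vertexOf d) = t
  revert t
  decide

end RootedMap

/-! ### Filling faces of a map with rims of quadrangles and disks -/

namespace RootedMap

/-- The permutation of the darts of a face following its contour. -/
def faceNext (M : RootedMap) (f : M.Face) : Equiv.Perm {d // M.faceOf d = f} :=
  M.next.subtypeEquiv fun d => by rw [faceOf_next]

@[simp] theorem faceNext_val (M : RootedMap) (f : M.Face) (d) :
    (M.faceNext f d).1 = M.next d.1 := rfl

@[simp] theorem faceNext_symm_val (M : RootedMap) (f : M.Face) (d) :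
    ((M.faceNext f).symm d).1 = M.next.symm d.1 := rfl

end RootedMap

/-- A map, some faces of which (the holes) are to be filled with a map with a boundary of the same
length, after insertion of a rim of quadrangles; `seam` matches the sides of a hole with the
boundary of the disk, in reverse order. -/
structure GlueData : Type 1 where
  base : RootedMap
  holes : Set base.Face
  outer_notMem : base.outerFace ∉ holes
  disk : holes → RootedMap
  seam (j : holes) :
    {d // base.faceOf d = j.1} ≃ {e // (disk j).faceOf e = (disk j).outerFace}
  seam_next : ∀ j d, (disk j).next (seam j (base.faceNext _ d)).1 = (seam j d).1

namespace GlueData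

variable (G : GlueData)

abbrev Side (j : G.holes) : Type := {d // G.base.faceOf d = j.1}

/-- The darts of the glued map: those of the base, those of the disks, and for each side of a hole
the two crossed darts of the quadrangle of the rim glued along it. -/
inductive Dart : Type
  | base (d : G.base.Dart)
  | inner (j : G.holes) (e : (G.disk j).Dart)
  | rimIn (j : G.holes) (d : G.Side j)
  | rimOut (j : G.holes) (d : G.Side j)

def dartEquiv : G.Dart ≃ G.base.Dart ⊕ Σ j : G.holes, ((G.disk j).Dart ⊕ (G.Side j ⊕ G.Side j)) where
  toFun
    | .base d => Sum.inl d
    | .inner j e => Sum.inr ⟨j, Sum.inl e⟩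
    | .rimIn j d => Sum.inr ⟨j, Sum.inr (Sum.inl d)⟩
    | .rimOut j d => Sum.inr ⟨j, Sum.inr (Sum.inr d)⟩
  invFun
    | Sum.inl d => .base d
    | Sum.inr ⟨j, Sum.inl e⟩ => .inner j e
    | Sum.inr ⟨j, Sum.inr (Sum.inl d)⟩ => .rimIn j d
    | Sum.inr ⟨j, Sum.inr (Sum.inr d)⟩ => .rimOut j d
  left_inv a := by cases a <;> rfl
  right_inv a := by rcases a with d | ⟨j, e | d | d⟩ <;> rfl

instance : Finite G.Dart := Finite.of_equiv _ G.dartEquiv.symm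

-- The contour of the rim quadrangle along a side `d` is `base d`, `rimIn d`, `inner (seam d)`,
-- `rimOut d`, so its crossed darts are opposite. Holes and outer faces of disks are thus cut up
-- into quadrangles; the other faces keep their contours.
open Classical in
def nextFun : G.Dart → G.Dart
  | .base d => if h : G.base.faceOf d ∈ G.holes then .rimIn ⟨_, h⟩ ⟨d, rfl⟩ else .base (G.base.next d)
  | .inner j e =>
    if h : (G.disk j).faceOf e = (G.disk j).outerFace then .rimOut j ((G.seam j).symm ⟨e, h⟩)
    else .inner j ((G.disk j).next e)
  | .rimIn j d => .inner j (G.seam j d).1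
  | .rimOut _ d => .base d.1

theorem nextFun_base_of_mem {d} (j : G.holes) (h : G.base.faceOf d = j.1) :
    G.nextFun (.base d) = .rimIn j ⟨d, h⟩ := by
  obtain ⟨j, hj⟩ := j
  obtain rfl : G.base.faceOf d = j := h
  simp [nextFun, hj]

theorem nextFun_base_of_notMem {d} (h : G.base.faceOf d ∉ G.holes) :
    G.nextFun (.base d) = .base (G.base.next d) := by simp [nextFun, h]

theorem nextFun_inner_of_eq {j e} (h : (G.disk j).faceOf e = (G.disk j).outerFace) :
    G.nextFun (.inner j e) = .rimOut j ((G.seam j).symm ⟨e, h⟩) := by simp [nextFun, h]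

theorem nextFun_inner_of_ne {j e} (h : (G.disk j).faceOf e ≠ (G.disk j).outerFace) :
    G.nextFun (.inner j e) = .inner j ((G.disk j).next e) := by simp [nextFun, h]

theorem nextFun_seam (j : G.holes) (d : G.Side j) :
    G.nextFun (.inner j (G.seam j d).1) = .rimOut j d := by
  rw [nextFun_inner_of_eq G (G.seam j d).2]; simp

theorem nextFun_surjective : Function.Surjective G.nextFun := by
  rintro (d | ⟨j, e⟩ | ⟨j, d⟩ | ⟨j, d⟩)
  · by_cases h : G.base.faceOf d ∈ G.holes
    · exact ⟨.rimOut ⟨_, h⟩ ⟨d, rfl⟩, rfl⟩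
    · refine ⟨.base (G.base.next.symm d), ?_⟩
      rw [nextFun_base_of_notMem G (by simpa using h), Equiv.apply_symm_apply]
  · by_cases h : (G.disk j).faceOf e = (G.disk j).outerFace
    · refine ⟨.rimIn j ((G.seam j).symm ⟨e, h⟩), ?_⟩
      simp [nextFun]
    · refine ⟨.inner j ((G.disk j).next.symm e), ?_⟩
      rw [nextFun_inner_of_ne G (by simpa using h), Equiv.apply_symm_apply]
  · exact ⟨.base d.1, G.nextFun_base_of_mem j d.2⟩
  · exact ⟨_, G.nextFun_seam j d⟩

def nextPerm : Equiv.Perm G.Dart :=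
  Equiv.ofBijective G.nextFun (Finite.surjective_iff_bijective.mp G.nextFun_surjective)

/-- Consecutive quadrangles of a rim share a crossed edge: the exit of the one along `d` is the
entrance of the one along the next side. -/
def flipFun : G.Dart → G.Dart
  | .base d => .base (G.base.flip d)
  | .inner j e => .inner j ((G.disk j).flip e)
  | .rimIn j d => .rimOut j (G.base.faceNext _ d)
  | .rimOut j d => .rimIn j ((G.base.faceNext _).symm d)

theorem flipFun_flipFun : Function.Involutive G.flipFun := by
  rintro (d | ⟨j, e⟩ | ⟨j, d⟩ | ⟨j, d⟩)
  · simp [flipFun, G.base.flip_flip]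
  · simp [flipFun, (G.disk j).flip_flip]
  · simp [flipFun]
  · simp [flipFun]

/-- The glued map. -/
abbrev glue : RootedMap where
  Dart := G.Dart
  finite_dart := inferInstance
  rot := G.nextPerm * G.flipFun_flipFun.toPerm
  flip := G.flipFun_flipFun.toPerm
  flip_flip := G.flipFun_flipFun
  flip_ne := by
    rintro (d | ⟨j, e⟩ | ⟨j, d⟩ | ⟨j, d⟩) h
    · exact G.base.flip_ne d (Dart.base.inj h)
    · simp only [Function.Involutive.coe_toPerm, flipFun, Dart.inner.injEq, heq_eq_eq,
        true_and] at h
      exact (G.disk j).flip_ne e h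
    · cases h
    · cases h
  root := .base G.base.root

theorem glue_next (a : G.Dart) : G.glue.next a = G.nextFun a := by
  rw [RootedMap.next_apply]
  change G.nextFun (G.flipFun (G.flipFun a)) = _
  rw [G.flipFun_flipFun]

theorem glue_rot (a : G.Dart) : G.glue.rot a = G.nextFun (G.flipFun a) := rfl

/-- The induced order of the darts of the base around a vertex. -/
theorem rot_base (d : G.base.Dart) :
    G.glue.rot (.base d) = .base (G.base.rot d) ∨
      (∃ j e, G.glue.rot (.base d) = .rimIn j e) ∧
        G.glue.rot (G.glue.rot (.base d)) = .base (G.base.rot d) := by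
  rw [glue_rot]
  by_cases h : G.base.faceOf (G.base.flip d) ∈ G.holes
  · right
    refine ⟨⟨⟨_, h⟩, ⟨_, rfl⟩, G.nextFun_base_of_mem ⟨_, h⟩ rfl⟩, ?_⟩
    change G.glue.rot (G.nextFun (.base (G.base.flip d))) = _
    rw [G.nextFun_base_of_mem ⟨_, h⟩ rfl, G.base.rot_apply]
    rfl
  · left
    change G.nextFun (.base (G.base.flip d)) = _
    rw [nextFun_base_of_notMem G h, G.base.rot_apply]

/-! #### Vertices -/

/-- Rims add no vertex: a crossed dart `rimIn` starts at a vertex of the base, the end of its side,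
and `rimOut` at a vertex of the disk. -/
def vertexMap : G.Dart → G.base.Vertex ⊕ Σ j : G.holes, (G.disk j).Vertex
  | .base d => Sum.inl (G.base.vertexOf d)
  | .inner j e => Sum.inr ⟨j, (G.disk j).vertexOf e⟩
  | .rimIn _ d => Sum.inl (G.base.vertexOf (G.base.next d.1))
  | .rimOut j d => Sum.inr ⟨j, (G.disk j).vertexOf ((G.disk j).flip (G.seam j d).1)⟩

theorem vertexMap_nextFun (a : G.Dart) : G.vertexMap (G.nextFun a) = G.vertexMap (G.flipFun a) := by
  rcases a with d | ⟨j, e⟩ | ⟨j, d⟩ | ⟨j, d⟩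
  · by_cases h : G.base.faceOf d ∈ G.holes
    · rw [G.nextFun_base_of_mem ⟨_, h⟩ rfl]
      simp [vertexMap, flipFun, G.base.vertexOf_next]
    · rw [nextFun_base_of_notMem G h]
      simp [vertexMap, flipFun, G.base.vertexOf_next]
  · by_cases h : (G.disk j).faceOf e = (G.disk j).outerFace
    · rw [nextFun_inner_of_eq G h]
      simp [vertexMap, flipFun]
    · rw [nextFun_inner_of_ne G h]
      simp [vertexMap, flipFun, (G.disk j).vertexOf_next]
  · simp only [nextFun, flipFun, vertexMap]
    rw [← (G.disk j).vertexOf_next, seam_next]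
  · simp [nextFun, flipFun, vertexMap]

theorem vertexMap_rot (a : G.Dart) : G.vertexMap (G.glue.rot a) = G.vertexMap a := by
  rw [glue_rot, vertexMap_nextFun, G.flipFun_flipFun]

theorem sameCycle_rot_base {d d' : G.base.Dart} (h : G.base.vertexOf d = G.base.vertexOf d') :
    G.glue.rot.SameCycle (.base d) (.base d') := by
  rw [RootedMap.vertexOf_eq_iff_sameCycle] at h
  refine h.map_sameCycle Dart.base fun a => ?_
  rcases G.rot_base a with h | ⟨-, h⟩
  · rw [← h]; exact Equiv.Perm.sameCycle_apply_self G.glue.rot _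
  · rw [← h]; exact ⟨2, rfl⟩

theorem sameCycle_rot_inner {j : G.holes} {d d' : (G.disk j).Dart}
    (h : (G.disk j).vertexOf d = (G.disk j).vertexOf d') :
    G.glue.rot.SameCycle (.inner j d) (.inner j d') := by
  rw [RootedMap.vertexOf_eq_iff_sameCycle] at h
  refine h.map_sameCycle (Dart.inner j) fun a => ?_
  by_cases ha : (G.disk j).faceOf ((G.disk j).flip a) = (G.disk j).outerFace
  -- At this corner of the boundary of the disk, a single dart `rimOut` has been inserted between
  -- `a` and its successor.
  · refine ⟨2, ?_⟩
    change G.nextFun (G.flipFun (G.nextFun (G.flipFun (.inner j a)))) = _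
    simp only [flipFun]
    rw [nextFun_inner_of_eq G ha]
    simp only [nextFun]
    congr 1
    have := G.seam_next j ((G.base.faceNext _).symm ((G.seam j).symm ⟨_, ha⟩))
    rw [← this, Equiv.apply_symm_apply, Equiv.apply_symm_apply, (G.disk j).rot_apply]
  · refine ⟨1, ?_⟩
    change G.nextFun (G.flipFun (.inner j a)) = _
    simp only [flipFun]
    rw [nextFun_inner_of_ne G ha, (G.disk j).rot_apply]

theorem sameCycle_rot_rimIn (j : G.holes) (d : G.Side j) :
    G.glue.rot.SameCycle (.rimIn j d) (.base (G.base.next d.1)) := ⟨1, rfl⟩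

theorem sameCycle_rot_rimOut (j : G.holes) (d : G.Side j) :
    G.glue.rot.SameCycle (.rimOut j d) (.inner j ((G.disk j).flip (G.seam j d).1)) := by
  refine Equiv.Perm.SameCycle.symm ⟨1, ?_⟩
  change G.nextFun (.inner j ((G.disk j).flip ((G.disk j).flip (G.seam j d).1))) = _
  rw [(G.disk j).flip_flip, nextFun_seam]

theorem sameCycle_rot_of_vertexMap_eq {a b : G.Dart} (h : G.vertexMap a = G.vertexMap b) :
    G.glue.rot.SameCycle a b := by
  have key : ∀ a, (∃ d, G.glue.rot.SameCycle a (.base d) ∧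
      G.vertexMap a = Sum.inl (G.base.vertexOf d)) ∨ (∃ j e, G.glue.rot.SameCycle a (.inner j e) ∧
      G.vertexMap a = Sum.inr ⟨j, (G.disk j).vertexOf e⟩) := by
    rintro (d | ⟨j, e⟩ | ⟨j, d⟩ | ⟨j, d⟩)
    · exact Or.inl ⟨d, .rfl, rfl⟩
    · exact Or.inr ⟨j, e, .rfl, rfl⟩
    · exact Or.inl ⟨_, G.sameCycle_rot_rimIn j d, rfl⟩
    · exact Or.inr ⟨_, _, G.sameCycle_rot_rimOut j d, rfl⟩
  rcases key a with ⟨d, h1, h2⟩ | ⟨j, e, h1, h2⟩ <;>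
    rcases key b with ⟨d', h1', h2'⟩ | ⟨j', e', h1', h2'⟩ <;> rw [h2, h2'] at h
  · exact h1.trans ((G.sameCycle_rot_base (Sum.inl_injective h)).trans h1'.symm)
  · cases h
  · cases h
  · have h' := Sum.inr_injective h
    obtain rfl : j = j' := congrArg Sigma.fst h'
    exact h1.trans ((G.sameCycle_rot_inner (by simpa using h')).trans h1'.symm)

theorem vertexMap_surjective : Function.Surjective G.vertexMap := by
  rintro (v | ⟨j, v⟩)
  · obtain ⟨d, rfl⟩ := G.base.vertexOf_surjective v
    exact ⟨.base d, rfl⟩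
  · obtain ⟨d, rfl⟩ := (G.disk j).vertexOf_surjective v
    exact ⟨.inner j d, rfl⟩

def vertexEquiv : G.glue.Vertex ≃ G.base.Vertex ⊕ Σ j : G.holes, (G.disk j).Vertex :=
  G.glue.rot.cyclesEquiv G.vertexMap G.vertexMap_surjective G.vertexMap_rot
    fun _ _ => G.sameCycle_rot_of_vertexMap_eq

/-! #### Faces -/

/-- The faces of the glued map: the faces of the base which are not holes, the inner faces of the
disks, and the quadrangles of the rims. -/
abbrev FaceType : Type :=
  {f : G.base.Face // f ∉ G.holes} ⊕ (Σ j : G.holes, (G.disk j).InnerFace) ⊕ Σ j, G.Side j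

open Classical in
def faceMap : G.Dart → G.FaceType
  | .base d =>
    if h : G.base.faceOf d ∈ G.holes then Sum.inr (Sum.inr ⟨⟨_, h⟩, ⟨d, rfl⟩⟩)
    else Sum.inl ⟨_, h⟩
  | .inner j e =>
    if h : (G.disk j).faceOf e = (G.disk j).outerFace then
      Sum.inr (Sum.inr ⟨j, (G.seam j).symm ⟨e, h⟩⟩)
    else Sum.inr (Sum.inl ⟨j, ⟨_, h⟩⟩)
  | .rimIn j d => Sum.inr (Sum.inr ⟨j, d⟩)
  | .rimOut j d => Sum.inr (Sum.inr ⟨j, d⟩)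

theorem faceMap_base_of_mem {d} (j : G.holes) (h : G.base.faceOf d = j.1) :
    G.faceMap (.base d) = Sum.inr (Sum.inr ⟨j, ⟨d, h⟩⟩) := by
  obtain ⟨j, hj⟩ := j
  obtain rfl : G.base.faceOf d = j := h
  simp [faceMap, hj]

theorem faceMap_base_of_notMem {d} (h : G.base.faceOf d ∉ G.holes) :
    G.faceMap (.base d) = Sum.inl ⟨_, h⟩ := by simp [faceMap, h]

theorem faceMap_inner_of_ne {j e} (h : (G.disk j).faceOf e ≠ (G.disk j).outerFace) :
    G.faceMap (.inner j e) = Sum.inr (Sum.inl ⟨j, ⟨_, h⟩⟩) := by simp [faceMap, h]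

theorem faceMap_inner_of_eq {j e} (h : (G.disk j).faceOf e = (G.disk j).outerFace) :
    G.faceMap (.inner j e) = Sum.inr (Sum.inr ⟨j, (G.seam j).symm ⟨e, h⟩⟩) := by simp [faceMap, h]

theorem faceMap_seam (j : G.holes) (d : G.Side j) :
    G.faceMap (.inner j (G.seam j d).1) = Sum.inr (Sum.inr ⟨j, d⟩) := by
  rw [faceMap_inner_of_eq G (G.seam j d).2]; simp

theorem faceMap_nextFun (a : G.Dart) : G.faceMap (G.nextFun a) = G.faceMap a := by
  rcases a with d | ⟨j, e⟩ | ⟨j, d⟩ | ⟨j, d⟩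
  · by_cases h : G.base.faceOf d ∈ G.holes
    · rw [G.nextFun_base_of_mem ⟨_, h⟩ rfl, G.faceMap_base_of_mem ⟨_, h⟩ rfl, faceMap]
    · rw [nextFun_base_of_notMem G h, faceMap_base_of_notMem G h,
        faceMap_base_of_notMem G (by simpa using h)]
      simp
  · by_cases h : (G.disk j).faceOf e = (G.disk j).outerFace
    · rw [nextFun_inner_of_eq G h, faceMap_inner_of_eq G h, faceMap]
    · rw [nextFun_inner_of_ne G h, faceMap_inner_of_ne G h,
        faceMap_inner_of_ne G (by simpa using h)]
      simp
  · rw [nextFun, faceMap_seam, faceMap]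
  · rw [nextFun, G.faceMap_base_of_mem j d.2, faceMap]

theorem faceMap_next (a : G.Dart) : G.faceMap (G.glue.next a) = G.faceMap a := by
  rw [glue_next, faceMap_nextFun]

theorem sameCycle_next_rim (j : G.holes) (d : G.Side j) {a : G.Dart}
    (h : G.faceMap a = Sum.inr (Sum.inr ⟨j, d⟩)) : G.glue.next.SameCycle (.base d.1) a := by
  have h1 : G.glue.next (.base d.1) = .rimIn j d := by
    rw [glue_next, G.nextFun_base_of_mem j d.2]
  have h2 : G.glue.next (.rimIn j d) = .inner j (G.seam j d).1 := by rw [glue_next]; rfl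
  have h3 : G.glue.next (.inner j (G.seam j d).1) = .rimOut j d := by
    rw [glue_next, nextFun_seam]
  rcases a with d' | ⟨j', e⟩ | ⟨j', d'⟩ | ⟨j', d'⟩
  · by_cases h' : G.base.faceOf d' ∈ G.holes
    · rw [G.faceMap_base_of_mem ⟨_, h'⟩ rfl] at h
      simp only [Sum.inr.injEq, Sigma.mk.injEq] at h
      obtain ⟨rfl, h⟩ := h
      rw [← eq_of_heq h]
    · rw [faceMap_base_of_notMem G h'] at h
      cases h
  · by_cases h' : (G.disk j').faceOf e = (G.disk j').outerFace
    · rw [faceMap_inner_of_eq G h'] at h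
      simp only [Sum.inr.injEq, Sigma.mk.injEq] at h
      obtain ⟨rfl, h⟩ := h
      rw [← eq_of_heq h] at h1 h2 ⊢
      rw [Equiv.apply_symm_apply] at h2
      exact ⟨2, by rw [zpow_two, Equiv.Perm.mul_apply, h1, h2]⟩
    · rw [faceMap_inner_of_ne G h'] at h
      cases h
  · cases h
    exact ⟨1, h1⟩
  · cases h
    exact ⟨3, by
      change G.glue.next (G.glue.next (G.glue.next (.base d.1))) = _
      rw [h1, h2, h3]⟩

theorem sameCycle_next_base {d d' : G.base.Dart} (h : G.base.faceOf d = G.base.faceOf d')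
    (hd : G.base.faceOf d ∉ G.holes) : G.glue.next.SameCycle (.base d) (.base d') := by
  have key := (G.base.faceOf_eq_iff_sameCycle _ _).1 h
  obtain ⟨n, hn⟩ := key.exists_nat_pow_eq
  refine ⟨n, ?_⟩
  rw [← hn, zpow_natCast]
  clear h hn key
  induction n generalizing d with
  | zero => rfl
  | succ n ih =>
    rw [pow_succ, Equiv.Perm.mul_apply, pow_succ, Equiv.Perm.mul_apply, glue_next,
      nextFun_base_of_notMem G hd, ih (by simpa using hd)]

theorem sameCycle_next_inner {j : G.holes} {d d' : (G.disk j).Dart}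
    (h : (G.disk j).faceOf d = (G.disk j).faceOf d')
    (hd : (G.disk j).faceOf d ≠ (G.disk j).outerFace) :
    G.glue.next.SameCycle (.inner j d) (.inner j d') := by
  have key := ((G.disk j).faceOf_eq_iff_sameCycle _ _).1 h
  obtain ⟨n, hn⟩ := key.exists_nat_pow_eq
  refine ⟨n, ?_⟩
  rw [← hn, zpow_natCast]
  clear h hn key
  induction n generalizing d with
  | zero => rfl
  | succ n ih =>
    rw [pow_succ, Equiv.Perm.mul_apply, pow_succ, Equiv.Perm.mul_apply, glue_next,
      nextFun_inner_of_ne G hd, ih (by simpa using hd)]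

theorem faceMap_base_eq_inl {a : G.Dart} {f} (h : G.faceMap a = Sum.inl f) :
    ∃ d, a = .base d ∧ G.base.faceOf d = f.1 := by
  rcases a with d | ⟨j, e⟩ | ⟨j, d⟩ | ⟨j, d⟩
  · by_cases h' : G.base.faceOf d ∈ G.holes
    · rw [G.faceMap_base_of_mem ⟨_, h'⟩ rfl] at h
      cases h
    · rw [faceMap_base_of_notMem G h', Sum.inl.injEq] at h
      exact ⟨d, rfl, congrArg Subtype.val h⟩
  · by_cases h' : (G.disk j).faceOf e = (G.disk j).outerFace
    · rw [faceMap_inner_of_eq G h'] at h; cases h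
    · rw [faceMap_inner_of_ne G h'] at h; cases h
  · cases h
  · cases h

theorem faceMap_eq_inr_inl {a : G.Dart} {j f} (h : G.faceMap a = Sum.inr (Sum.inl ⟨j, f⟩)) :
    ∃ e, a = .inner j e ∧ (G.disk j).faceOf e = f.1 := by
  rcases a with d | ⟨j, e⟩ | ⟨j, d⟩ | ⟨j, d⟩
  · by_cases h' : G.base.faceOf d ∈ G.holes
    · rw [G.faceMap_base_of_mem ⟨_, h'⟩ rfl] at h
      cases h
    · rw [faceMap_base_of_notMem G h'] at h
      cases h
  · by_cases h' : (G.disk j).faceOf e = (G.disk j).outerFace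
    · rw [faceMap_inner_of_eq G h'] at h; cases h
    · rw [faceMap_inner_of_ne G h'] at h
      cases h
      exact ⟨e, rfl, rfl⟩
  · cases h
  · cases h

theorem sameCycle_next_of_faceMap_eq {a b : G.Dart} (h : G.faceMap a = G.faceMap b) :
    G.glue.next.SameCycle a b := by
  rcases hb : G.faceMap b with f | ⟨j, f⟩ | ⟨j, d⟩ <;> rw [hb] at h
  · obtain ⟨d, rfl, h1⟩ := G.faceMap_base_eq_inl h
    obtain ⟨d', rfl, h2⟩ := G.faceMap_base_eq_inl hb
    exact G.sameCycle_next_base (h1.trans h2.symm) (by rw [h1]; exact f.2)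
  · obtain ⟨d, rfl, h1⟩ := G.faceMap_eq_inr_inl h
    obtain ⟨d', rfl, h2⟩ := G.faceMap_eq_inr_inl hb
    exact G.sameCycle_next_inner (h1.trans h2.symm) (by rw [h1]; exact f.2)
  · exact (G.sameCycle_next_rim j d h).symm.trans (G.sameCycle_next_rim j d hb)

theorem faceMap_surjective : Function.Surjective G.faceMap := by
  rintro (⟨f, hf⟩ | ⟨j, f, hf⟩ | ⟨j, d⟩)
  · obtain ⟨d, rfl⟩ := G.base.faceOf_surjective f
    exact ⟨.base d, G.faceMap_base_of_notMem hf⟩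
  · obtain ⟨d, rfl⟩ := (G.disk j).faceOf_surjective f
    exact ⟨.inner j d, G.faceMap_inner_of_ne hf⟩
  · exact ⟨.rimIn j d, rfl⟩

def faceEquiv : G.glue.Face ≃ G.FaceType :=
  G.glue.next.cyclesEquiv G.faceMap G.faceMap_surjective G.faceMap_next
    fun _ _ => G.sameCycle_next_of_faceMap_eq

theorem faceEquiv_faceOf (a : G.Dart) : G.faceEquiv (G.glue.faceOf a) = G.faceMap a := rfl

theorem faceOf_eq_iff (a b : G.Dart) :
    G.glue.faceOf a = G.glue.faceOf b ↔ G.faceMap a = G.faceMap b := by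
  rw [← faceEquiv_faceOf, ← faceEquiv_faceOf, G.faceEquiv.apply_eq_iff_eq]

theorem faceEquiv_outerFace :
    G.faceEquiv G.glue.outerFace = Sum.inl ⟨G.base.outerFace, G.outer_notMem⟩ :=
  G.faceMap_base_of_notMem G.outer_notMem

/-! #### Degrees -/

theorem degree_glue (f : G.FaceType) :
    G.glue.degree (G.faceEquiv.symm f) = Nat.card {a : G.Dart // G.faceMap a = f} :=
  Nat.card_congr (Equiv.subtypeEquivRight fun a => by
    rw [← faceEquiv_faceOf]; exact (G.faceEquiv.eq_symm_apply))

theorem degree_glue_base (f : {f : G.base.Face // f ∉ G.holes}) :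
    G.glue.degree (G.faceEquiv.symm (Sum.inl f)) = G.base.degree f.1 := by
  rw [degree_glue]
  have key : ∀ d : {d // G.base.faceOf d = f.1}, G.faceMap (.base d.1) = Sum.inl f := fun d => by
    rw [faceMap_base_of_notMem G (by rw [d.2]; exact f.2)]
    exact congrArg _ (Subtype.ext d.2)
  refine (Nat.card_congr (Equiv.ofBijective
    (fun d : {d // G.base.faceOf d = f.1} => ⟨Dart.base d.1, key d⟩) ⟨?_, ?_⟩)).symm
  · intro d d' h
    exact Subtype.ext (Dart.base.inj (congrArg Subtype.val h))
  · rintro ⟨a, ha⟩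
    obtain ⟨d, rfl, h1⟩ := G.faceMap_base_eq_inl ha
    exact ⟨⟨d, h1⟩, rfl⟩

/-- The darts of an inner face of a disk. -/
def innerFaceDarts (j : G.holes) (f : (G.disk j).InnerFace) :
    {e // (G.disk j).faceOf e = f.1} ≃ {a : G.Dart // G.faceMap a = Sum.inr (Sum.inl ⟨j, f⟩)} :=
  Equiv.ofBijective (fun e => ⟨Dart.inner j e.1, by
    rw [faceMap_inner_of_ne G (by rw [e.2]; exact f.2)]
    have : (⟨(G.disk j).faceOf e.1, by rw [e.2]; exact f.2⟩ : (G.disk j).InnerFace) = f :=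
      Subtype.ext e.2
    rw [this]⟩) <| by
    constructor
    · intro d d' h
      exact Subtype.ext (by simpa using congrArg Subtype.val h)
    · rintro ⟨a, ha⟩
      obtain ⟨d, rfl, h1⟩ := G.faceMap_eq_inr_inl ha
      exact ⟨⟨d, h1⟩, rfl⟩

theorem degree_glue_inner (j : G.holes) (f : (G.disk j).InnerFace) :
    G.glue.degree (G.faceEquiv.symm (Sum.inr (Sum.inl ⟨j, f⟩))) = (G.disk j).degree f.1 := by
  rw [degree_glue]
  exact (Nat.card_congr (G.innerFaceDarts j f)).symm

theorem faceMap_eq_rim_iff {a : G.Dart} {j : G.holes} {d : G.Side j} :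
    G.faceMap a = Sum.inr (Sum.inr ⟨j, d⟩) ↔
      a = .base d.1 ∨ a = .rimIn j d ∨ a = .inner j (G.seam j d).1 ∨ a = .rimOut j d := by
  constructor
  · intro h
    rcases a with d' | ⟨j', e⟩ | ⟨j', d'⟩ | ⟨j', d'⟩
    · by_cases h' : G.base.faceOf d' ∈ G.holes
      · rw [G.faceMap_base_of_mem ⟨_, h'⟩ rfl] at h
        simp only [Sum.inr.injEq, Sigma.mk.injEq] at h
        obtain ⟨rfl, h⟩ := h
        rw [← eq_of_heq h]
        exact Or.inl rfl
      · rw [faceMap_base_of_notMem G h'] at h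
        cases h
    · by_cases h' : (G.disk j').faceOf e = (G.disk j').outerFace
      · rw [faceMap_inner_of_eq G h'] at h
        simp only [Sum.inr.injEq, Sigma.mk.injEq] at h
        obtain ⟨rfl, h⟩ := h
        rw [← eq_of_heq h, Equiv.apply_symm_apply]
        simp
      · rw [faceMap_inner_of_ne G h'] at h
        cases h
    · cases h; simp
    · cases h; simp
  · rintro (rfl | rfl | rfl | rfl)
    · exact G.faceMap_base_of_mem j d.2
    · rfl
    · exact G.faceMap_seam j d
    · rfl

theorem degree_glue_rim (j : G.holes) (d : G.Side j) :
    G.glue.degree (G.faceEquiv.symm (Sum.inr (Sum.inr ⟨j, d⟩))) = 4 := by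
  classical
  rw [degree_glue]
  have : Nat.card {a : G.Dart // G.faceMap a = Sum.inr (Sum.inr ⟨j, d⟩)} =
      Set.ncard (({.base d.1, .rimIn j d, .inner j (G.seam j d).1, .rimOut j d} :
        Finset G.Dart) : Set G.Dart) := by
    rw [← Nat.card_coe_set_eq]
    refine Nat.card_congr (Equiv.subtypeEquivRight fun a => ?_)
    rw [faceMap_eq_rim_iff]
    simp
  rw [this, Set.ncard_coe_finset, Finset.card_insert_of_notMem (by simp),
    Finset.card_insert_of_notMem (by simp), Finset.card_insert_of_notMem (by simp),
    Finset.card_singleton]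

/-! #### Connectedness and genus -/

theorem glue_isConnected (hb : G.base.IsConnected) (hd : ∀ j, (G.disk j).IsConnected) :
    G.glue.IsConnected := by
  refine RootedMap.isConnected_of fun S hroot hrot hflip => ?_
  have hnext : ∀ a : G.Dart, a ∈ S → G.nextFun a ∈ S := fun a ha => by
    have := hrot _ (hflip a ha)
    rwa [G.glue.rot_apply, G.glue.flip_flip, glue_next] at this
  have h1 : ∀ d, Dart.base d ∈ S := by
    refine hb.induction (S := {d | Dart.base d ∈ S}) G.base.root hroot (fun d hd => ?_)
      fun d hd => hflip _ hd
    rcases G.rot_base d with h | ⟨-, h⟩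
    · change Dart.base _ ∈ S
      rw [← h]; exact hrot _ hd
    · change Dart.base _ ∈ S
      rw [← h]; exact hrot _ (hrot _ hd)
  have h2 : ∀ j (d : G.Side j), Dart.rimIn j d ∈ S := fun j d => by
    rw [← G.nextFun_base_of_mem j d.2]; exact hnext _ (h1 _)
  have h3 : ∀ j (d : G.Side j), Dart.rimOut j d ∈ S := fun j d => by
    have := hflip _ (h2 j ((G.base.faceNext _).symm d))
    simpa [flipFun] using this
  have h4 : ∀ j (d : G.Side j), Dart.inner j (G.seam j d).1 ∈ S := fun j d => hnext _ (h2 j d)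
  have h5 : ∀ j e, (G.disk j).faceOf e = (G.disk j).outerFace → Dart.inner j e ∈ S :=
    fun j e he => by simpa using h4 j ((G.seam j).symm ⟨e, he⟩)
  have h6 : ∀ j e, Dart.inner j e ∈ S := fun j => by
    refine (hd j).induction_next (S := {e | Dart.inner j e ∈ S}) (G.disk j).root (h5 j _ rfl)
      (fun e he => ?_) fun e he => hflip _ he
    by_cases h : (G.disk j).faceOf e = (G.disk j).outerFace
    · exact h5 j _ (by simpa using h)
    · change Dart.inner _ _ ∈ S
      rw [← nextFun_inner_of_ne G h]
      exact hnext _ he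
  rintro (d | ⟨j, e⟩ | ⟨j, d⟩ | ⟨j, d⟩)
  exacts [h1 d, h6 j e, h2 j d, h3 j d]

theorem card_glue_vertex [Fintype G.holes] :
    Nat.card G.glue.Vertex = Nat.card G.base.Vertex + ∑ j, Nat.card (G.disk j).Vertex := by
  rw [Nat.card_congr G.vertexEquiv, Nat.card_sum, Nat.card_sigma]

/-- Each filled hole costs two faces, the hole itself and the outer face of its disk, and brings one
quadrangle per side. The losses stand on the left to avoid subtraction. -/
theorem card_glue_face [Fintype G.holes] :
    Nat.card G.glue.Face + ∑ _j : G.holes, 2 =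
      Nat.card G.base.Face + ∑ j, (Nat.card (G.disk j).Face + Nat.card (G.Side j)) := by
  classical
  have h1 : Nat.card {f : G.base.Face // f ∉ G.holes} + ∑ _j : G.holes, 1 =
      Nat.card G.base.Face := by
    rw [Finset.sum_const, Finset.card_univ, ← Nat.card_eq_fintype_card, smul_eq_mul, mul_one,
      add_comm, ← Nat.card_sum]
    exact Nat.card_congr (Equiv.sumCompl fun f => f ∈ G.holes)
  have h2 : ∀ j, Nat.card (G.disk j).InnerFace + 1 = Nat.card (G.disk j).Face := fun j => by
    rw [← Finite.card_option]
    exact Nat.card_congr (Equiv.optionSubtypeNe (G.disk j).outerFace)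
  have : Finite (Σ j : G.holes, (G.disk j).InnerFace) := inferInstance
  rw [Nat.card_congr G.faceEquiv, Nat.card_sum, Nat.card_sum, Nat.card_sigma, Nat.card_sigma,
    ← h1]
  simp only [← h2, Finset.sum_add_distrib]
  have h3 : ∑ _j : G.holes, 2 = ∑ _j : G.holes, 1 + ∑ _j : G.holes, 1 := by
    rw [← Finset.sum_add_distrib]
  omega

theorem card_glue_edge [Fintype G.holes] :
    Nat.card G.glue.Edge =
      Nat.card G.base.Edge + ∑ j, (Nat.card (G.disk j).Edge + Nat.card (G.Side j)) := by
  have h1 := G.glue.card_dart.symm.trans (Nat.card_congr G.dartEquiv)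
  rw [Nat.card_sum, Nat.card_sigma, G.base.card_dart] at h1
  simp only [Nat.card_sum, (G.disk _).card_dart] at h1
  have h2 : ∑ j, (2 * Nat.card (G.disk j).Edge + (Nat.card (G.Side j) + Nat.card (G.Side j))) =
      2 * ∑ j, (Nat.card (G.disk j).Edge + Nat.card (G.Side j)) := by
    rw [Finset.mul_sum]
    exact Finset.sum_congr rfl fun j _ => by ring
  omega

/-- A rim with `k` sides brings as many faces as edges, so the defects from Euler's relation add up
over the base and the disks. -/
theorem card_glue_euler [Fintype G.holes] :
    Nat.card G.glue.Vertex + Nat.card G.glue.Face +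
      (Nat.card G.base.Edge + ∑ j, (Nat.card (G.disk j).Edge + 2)) =
    Nat.card G.glue.Edge + (Nat.card G.base.Vertex + Nat.card G.base.Face +
      ∑ j, (Nat.card (G.disk j).Vertex + Nat.card (G.disk j).Face)) := by
  have h1 := G.card_glue_vertex
  have h2 := G.card_glue_face
  have h3 := G.card_glue_edge
  simp only [Finset.sum_add_distrib] at *
  omega

theorem glue_isPlanar (hb : G.base.IsPlanar) (hd : ∀ j, (G.disk j).IsPlanar) :
    G.glue.IsPlanar := by
  have := Fintype.ofFinite G.holes
  refine ⟨G.glue_isConnected hb.1 fun j => (hd j).1, ?_⟩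
  have h1 := G.card_glue_euler
  have h2 : ∑ j, (Nat.card (G.disk j).Vertex + Nat.card (G.disk j).Face) =
      ∑ j, (Nat.card (G.disk j).Edge + 2) := Finset.sum_congr rfl fun j _ => (hd j).2
  have h3 := hb.2
  omega

/-- No piece can exceed its Euler bound, and the defects of the pieces sum to that of the glued map,
which is zero; so every defect vanishes. -/
theorem isPlanar_of_glue (hG : G.glue.IsPlanar) (hb : G.base.IsConnected)
    (hd : ∀ j, (G.disk j).IsConnected) : G.base.IsPlanar ∧ ∀ j, (G.disk j).IsPlanar := by
  have := Fintype.ofFinite G.holes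
  have h1 := G.card_glue_euler
  have h2 : ∀ j ∈ Finset.univ, Nat.card (G.disk j).Vertex + Nat.card (G.disk j).Face ≤
      Nat.card (G.disk j).Edge + 2 := fun j _ => (hd j).card_le
  have h3 := hb.card_le
  have h4 := hG.2
  have h5 := Finset.sum_le_sum h2
  refine ⟨⟨hb, by omega⟩, fun j => ⟨hd j, ?_⟩⟩
  exact (Finset.sum_eq_sum_iff_of_le h2).1 (by omega) j (Finset.mem_univ j)

theorem glue_boundaryLength : G.glue.boundaryLength = G.base.boundaryLength := by
  rw [RootedMap.boundaryLength, ← G.faceEquiv.symm_apply_apply G.glue.outerFace,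
    faceEquiv_outerFace, degree_glue_base]
  rfl

end GlueData

/-! ### Rigid loop configurations on glued maps -/

/-- All the inner faces are quadrangles, and `C` is the set of crossed darts of a rigid loop
configuration. -/
structure RootedMap.IsRigid (M : RootedMap) (C : Set M.Dart) : Prop where
  quad : ∀ f : M.InnerFace, M.degree f.1 = 4
  crossed_flip : ∀ d ∈ C, M.flip d ∈ C
  crossed_two : ∀ d ∈ C, Nat.card {e // e ∈ C ∧ M.faceOf e = M.faceOf d} = 2
  crossed_inner : ∀ d ∈ C, M.faceOf d ≠ M.outerFace
  rigid : ∀ d ∈ C, M.next (M.next d) ∈ C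

theorem LoopQuadrangulation.isRigid {p : ℕ} (Q : LoopQuadrangulation p) :
    Q.map.IsRigid Q.crossed :=
  ⟨Q.quad, Q.crossed_flip, Q.crossed_two, Q.crossed_inner, Q.rigid⟩

/-- The loop-decorated quadrangulation with a given set of crossed darts. -/
abbrev LoopQuadrangulation.ofIsRigid {p : ℕ} (M : RootedMap) (hM : M.IsPlanar)
    (hp : M.boundaryLength = p) (C : Set M.Dart) (hC : M.IsRigid C) : LoopQuadrangulation p where
  map := M
  planar := hM
  quad := hC.quad
  boundary := hp
  crossed := C
  crossed_flip := hC.crossed_flip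
  crossed_two := hC.crossed_two
  crossed_inner := hC.crossed_inner
  rigid := hC.rigid

namespace RootedMap

/-- A face is a single cycle, so a function invariant along its contour is constant on it. -/
theorem eq_of_faceNext {M : RootedMap} {f : M.Face} {Y : Type*}
    (u : {d // M.faceOf d = f} → Y) (hu : ∀ d, u (M.faceNext f d) = u d) (d d') : u d = u d' := by
  classical
  have h : M.next.SameCycle d.1 d'.1 :=
    (M.faceOf_eq_iff_sameCycle _ _).1 (d.2.trans d'.2.symm)
  have := h.apply_eq
    (f := fun a => if h : M.faceOf a = f then some (u ⟨a, h⟩) else none) (fun a => by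
      by_cases ha : M.faceOf a = f
      · have ha' : M.faceOf (M.next a) = f := by rwa [faceOf_next]
        simp only [ha, ha', dif_pos]
        exact congrArg some (hu ⟨a, ha⟩)
      · simp [ha])
  simpa [d.2, d'.2] using this

end RootedMap

theorem restrictCycles_apply_of_mem {D : Type} [Finite D] (s : Equiv.Perm D) (K : Set D) (x : K)
    (h : s x.1 ∈ K) : (restrictCycles s K x).1 = s x.1 := by
  have h1 := returnTime_pos s K x
  have h2 := returnTime_le s K x one_pos (by simpa using h)
  have h3 : returnTime s K x = 1 := by omega
  change (s ^ returnTime s K x) x.1 = _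
  rw [h3, pow_one]

theorem restrictCycles_apply_of_notMem {D : Type} [Finite D] (s : Equiv.Perm D) (K : Set D) (x : K)
    (h : s x.1 ∉ K) (h' : s (s x.1) ∈ K) : (restrictCycles s K x).1 = s (s x.1) := by
  have h1 := returnTime_pos s K x
  have h2 := returnTime_le s K x two_pos (by simpa [pow_two] using h')
  have h3 : returnTime s K x ≠ 1 := fun h1 => h (by
    have := returnTime_mem s K x
    rwa [h1, pow_one] at this)
  have h4 : returnTime s K x = 2 := by omega
  change (s ^ returnTime s K x) x.1 = _
  rw [h4]
  rfl

theorem Nat.card_subtype_sum {A B : Type*} [Finite A] [Finite B] (P : A ⊕ B → Prop) :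
    Nat.card {t // P t} = Nat.card {a // P (Sum.inl a)} + Nat.card {b // P (Sum.inr b)} := by
  rw [Nat.card_congr Equiv.subtypeSum, Nat.card_sum]

theorem Nat.card_subtype_sigma {J : Type*} {B : J → Type*} [Fintype J] [∀ j, Finite (B j)]
    (P : (Σ j, B j) → Prop) :
    Nat.card {t // P t} = ∑ j, Nat.card {b // P ⟨j, b⟩} := by
  rw [← Nat.card_sigma]
  exact Nat.card_congr
    { toFun := fun t => ⟨t.1.1, ⟨t.1.2, t.2⟩⟩
      invFun := fun t => ⟨⟨t.1, t.2.1⟩, t.2.2⟩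
      left_inv := fun _ => rfl
      right_inv := fun _ => rfl }

namespace GlueData

variable (G : GlueData) (cr : ∀ j, Set (G.disk j).Dart)

/-- The crossed darts of the glued map: those of the disks and those of the rims. -/
def crossed : Set G.Dart :=
  {a | match a with
    | .base _ => False
    | .inner j e => e ∈ cr j
    | .rimIn _ _ => True
    | .rimOut _ _ => True}

@[simp] theorem rimIn_mem_crossed (j d) : .rimIn j d ∈ G.crossed cr ↔ True := Iff.rfl
@[simp] theorem rimOut_mem_crossed (j d) : .rimOut j d ∈ G.crossed cr ↔ True := Iff.rfl

theorem faceOf_inner_iff {j : G.holes} {e : (G.disk j).Dart}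
    (he : (G.disk j).faceOf e ≠ (G.disk j).outerFace) (a : G.Dart) :
    G.glue.faceOf a = G.glue.faceOf (.inner j e) ↔
      ∃ e', a = .inner j e' ∧ (G.disk j).faceOf e' = (G.disk j).faceOf e := by
  rw [faceOf_eq_iff, faceMap_inner_of_ne G he]
  constructor
  · exact fun h => G.faceMap_eq_inr_inl h
  · rintro ⟨e', rfl, h⟩
    rw [← faceMap_inner_of_ne G he, ← faceOf_eq_iff]
    exact (G.glue.faceOf_eq_iff_sameCycle _ _).2 (G.sameCycle_next_inner h (by rwa [h]))

theorem card_crossed_inner {j : G.holes} {e : (G.disk j).Dart}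
    (he : (G.disk j).faceOf e ≠ (G.disk j).outerFace) :
    Nat.card {a // a ∈ G.crossed cr ∧ G.glue.faceOf a = G.glue.faceOf (.inner j e)} =
      Nat.card {e' // e' ∈ cr j ∧ (G.disk j).faceOf e' = (G.disk j).faceOf e} := by
  refine (Nat.card_congr (Equiv.ofBijective (fun e' => ⟨.inner j e'.1, e'.2.1,
    (G.faceOf_inner_iff he _).2 ⟨_, rfl, e'.2.2⟩⟩) ⟨?_, ?_⟩)).symm
  · intro d d' h
    exact Subtype.ext (by simpa using congrArg Subtype.val h)
  · rintro ⟨a, ha, h⟩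
    obtain ⟨e', rfl, h'⟩ := (G.faceOf_inner_iff he _).1 h
    exact ⟨⟨e', ha, h'⟩, rfl⟩

/-- Of the four darts of a rim quadrangle, the one of the base is never crossed, and the one of the
disk is not because loops of the disk avoid its outer face. -/
theorem card_crossed_rim (hcr : ∀ j, ∀ e ∈ cr j, (G.disk j).faceOf e ≠ (G.disk j).outerFace)
    (j : G.holes) (d : G.Side j) {b : G.Dart} (hb : G.faceMap b = Sum.inr (Sum.inr ⟨j, d⟩)) :
    Nat.card {a // a ∈ G.crossed cr ∧ G.glue.faceOf a = G.glue.faceOf b} = 2 := by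
  classical
  have : Nat.card {a // a ∈ G.crossed cr ∧ G.glue.faceOf a = G.glue.faceOf b} =
      Set.ncard (({.rimIn j d, .rimOut j d} : Finset G.Dart) : Set G.Dart) := by
    rw [← Nat.card_coe_set_eq]
    refine Nat.card_congr (Equiv.subtypeEquivRight fun a => ?_)
    rw [faceOf_eq_iff, hb, faceMap_eq_rim_iff]
    simp only [Finset.coe_insert, Finset.coe_singleton, Set.mem_insert_iff, Set.mem_singleton_iff]
    constructor
    · rintro ⟨h1, rfl | rfl | rfl | rfl⟩
      · exact h1.elim
      · simp
      · exact (hcr j _ h1 (G.seam j d).2).elim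
      · simp
    · rintro (rfl | rfl) <;> simp
  rw [this, Set.ncard_coe_finset, Finset.card_pair (by simp)]

theorem glue_isRigid (hbase : ∀ f ∉ G.holes, f ≠ G.base.outerFace → G.base.degree f = 4)
    (hcr : ∀ j, (G.disk j).IsRigid (cr j)) : G.glue.IsRigid (G.crossed cr) where
  quad := by
    rintro ⟨f, hf⟩
    obtain ⟨t, rfl⟩ := G.faceEquiv.symm.surjective f
    rcases t with f | ⟨j, f⟩ | ⟨j, d⟩
    · refine (G.degree_glue_base f).trans (hbase _ f.2 fun h => hf ?_)
      rw [Equiv.symm_apply_eq, faceEquiv_outerFace]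
      exact congrArg _ (Subtype.ext h)
    · exact (G.degree_glue_inner j f).trans ((hcr j).quad f)
    · exact G.degree_glue_rim j d
  crossed_flip := by
    rintro (d | ⟨j, e⟩ | ⟨j, d⟩ | ⟨j, d⟩) h
    · exact h.elim
    · exact (hcr j).crossed_flip e h
    · trivial
    · trivial
  crossed_two := by
    rintro (d | ⟨j, e⟩ | ⟨j, d⟩ | ⟨j, d⟩) h
    · exact h.elim
    · rw [G.card_crossed_inner cr ((hcr j).crossed_inner e h)]
      exact (hcr j).crossed_two e h
    · exact G.card_crossed_rim cr (fun j => (hcr j).crossed_inner) j d rfl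
    · exact G.card_crossed_rim cr (fun j => (hcr j).crossed_inner) j d rfl
  crossed_inner := by
    rintro a ha h
    rw [← G.faceEquiv.apply_eq_iff_eq, faceEquiv_outerFace] at h
    obtain ⟨d, rfl, -⟩ := G.faceMap_base_eq_inl h
    exact ha
  rigid := by
    rintro (d | ⟨j, e⟩ | ⟨j, d⟩ | ⟨j, d⟩) h
    · exact h.elim
    · have he := (hcr j).crossed_inner e h
      rw [glue_next, glue_next, nextFun_inner_of_ne G he, nextFun_inner_of_ne G (by simpa using he)]
      exact (hcr j).rigid e h
    · rw [glue_next, glue_next]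
      change G.nextFun (.inner j (G.seam j d).1) ∈ _
      rw [nextFun_seam]
      trivial
    · rw [glue_next, glue_next]
      change G.nextFun (.base d.1) ∈ _
      rw [G.nextFun_base_of_mem j d.2]
      trivial

theorem base_degree_of_glue_isRigid (h : G.glue.IsRigid (G.crossed cr)) (f : G.base.Face)
    (hf : f ∉ G.holes) (hf' : f ≠ G.base.outerFace) : G.base.degree f = 4 := by
  rw [← G.degree_glue_base ⟨f, hf⟩]
  refine h.quad ⟨_, fun h' => hf' ?_⟩
  rw [Equiv.symm_apply_eq, faceEquiv_outerFace] at h'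
  simpa using h'

theorem disk_isRigid_of_glue (h : G.glue.IsRigid (G.crossed cr)) (j : G.holes)
    (hcr : ∀ e ∈ cr j, (G.disk j).faceOf e ≠ (G.disk j).outerFace) :
    (G.disk j).IsRigid (cr j) where
  quad f := by
    rw [← G.degree_glue_inner j f]
    refine h.quad ⟨_, fun h' => ?_⟩
    rw [Equiv.symm_apply_eq, faceEquiv_outerFace] at h'
    cases h'
  crossed_flip d hd := h.crossed_flip (.inner j d) hd
  crossed_two d hd := by
    rw [← G.card_crossed_inner cr (hcr d hd)]
    exact h.crossed_two (.inner j d) hd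
  crossed_inner := hcr
  rigid d hd := by
    have h1 := h.rigid (.inner j d) hd
    rwa [glue_next, glue_next, nextFun_inner_of_ne G (hcr d hd),
      nextFun_inner_of_ne G (by simpa using hcr d hd)] at h1

end GlueData

/-- A planar map with a boundary of length `p`, whose inner faces are quadrangles or holes, each
hole coming with a loop-decorated quadrangulation with a boundary of the same length. -/
structure RigidGlueData (p : ℕ) : Type 1 where
  base : RootedMap
  planar : base.IsPlanar
  boundary : base.boundaryLength = p
  holes : Set base.Face
  outer_notMem : base.outerFace ∉ holes
  quad : ∀ f ∉ holes, f ≠ base.outerFace → base.degree f = 4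
  disk (j : holes) : LoopQuadrangulation (base.degree j.1)
  seam (j : holes) :
    {d // base.faceOf d = j.1} ≃ {e // (disk j).map.faceOf e = (disk j).map.outerFace}
  seam_next : ∀ j d, (disk j).map.next (seam j (base.faceNext _ d)).1 = (seam j d).1

namespace RigidGlueData

variable {p : ℕ} (R : RigidGlueData p)

abbrev toGlueData : GlueData where
  base := R.base
  holes := R.holes
  outer_notMem := R.outer_notMem
  disk j := (R.disk j).map
  seam := R.seam
  seam_next := R.seam_next

abbrev crossed : Set R.toGlueData.Dart := R.toGlueData.crossed fun j => (R.disk j).crossed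

theorem glue_isRigid : R.toGlueData.glue.IsRigid R.crossed :=
  R.toGlueData.glue_isRigid _ R.quad fun j => (R.disk j).isRigid

/-- The loop-decorated quadrangulation obtained by filling the holes; the rims are visited by
additional loops. -/
abbrev glue : LoopQuadrangulation p :=
  LoopQuadrangulation.ofIsRigid R.toGlueData.glue
    (R.toGlueData.glue_isPlanar R.planar fun j => (R.disk j).planar)
    (R.toGlueData.glue_boundaryLength.trans R.boundary) R.crossed R.glue_isRigid

/-! #### Loops -/

/-- Each hole carries exactly one loop, `none`, besides those of its disk: the one running through
its rim. -/
def loopMap : {a // a ∈ R.crossed} → Σ j : R.holes, Option (R.disk j).Loop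
  | ⟨.base _, h⟩ => h.elim
  | ⟨.inner j e, h⟩ => ⟨j, some (Quot.mk _ ⟨e, h⟩)⟩
  | ⟨.rimIn j _, _⟩ => ⟨j, none⟩
  | ⟨.rimOut j _, _⟩ => ⟨j, none⟩

theorem loopMap_rim {a : R.toGlueData.Dart} (ha : a ∈ R.crossed) {j d}
    (h : R.toGlueData.faceMap a = Sum.inr (Sum.inr ⟨j, d⟩)) : R.loopMap ⟨a, ha⟩ = ⟨j, none⟩ := by
  rcases (R.toGlueData.faceMap_eq_rim_iff).1 h with rfl | rfl | rfl | rfl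
  · exact ha.elim
  · rfl
  · exact ((R.disk j).crossed_inner _ ha (R.seam j d).2).elim
  · rfl

theorem loopMap_step (a b : {a // a ∈ R.crossed}) (h : R.glue.loopStep a b) :
    R.loopMap a = R.loopMap b := by
  obtain ⟨a, ha⟩ := a
  obtain ⟨b, hb⟩ := b
  rcases h with h | h
  · obtain rfl : b = R.toGlueData.flipFun a := h
    rcases a with d | ⟨j, e⟩ | ⟨j, d⟩ | ⟨j, d⟩
    · exact ha.elim
    · have : (R.disk j).loopStep ⟨e, ha⟩ ⟨(R.disk j).map.flip e, hb⟩ := Or.inl rfl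
      simp only [GlueData.flipFun, loopMap, Quot.sound this]
    · rfl
    · rfl
  · have h' : R.toGlueData.faceMap b = R.toGlueData.faceMap a :=
      (R.toGlueData.faceOf_eq_iff b a).1 h
    rcases hf : R.toGlueData.faceMap a with f | ⟨j, f⟩ | ⟨j, d⟩ <;> rw [hf] at h'
    · obtain ⟨d, rfl, -⟩ := R.toGlueData.faceMap_base_eq_inl hf
      exact ha.elim
    · obtain ⟨d, rfl, h1⟩ := R.toGlueData.faceMap_eq_inr_inl hf
      obtain ⟨d', rfl, h2⟩ := R.toGlueData.faceMap_eq_inr_inl h'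
      have : (R.disk j).loopStep ⟨d, ha⟩ ⟨d', hb⟩ := Or.inr (h2.trans h1.symm)
      simp only [loopMap, Quot.sound this]
    · rw [R.loopMap_rim ha hf, R.loopMap_rim hb h']

theorem rim_loop_eq (j : R.holes) (d d' : R.toGlueData.Side j) :
    (Quot.mk _ ⟨.rimIn j d, trivial⟩ : R.glue.Loop) = Quot.mk _ ⟨.rimIn j d', trivial⟩ := by
  refine RootedMap.eq_of_faceNext
    (u := fun d => (Quot.mk _ ⟨.rimIn j d, trivial⟩ : R.glue.Loop)) (fun d => ?_) d d'
  have h1 : R.glue.loopStep ⟨.rimIn j d, trivial⟩ ⟨.rimOut j (R.base.faceNext _ d), trivial⟩ :=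
    Or.inl rfl
  have h2 : R.glue.loopStep ⟨.rimOut j (R.base.faceNext _ d), trivial⟩
      ⟨.rimIn j (R.base.faceNext _ d), trivial⟩ :=
    Or.inr ((R.toGlueData.faceOf_eq_iff _ _).2 rfl)
  exact ((Quot.sound h1).trans (Quot.sound h2)).symm

def holeDart (j : R.holes) : R.toGlueData.Side j := ⟨Quotient.out j.1, Quotient.out_eq j.1⟩

def ofLoop (j : R.holes) : (R.disk j).Loop → R.glue.Loop :=
  Quot.map (fun e => ⟨.inner j e.1, e.2⟩) fun a _ h => h.imp (fun h => congrArg _ h) fun h =>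
    (R.toGlueData.faceOf_inner_iff ((R.disk j).crossed_inner _ a.2) _).2 ⟨_, rfl, h⟩

def loopEquiv : R.glue.Loop ≃ Σ j : R.holes, Option (R.disk j).Loop where
  toFun := Quot.lift R.loopMap R.loopMap_step
  invFun
    | ⟨j, none⟩ => Quot.mk _ ⟨.rimIn j (R.holeDart j), trivial⟩
    | ⟨j, some l⟩ => R.ofLoop j l
  left_inv := by
    rintro ⟨⟨d | ⟨j, e⟩ | ⟨j, d⟩ | ⟨j, d⟩, h⟩⟩
    · exact h.elim
    · rfl
    · exact R.rim_loop_eq _ _ _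
    · refine (R.rim_loop_eq _ _ d).trans (Quot.sound (Or.inr ?_))
      exact (R.toGlueData.faceOf_eq_iff _ _).2 rfl
  right_inv := by
    rintro ⟨j, _ | l⟩
    · rfl
    · obtain ⟨e, rfl⟩ := Quot.exists_rep l
      rfl

instance {q : ℕ} (Q : LoopQuadrangulation q) : Finite Q.Loop :=
  Finite.of_surjective (Quot.mk _) Quot.mk_surjective

theorem numLoops_glue [Fintype R.holes] :
    R.glue.numLoops = ∑ j, (1 + (R.disk j).numLoops) := by
  rw [LoopQuadrangulation.numLoops, Nat.card_congr R.loopEquiv, Nat.card_sigma]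
  refine Finset.sum_congr rfl fun j _ => ?_
  rw [Finite.card_option, add_comm]
  rfl

/-! #### Visited faces -/

def VisitedType (t : R.toGlueData.FaceType) : Prop :=
  match t with
  | Sum.inl _ => False
  | Sum.inr (Sum.inl f) => (R.disk f.1).IsVisited f.2.1
  | Sum.inr (Sum.inr _) => True

theorem isVisited_iff (f : R.toGlueData.glue.Face) :
    R.VisitedType (R.toGlueData.faceEquiv f) ↔ R.glue.IsVisited f := by
  obtain ⟨t, rfl⟩ := R.toGlueData.faceEquiv.symm.surjective f
  rw [Equiv.apply_symm_apply]
  rcases t with f | ⟨j, f⟩ | ⟨j, d⟩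
  · refine iff_of_false id ?_
    rintro ⟨a, ha, h⟩
    rw [Equiv.eq_symm_apply] at h
    obtain ⟨d, rfl, -⟩ := R.toGlueData.faceMap_base_eq_inl h
    exact ha
  · constructor
    · rintro ⟨d, hd, h⟩
      refine ⟨.inner j d, hd, ?_⟩
      rw [Equiv.eq_symm_apply]
      exact (R.toGlueData.innerFaceDarts j f ⟨d, h⟩).2
    · rintro ⟨a, ha, h⟩
      rw [Equiv.eq_symm_apply] at h
      obtain ⟨d, rfl, h1⟩ := R.toGlueData.faceMap_eq_inr_inl h
      exact ⟨d, ha, h1⟩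
  · refine iff_of_true trivial ⟨.rimIn j d, trivial, ?_⟩
    rw [Equiv.eq_symm_apply]
    rfl

theorem numVisited_glue [Fintype R.holes] :
    R.glue.numVisited = ∑ j, (R.base.degree j.1 + (R.disk j).numVisited) := by
  have h1 : R.glue.numVisited = Nat.card {t // R.VisitedType t} :=
    (Nat.card_congr (R.toGlueData.faceEquiv.subtypeEquiv fun f => (R.isVisited_iff f).symm))
  rw [h1, Nat.card_subtype_sum, Nat.card_subtype_sum, Nat.card_subtype_sigma,
    Nat.card_subtype_sigma]
  change Nat.card {_a // False} + _ = _
  rw [Nat.card_of_isEmpty, zero_add, add_comm, ← Finset.sum_add_distrib]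
  refine Finset.sum_congr rfl fun j _ => congrArg₂ _ ?_ ?_
  · exact Nat.card_congr (Equiv.subtypeUnivEquiv fun _ => trivial)
  · exact Nat.card_congr
      { toFun := fun f => ⟨f.1.1, f.2⟩
        invFun := fun f => ⟨⟨f.1, by
          obtain ⟨_, d, hd, rfl⟩ := f
          exact (R.disk j).crossed_inner d hd⟩, f.2⟩
        left_inv := fun _ => rfl
        right_inv := fun _ => rfl }

theorem numUnvisited_glue [Fintype R.holes] :
    R.glue.numUnvisited = Nat.card {f : R.base.InnerFace // f.1 ∉ R.holes} +
      ∑ j, (R.disk j).numUnvisited := by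
  have h0 : R.glue.numUnvisited =
      Nat.card {f : R.glue.map.Face // f ≠ R.glue.map.outerFace ∧ ¬ R.glue.IsVisited f} :=
    Nat.card_congr (Equiv.subtypeSubtypeEquivSubtypeInter (fun f => f ≠ R.glue.map.outerFace)
      fun f => ¬ R.glue.IsVisited f)
  have h1 : R.glue.numUnvisited = Nat.card {t : R.toGlueData.FaceType //
      t ≠ Sum.inl ⟨R.base.outerFace, R.outer_notMem⟩ ∧ ¬ R.VisitedType t} := by
    rw [h0]
    refine Nat.card_congr (R.toGlueData.faceEquiv.subtypeEquiv fun f => ?_)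
    rw [R.isVisited_iff, ← R.toGlueData.faceEquiv_outerFace, Ne, Ne, Equiv.apply_eq_iff_eq]
  rw [h1, Nat.card_subtype_sum, Nat.card_subtype_sum, Nat.card_subtype_sigma,
    Nat.card_subtype_sigma]
  refine congrArg₂ _ (Nat.card_congr ?_) ?_
  · exact
      { toFun := fun f => ⟨⟨f.1.1, fun h => f.2.1 (congrArg Sum.inl (Subtype.ext h))⟩, f.1.2⟩
        invFun := fun f => ⟨⟨f.1.1, f.2⟩,
          fun h => f.1.2 (congrArg Subtype.val (Sum.inl_injective h)), id⟩
        left_inv := fun _ => rfl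
        right_inv := fun _ => rfl }
  · have h2 : ∀ j : R.holes, Nat.card {b : R.toGlueData.Side j //
        (Sum.inr (Sum.inr ⟨j, b⟩) : R.toGlueData.FaceType) ≠
          Sum.inl ⟨R.base.outerFace, R.outer_notMem⟩ ∧ ¬ True} = 0 := fun j => by simp
    refine (congrArg₂ _ ?_ (Finset.sum_eq_zero fun j _ => h2 j)).trans (add_zero _)
    refine Finset.sum_congr rfl fun j _ => Nat.card_congr (Equiv.subtypeEquivRight fun f => ?_)
    exact and_iff_right (by simp)

theorem weight_glue [Fintype R.holes] (n g h : ℝ≥0) :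
    R.glue.weight n g h = (g : ℝ≥0∞) ^ Nat.card {f : R.base.InnerFace // f.1 ∉ R.holes} *
      ∏ j : R.holes, (n * (h : ℝ≥0∞) ^ R.base.degree j.1 * (R.disk j).weight n g h) := by
  rw [LoopQuadrangulation.weight, numLoops_glue, numVisited_glue, numUnvisited_glue]
  simp only [LoopQuadrangulation.weight, Finset.prod_mul_distrib, Finset.prod_pow_eq_pow_sum,
    pow_add, Finset.sum_add_distrib, Finset.sum_const, Finset.card_univ, Finset.prod_const,
    smul_eq_mul, mul_one]
  ring

/-! #### The gasket -/

/-- Only the crossed edges of rim `j` join the vertices of disk `j` to other vertices, so moves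
avoiding the loop of that rim neither enter nor leave the disk. -/
theorem vertexMap_avoid (j : R.holes) (l : R.glue.Loop)
    (hl : ∀ d : R.toGlueData.Side j, (Quot.mk _ ⟨.rimIn j d, trivial⟩ : R.glue.Loop) = l)
    (a b : R.toGlueData.Dart) (h : R.glue.avoidStep l a b) :
    (∃ v, R.toGlueData.vertexMap a = Sum.inr ⟨j, v⟩) =
      ∃ v, R.toGlueData.vertexMap b = Sum.inr ⟨j, v⟩ := by
  rcases h with rfl | ⟨h, rfl⟩
  · rw [R.toGlueData.vertexMap_rot a]
  · rcases a with d | ⟨j', e⟩ | ⟨j', d⟩ | ⟨j', d⟩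
    · simp [GlueData.flipFun, GlueData.vertexMap]
    · refine propext ⟨?_, ?_⟩
      · rintro ⟨v, hv⟩
        obtain rfl : j' = j := congrArg Sigma.fst (Sum.inr_injective hv)
        exact ⟨_, rfl⟩
      · rintro ⟨v, hv⟩
        obtain rfl : j' = j := congrArg Sigma.fst (Sum.inr_injective hv)
        exact ⟨_, rfl⟩
    · have hj : j' ≠ j := by
        rintro rfl
        exact h ⟨trivial, hl d⟩
      simp [GlueData.flipFun, GlueData.vertexMap, hj]
    · have hj : j' ≠ j := by
        rintro rfl
        refine h ⟨trivial, Eq.trans (Quot.sound (Or.inr ?_)) (hl d)⟩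
        exact (R.toGlueData.faceOf_eq_iff _ _).2 rfl
      simp [GlueData.flipFun, GlueData.vertexMap, hj]

/-- The loop of its rim separates each disk from the root. A base dart is joined to the root inside
the connected base, whose edges are never crossed; the rim darts inserted at corners are passed by
turning around a vertex, which no loop obstructs. -/
theorem mem_gasketDarts_iff (a : R.toGlueData.Dart) :
    a ∈ R.glue.gasketDarts ↔ ∃ d, a = .base d := by
  constructor
  · rintro ⟨h1, h2⟩
    rcases a with d | ⟨j, e⟩ | ⟨j, d⟩ | ⟨j, d⟩
    · exact ⟨d, rfl⟩
    · exfalso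
      let l : R.glue.Loop := Quot.mk _ ⟨.rimIn j (R.holeDart j), trivial⟩
      have h := h2 l
      rw [LoopQuadrangulation.IsInterior, not_not] at h
      have := congrArg (Quot.lift
        (fun a => ∃ v, R.toGlueData.vertexMap a = Sum.inr ⟨j, v⟩)
        (R.vertexMap_avoid j l fun d => R.rim_loop_eq j d _)) h
      simp [GlueData.vertexMap] at this
    · exact (h1 trivial).elim
    · exact (h1 trivial).elim
  · rintro ⟨d, rfl⟩
    refine ⟨id, fun l => not_not.2 ?_⟩
    refine R.planar.1.induction (S := {d | Quot.mk (R.glue.avoidStep l) (.base d) =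
      Quot.mk (R.glue.avoidStep l) R.glue.map.root}) R.base.root rfl ?_ ?_ d
    · intro d hd
      have hr : ∀ a : R.toGlueData.Dart, Quot.mk (R.glue.avoidStep l) (R.toGlueData.glue.rot a) =
          Quot.mk (R.glue.avoidStep l) a := fun a =>
        (Quot.sound (r := R.glue.avoidStep l) (Or.inl rfl)).symm
      rcases R.toGlueData.rot_base d with h | ⟨-, h⟩
      · change Quot.mk _ _ = _
        rw [← h]
        exact (hr _).trans hd
      · change Quot.mk _ _ = _
        rw [← h]
        exact (hr _).trans ((hr _).trans hd)
    · intro d hd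
      have hs : R.glue.avoidStep l (.base d) (.base (R.base.flip d)) :=
        Or.inr ⟨fun h => h.1, rfl⟩
      exact (Quot.sound hs).symm.trans hd

theorem base_mem_gasketDarts (d : R.base.Dart) :
    (GlueData.Dart.base d : R.toGlueData.Dart) ∈ R.glue.gasketDarts :=
  (R.mem_gasketDarts_iff _).2 ⟨d, rfl⟩

/-- At most one crossed dart lies between consecutive base darts around a vertex, so the first
return takes one or two steps. -/
def gasketIso : RootedMap.Iso R.base R.glue.gasket where
  toEquiv := Equiv.ofBijective (fun d => ⟨.base d, R.base_mem_gasketDarts d⟩) <| by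
    constructor
    · intro d d' h
      exact GlueData.Dart.base.inj (congrArg Subtype.val h)
    · rintro ⟨a, ha⟩
      obtain ⟨d, rfl⟩ := (R.mem_gasketDarts_iff a).1 ha
      exact ⟨d, rfl⟩
  map_rot d := by
    apply Subtype.ext
    change GlueData.Dart.base (R.base.rot d) = (restrictCycles R.glue.map.rot R.glue.gasketDarts
      ⟨.base d, R.base_mem_gasketDarts d⟩).1
    rcases R.toGlueData.rot_base d with h | ⟨⟨j, e, h⟩, h'⟩
    · rw [restrictCycles_apply_of_mem _ _ _ (by rw [h]; exact R.base_mem_gasketDarts _), h]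
    · rw [restrictCycles_apply_of_notMem _ _ _ _ (by rw [h']; exact R.base_mem_gasketDarts _), h']
      rw [h, mem_gasketDarts_iff]
      simp
  map_flip d := rfl
  map_root := rfl

end RigidGlueData

/-! ### Contours of faces -/

namespace RootedMap

variable (M : RootedMap)

theorem next_isCycleOn (f : M.Face) : M.next.IsCycleOn {d | M.faceOf d = f} := by
  refine ⟨⟨fun d hd => (M.faceOf_next d).trans hd, M.next.injective.injOn, fun d hd =>
    ⟨M.next.symm d, (M.faceOf_next_symm d).trans hd, M.next.apply_symm_apply d⟩⟩, ?_⟩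
  intro d hd d' hd'
  exact (M.faceOf_eq_iff_sameCycle _ _).1 (Eq.trans hd (Eq.symm hd'))

theorem next_pow_apply_eq_iff (d : M.Dart) (n : ℕ) :
    (M.next ^ n) d = d ↔ M.degree (M.faceOf d) ∣ n := by
  classical
  have := Fintype.ofFinite M.Dart
  have h : M.next.IsCycleOn ((Finset.univ.filter fun e => M.faceOf e = M.faceOf d :
      Finset M.Dart) : Set M.Dart) := by
    simpa using M.next_isCycleOn (M.faceOf d)
  rw [h.pow_apply_eq (by simp), degree, Nat.card_eq_fintype_card, Fintype.card_subtype]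

theorem card_dart_eq_sum_degree [Fintype M.Face] : Nat.card M.Dart = ∑ f, M.degree f := by
  rw [← Nat.card_congr (Equiv.sigmaFiberEquiv M.faceOf), Nat.card_sigma]
  rfl

/-- The total degree `2 E` is the boundary length plus a multiple of four. -/
theorem boundaryLength_even_of_quad (h : ∀ f : M.InnerFace, M.degree f.1 = 4) :
    Even M.boundaryLength := by
  classical
  have := Fintype.ofFinite M.Face
  have h1 := M.card_dart_eq_sum_degree
  rw [M.card_dart, ← Finset.add_sum_erase _ _ (Finset.mem_univ M.outerFace),
    Finset.sum_congr rfl (g := fun _ => 4) (fun f hf => h ⟨f, (Finset.mem_erase.1 hf).1⟩),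
    Finset.sum_const, smul_eq_mul] at h1
  have : M.boundaryLength = M.degree M.outerFace := rfl
  rw [this, Nat.even_iff]
  omega

theorem exists_equivariant_equiv {A B : Type} [Finite A] [Finite B] (s : Equiv.Perm A)
    (t : Equiv.Perm B) (hs : s.IsCycleOn Set.univ) (ht : t.IsCycleOn Set.univ)
    (hc : Nat.card A = Nat.card B) (a₀ : A) (b₀ : B) :
    ∃ e : A ≃ B, e a₀ = b₀ ∧ ∀ a, e (s a) = t (e a) := by
  classical
  have := Fintype.ofFinite A
  have := Fintype.ofFinite B
  rw [← Finset.coe_univ] at hs ht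
  rw [Nat.card_eq_fintype_card, Nat.card_eq_fintype_card] at hc
  have hA : ∀ a, ∃ n : ℕ, (s ^ n) a₀ = a := fun a =>
    (hs.2 (Finset.mem_coe.2 (Finset.mem_univ a₀)) (Finset.mem_coe.2 (Finset.mem_univ a))).exists_nat_pow_eq
  have hB : ∀ b, ∃ n : ℕ, (t ^ n) b₀ = b := fun b =>
    (ht.2 (Finset.mem_coe.2 (Finset.mem_univ b₀)) (Finset.mem_coe.2 (Finset.mem_univ b))).exists_nat_pow_eq
  have hAB : ∀ m n : ℕ, (s ^ m) a₀ = (s ^ n) a₀ ↔ (t ^ m) b₀ = (t ^ n) b₀ := fun m n => by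
    rw [hs.pow_apply_eq_pow_apply (Finset.mem_univ _), ht.pow_apply_eq_pow_apply (Finset.mem_univ _),
      Finset.card_univ, Finset.card_univ, hc]
  choose k hk using hA
  have hpow : ∀ n : ℕ, (t ^ k ((s ^ n) a₀)) b₀ = (t ^ n) b₀ := fun n => (hAB _ _).1 (hk _)
  refine ⟨Equiv.ofBijective (fun a => (t ^ k a) b₀) ⟨fun a a' h => ?_, fun b => ?_⟩, ?_, ?_⟩
  · rw [← hk a, ← hk a']
    exact (hAB _ _).2 h
  · obtain ⟨n, rfl⟩ := hB b
    exact ⟨_, hpow n⟩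
  · exact hpow 0
  · intro a
    obtain ⟨n, rfl⟩ : ∃ n : ℕ, (s ^ n) a₀ = a := ⟨_, hk a⟩
    change (t ^ k (s ((s ^ n) a₀))) b₀ = t ((t ^ k ((s ^ n) a₀)) b₀)
    rw [hpow, ← Equiv.Perm.mul_apply, ← Equiv.Perm.mul_apply, ← pow_succ', ← pow_succ', hpow]

theorem faceNext_isCycleOn (f : M.Face) : (M.faceNext f).IsCycleOn Set.univ := by
  refine ⟨Set.bijOn_univ.2 (M.faceNext f).bijective, fun d _ d' _ => ?_⟩
  have := eq_of_faceNext (u := fun d => (Quotient.mk (Equiv.Perm.SameCycle.setoid (M.faceNext f)) d))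
    (fun d => (Quotient.sound (Equiv.Perm.sameCycle_apply_self _ d)).symm) d d'
  exact Quotient.exact this

/-- A face and the boundary of a map with a boundary of the same length can be matched in reverse
order, starting from given darts. -/
theorem exists_seam (f : M.Face) (d₀ : {d // M.faceOf d = f}) (N : RootedMap)
    (hN : N.boundaryLength = M.degree f) :
    ∃ e : {d // M.faceOf d = f} ≃ {e // N.faceOf e = N.outerFace},
      e d₀ = ⟨N.root, rfl⟩ ∧ ∀ d, N.next (e (M.faceNext f d)).1 = (e d).1 := by
  -- The inverse appears because a hole and the disk that fills it traverse their common contour in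
  -- opposite directions.
  obtain ⟨e, h1, h2⟩ := exists_equivariant_equiv (M.faceNext f) (N.faceNext N.outerFace)⁻¹
    (M.faceNext_isCycleOn f) (N.faceNext_isCycleOn _).inv hN.symm d₀ ⟨N.root, rfl⟩
  refine ⟨e, h1, fun d => ?_⟩
  rw [h2]
  have := congrArg Subtype.val ((N.faceNext N.outerFace).apply_symm_apply (e d))
  exact this

/-! ### Cutting edges and keeping the component of a dart -/

variable (C : Set M.Dart) (r : M.Dart)

/-- The darts whose origin can be reached from that of `r` without crossing the edges of `C`. -/
inductive Reach : M.Dart → Prop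
  | base : Reach r
  | rot {d} : Reach d → Reach (M.rot d)
  | flip {d} : Reach d → d ∉ C → Reach (M.flip d)

variable {M C r}

theorem Reach.apply_eq {Y : Type*} {u : M.Dart → Y} (hrot : ∀ d, u (M.rot d) = u d)
    (hflip : ∀ d ∉ C, u (M.flip d) = u d) {d : M.Dart} (h : M.Reach C r d) : u d = u r := by
  induction h with
  | base => rfl
  | rot _ ih => rw [hrot, ih]
  | flip _ hd ih => rw [hflip _ hd, ih]

variable (hC : ∀ d ∈ C, M.flip d ∈ C)

include hC in
theorem flip_mem_iff (d : M.Dart) : M.flip d ∈ C ↔ d ∈ C :=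
  ⟨fun h => by simpa [M.flip_flip] using hC _ h, hC d⟩

variable (M C r) in
def componentDarts : Set M.Dart := {d | d ∉ C ∧ M.Reach C r d}

include hC in
theorem flip_mem_componentDarts (d : M.Dart) :
    d ∈ M.componentDarts C r ↔ M.flip d ∈ M.componentDarts C r := by
  have key : ∀ d, d ∈ M.componentDarts C r → M.flip d ∈ M.componentDarts C r :=
    fun d hd => ⟨fun h => hd.1 ((flip_mem_iff hC d).1 h), hd.2.flip hd.1⟩
  exact ⟨key d, fun h => by simpa [M.flip_flip] using key _ h⟩

variable (M C r) in
/-- The component of `r` when the edges of `C` are erased. -/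
def component (hC : ∀ d ∈ C, M.flip d ∈ C) (hr : r ∉ C) : RootedMap where
  Dart := M.componentDarts C r
  finite_dart := inferInstance
  rot := restrictCycles M.rot (M.componentDarts C r)
  flip := M.flip.subtypeEquiv (flip_mem_componentDarts hC)
  flip_flip d := Subtype.ext (M.flip_flip d.1)
  flip_ne d h := M.flip_ne d.1 (congrArg Subtype.val h)
  root := ⟨r, hr, .base⟩

variable {hC} {hr : r ∉ C}

def component.val (d : (M.component C r hC hr).Dart) : M.Dart := Subtype.val d

theorem component.val_injective :
    Function.Injective (component.val : (M.component C r hC hr).Dart → M.Dart) :=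
  Subtype.val_injective

theorem component.notMem (d : (M.component C r hC hr).Dart) : component.val d ∉ C := d.2.1

theorem component.reach (d : (M.component C r hC hr).Dart) : M.Reach C r (component.val d) := d.2.2

theorem component.rot_of_notMem (d : (M.component C r hC hr).Dart)
    (h : M.rot (component.val d) ∉ C) :
    component.val ((M.component C r hC hr).rot d) = M.rot (component.val d) :=
  restrictCycles_apply_of_mem M.rot _ d ⟨h, (component.reach d).rot⟩

theorem component.rot_of_mem (hrot : ∀ d ∈ C, M.rot d ∉ C) (d : (M.component C r hC hr).Dart)
    (h : M.rot (component.val d) ∈ C) :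
    component.val ((M.component C r hC hr).rot d) = M.rot (M.rot (component.val d)) :=
  restrictCycles_apply_of_notMem M.rot _ d (fun h' => h'.1 h)
    ⟨hrot _ h, (component.reach d).rot.rot⟩

theorem component.next_of_notMem (d : (M.component C r hC hr).Dart)
    (h : M.next (component.val d) ∉ C) :
    component.val ((M.component C r hC hr).next d) = M.next (component.val d) := by
  rw [next_apply] at *
  exact component.rot_of_notMem _ h

theorem component.next_of_mem (hrot : ∀ d ∈ C, M.rot d ∉ C) (d : (M.component C r hC hr).Dart)
    (h : M.next (component.val d) ∈ C) :
    component.val ((M.component C r hC hr).next d) = M.next (M.flip (M.next (component.val d))) := by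
  rw [M.next_flip]
  rw [next_apply] at *
  exact component.rot_of_mem hrot _ h

theorem component.isConnected (hrot : ∀ d ∈ C, M.rot d ∉ C) :
    (M.component C r hC hr).IsConnected := by
  refine isConnected_of fun S h1 h2 h3 => ?_
  -- A path may stand on an erased dart; by `hrot` its successor around the vertex is kept and
  -- serves as a substitute in the induction.
  have key : ∀ d, M.Reach C r d →
      (d ∉ C → ∃ e ∈ S, component.val e = d) ∧ (d ∈ C → ∃ e ∈ S, component.val e = M.rot d) := by
    intro d hd
    induction hd with
    | base => exact ⟨fun _ => ⟨_, h1, rfl⟩, fun h => (hr h).elim⟩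
    | @rot d hd ih =>
      by_cases hdC : d ∈ C
      · exact ⟨fun _ => ih.2 hdC, fun h => (hrot d hdC h).elim⟩
      · obtain ⟨e, he, rfl⟩ := ih.1 hdC
        exact ⟨fun h => ⟨_, h2 e he, component.rot_of_notMem e h⟩,
          fun h => ⟨_, h2 e he, component.rot_of_mem hrot e h⟩⟩
    | @flip d hd hdC ih =>
      obtain ⟨e, he, rfl⟩ := ih.1 hdC
      exact ⟨fun _ => ⟨_, h3 e he, rfl⟩, fun h => (hdC ((flip_mem_iff hC _).1 h)).elim⟩
  intro d
  obtain ⟨e, he, h⟩ := (key (component.val d) (component.reach d)).1 (component.notMem d)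
  rwa [← component.val_injective h]

/-! ### Crossed faces -/

namespace IsRigid

variable {M : RootedMap} {C : Set M.Dart} (h : M.IsRigid C)
include h

theorem next_four {d : M.Dart} (hd : M.faceOf d ≠ M.outerFace) :
    M.next (M.next (M.next (M.next d))) = d :=
  (M.next_pow_apply_eq_iff d 4).2 (h.quad ⟨_, hd⟩).dvd

theorem next_two_ne {d : M.Dart} (hd : M.faceOf d ≠ M.outerFace) : M.next (M.next d) ≠ d := by
  intro h2
  have := (M.next_pow_apply_eq_iff d 2).1 h2
  rw [h.quad ⟨_, hd⟩] at this
  omega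

/-- By rigidity `next (next d)` is crossed; if `next d` were crossed as well, the face would have
three crossed darts instead of two. -/
theorem next_notMem {d : M.Dart} (hd : d ∈ C) : M.next d ∉ C := by
  classical
  intro hd'
  have ho := h.crossed_inner d hd
  have hne : M.next d ≠ d := fun h1 => h.next_two_ne ho (by rw [h1, h1])
  have hne2 : M.next (M.next d) ≠ M.next d := fun h1 => hne (M.next.injective h1)
  have := Fintype.ofFinite M.Dart
  have h2 := h.crossed_two d hd
  rw [Nat.card_eq_fintype_card, Fintype.card_subtype] at h2
  have hsub : ({d, M.next d, M.next (M.next d)} : Finset M.Dart) ⊆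
      Finset.univ.filter fun e => e ∈ C ∧ M.faceOf e = M.faceOf d := by
    intro e he
    simp only [Finset.mem_insert, Finset.mem_singleton] at he
    rcases he with rfl | rfl | rfl
    · simp [hd]
    · simp [hd']
    · simp [h.rigid d hd]
  have h3 := Finset.card_le_card hsub
  rw [Finset.card_insert_of_notMem, Finset.card_pair hne2.symm, h2] at h3
  · omega
  · simp [hne.symm, (h.next_two_ne ho).symm]

theorem rot_notMem {d : M.Dart} (hd : d ∈ C) : M.rot d ∉ C := by
  rw [rot_apply]
  exact h.next_notMem (h.crossed_flip d hd)

theorem of_iso {N : RootedMap} {C' : Set N.Dart} (e : Iso M N)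
    (he : ∀ d, d ∈ C ↔ e.toEquiv d ∈ C') : N.IsRigid C' where
  quad f := by
    obtain ⟨f, rfl⟩ := e.innerFace.surjective f
    exact (e.degree_face f.1).trans (h.quad f)
  crossed_flip d hd := by
    obtain ⟨d, rfl⟩ := e.toEquiv.surjective d
    rw [← e.map_flip, ← he]
    exact h.crossed_flip d ((he d).2 hd)
  crossed_two d hd := by
    obtain ⟨d, rfl⟩ := e.toEquiv.surjective d
    rw [← h.crossed_two d ((he d).2 hd)]
    refine (Nat.card_congr (e.toEquiv.subtypeEquiv fun a => ?_)).symm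
    rw [he, e.faceOf_eq_iff]
  crossed_inner d hd := by
    obtain ⟨d, rfl⟩ := e.toEquiv.surjective d
    rw [← e.face_faceOf, ← e.face_outerFace, Ne, e.face.apply_eq_iff_eq]
    exact h.crossed_inner d ((he d).2 hd)
  rigid d hd := by
    obtain ⟨d, rfl⟩ := e.toEquiv.surjective d
    rw [← e.map_next, ← e.map_next, ← he]
    exact h.rigid d ((he d).2 hd)

end IsRigid

end RootedMap

/-! ### Decomposition of a loop-decorated quadrangulation along its gasket -/

/-- A map drawn on the darts of a loop-decorated quadrangulation which are not crossed, with the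
cyclic order obtained by skipping the crossed darts. -/
structure GasketEmbedding {p : ℕ} (M : RootedMap) (Q : LoopQuadrangulation p) where
  toFun : M.Dart → Q.map.Dart
  injective : Function.Injective toFun
  map_root : toFun M.root = Q.map.root
  map_flip : ∀ d, toFun (M.flip d) = Q.map.flip (toFun d)
  notMem : ∀ d, toFun d ∉ Q.crossed
  next_of_notMem : ∀ d, Q.map.next (toFun d) ∉ Q.crossed →
    toFun (M.next d) = Q.map.next (toFun d)
  next_of_mem : ∀ d, Q.map.next (toFun d) ∈ Q.crossed →
    toFun (M.next d) = Q.map.next (Q.map.flip (Q.map.next (toFun d)))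

namespace GasketEmbedding

variable {p : ℕ} {M : RootedMap} {Q : LoopQuadrangulation p}

/-- Any loop-decorated quadrangulation has a gasket: the component of the root when all the crossed
edges are erased. -/
def ofQuadrangulation (Q : LoopQuadrangulation p) :
    GasketEmbedding (Q.map.component Q.crossed Q.map.root Q.crossed_flip
      (fun h => Q.crossed_inner _ h rfl)) Q where
  toFun := RootedMap.component.val
  injective := RootedMap.component.val_injective
  map_root := rfl
  map_flip _ := rfl
  notMem := RootedMap.component.notMem
  next_of_notMem := RootedMap.component.next_of_notMem
  next_of_mem := RootedMap.component.next_of_mem fun _ => Q.isRigid.rot_notMem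

/-- Fillings are built over a chosen representative of a class of maps, which is only isomorphic to
the component of the root. -/
def ofIso {N : RootedMap} (E : GasketEmbedding M Q) (e : RootedMap.Iso N M) :
    GasketEmbedding N Q where
  toFun d := E.toFun (e.toEquiv d)
  injective := E.injective.comp e.toEquiv.injective
  map_root := by rw [e.map_root, E.map_root]
  map_flip d := by rw [e.map_flip, E.map_flip]
  notMem d := E.notMem _
  next_of_notMem d h := by rw [e.map_next, E.next_of_notMem _ h]
  next_of_mem d h := by rw [e.map_next, E.next_of_mem _ h]

variable (E : GasketEmbedding M Q)

/-! ### Faces of the gasket and their contact with loops. -/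

theorem rigid_iff {d : Q.map.Dart} (hd : Q.map.faceOf d ≠ Q.map.outerFace) :
    Q.map.next (Q.map.next d) ∈ Q.crossed ↔ d ∈ Q.crossed :=
  ⟨fun h => by rw [← Q.isRigid.next_four hd]; exact Q.rigid _ h, Q.rigid d⟩

theorem faceOf_ne_outer {d : Q.map.Dart} (hd : Q.map.next d ∈ Q.crossed) :
    Q.map.faceOf d ≠ Q.map.outerFace := by
  rw [← Q.map.faceOf_next]
  exact Q.crossed_inner _ hd

/-- When the contour of the gasket skips a crossed dart `c`, it resumes at `next (flip c)`, and
rigidity makes the following dart of that face crossed again. So a gasket face follows loops all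
along its contour or nowhere, and in the latter case is a face of `Q`. -/
theorem next_mem_iff (d : M.Dart) : Q.map.next (E.toFun (M.next d)) ∈ Q.crossed ↔
    Q.map.next (E.toFun d) ∈ Q.crossed := by
  by_cases h : Q.map.next (E.toFun d) ∈ Q.crossed
  · rw [E.next_of_mem d h]
    exact iff_of_true (Q.rigid _ (Q.crossed_flip _ h)) h
  · rw [E.next_of_notMem d h]
    refine iff_of_false (fun h' => ?_) h
    have h1 := faceOf_ne_outer h'
    rw [Q.map.faceOf_next] at h1
    exact E.notMem d ((rigid_iff h1).1 h')

/-- The faces of the gasket which are in contact with a loop. -/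
def holes : Set M.Face := {f | ∃ d, M.faceOf d = f ∧ Q.map.next (E.toFun d) ∈ Q.crossed}

theorem faceOf_mem_holes_iff (d : M.Dart) :
    M.faceOf d ∈ E.holes ↔ Q.map.next (E.toFun d) ∈ Q.crossed := by
  refine ⟨?_, fun h => ⟨d, rfl, h⟩⟩
  rintro ⟨d', h1, h2⟩
  have := ((M.faceOf_eq_iff_sameCycle _ _).1 h1).apply_eq
    (f := fun d => Q.map.next (E.toFun d) ∈ Q.crossed) fun d => propext (E.next_mem_iff d)
  exact this ▸ h2

theorem outerFace_notMem_holes : M.outerFace ∉ E.holes := by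
  rw [RootedMap.outerFace, E.faceOf_mem_holes_iff, E.map_root]
  intro h
  exact faceOf_ne_outer h rfl

theorem map_rot_induction {Y : Type*} (u : Q.map.Dart → Y) (hrot : ∀ d, u (Q.map.rot d) = u d)
    (hflip : ∀ d ∉ Q.crossed, u (Q.map.flip d) = u d) (hM : M.IsConnected) (d : M.Dart) :
    u (E.toFun d) = u Q.map.root := by
  have hnext : ∀ d, u (Q.map.next d) = u (Q.map.flip d) := fun d => hrot _
  refine hM.induction_next (S := {d | u (E.toFun d) = u Q.map.root}) M.root
    (congrArg u E.map_root) (fun d hd => ?_) (fun d hd => ?_) d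
  · refine Eq.trans ?_ hd
    by_cases h : Q.map.next (E.toFun d) ∈ Q.crossed
    · rw [E.next_of_mem d h, hnext, Q.map.flip_flip, hnext, hflip _ (E.notMem d)]
    · rw [E.next_of_notMem d h, hnext, hflip _ (E.notMem d)]
  · refine Eq.trans ?_ hd
    rw [E.map_flip, hflip _ (E.notMem d)]

/-! #### Gluing back -/

section Glue

variable {G : GlueData} (E : GasketEmbedding G.base Q) (hholes : G.holes = E.holes)
  (θ : ∀ j, (G.disk j).Dart → Q.map.Dart)

/-- The quadrangle along a side `d` of a hole consists of `d`, a crossed dart, the opposite dart on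
the boundary of the disk, and a second crossed dart. -/
def glueFun : G.Dart → Q.map.Dart
  | .base d => E.toFun d
  | .inner j e => θ j e
  | .rimIn _ d => Q.map.next (E.toFun d.1)
  | .rimOut _ d => Q.map.next (Q.map.next (Q.map.next (E.toFun d.1)))

include hholes in
theorem next_mem_of_side {j : G.holes} (d : G.Side j) :
    Q.map.next (E.toFun d.1) ∈ Q.crossed := by
  rw [← E.faceOf_mem_holes_iff, d.2, ← hholes]
  exact j.2

include hholes in
-- The content of the holes enters only through maps `θ` compatible with the seams, so that the
-- result applies both to the disks cut out of `Q` and to representatives of their classes.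
-- Bijectivity reduces to the fibre of the root: the root is not crossed, not in a disk by `hroot`,
-- and has one preimage in the base.
theorem glueFun_bijective
    (hflip : ∀ j e, θ j ((G.disk j).flip e) = Q.map.flip (θ j e))
    (hnext : ∀ j e, (G.disk j).faceOf e ≠ (G.disk j).outerFace →
      θ j ((G.disk j).next e) = Q.map.next (θ j e))
    (hseam : ∀ j d, θ j (G.seam j d).1 = Q.map.next (Q.map.next (E.toFun d.1)))
    (hroot : ∀ j e, θ j e ≠ Q.map.root) :
    Function.Bijective (E.glueFun θ) ∧
      (∀ a, E.glueFun θ (G.glue.next a) = Q.map.next (E.glueFun θ a)) ∧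
      (∀ a, E.glueFun θ (G.glue.flip a) = Q.map.flip (E.glueFun θ a)) ∧
      E.glueFun θ G.glue.root = Q.map.root := by
  have hN : ∀ a, E.glueFun θ (G.glue.next a) = Q.map.next (E.glueFun θ a) := by
    intro a
    rw [G.glue_next]
    rcases a with d | ⟨j, e⟩ | ⟨j, d⟩ | ⟨j, d⟩
    · by_cases h : G.base.faceOf d ∈ G.holes
      · rw [G.nextFun_base_of_mem ⟨_, h⟩ rfl]
        rfl
      · rw [GlueData.nextFun_base_of_notMem G h]
        refine E.next_of_notMem d fun h' => h ?_
        rwa [hholes, E.faceOf_mem_holes_iff]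
    · by_cases h : (G.disk j).faceOf e = (G.disk j).outerFace
      · rw [GlueData.nextFun_inner_of_eq G h]
        simp only [glueFun]
        rw [← hseam, Equiv.apply_symm_apply]
      · rw [GlueData.nextFun_inner_of_ne G h]
        exact hnext j e h
    · exact hseam j d
    · exact (Q.isRigid.next_four (faceOf_ne_outer (E.next_mem_of_side hholes d))).symm
  -- The contour of the gasket crosses from one quadrangle of the rim to the next one; going three
  -- steps around the latter returns to the shared edge.
  have key : ∀ {j : G.holes} (d : G.Side j), E.glueFun θ (.rimOut j (G.base.faceNext _ d)) =
      Q.map.flip (Q.map.next (E.toFun d.1)) := by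
    intro j d
    have h := E.next_mem_of_side hholes d
    simp only [glueFun, RootedMap.faceNext_val]
    rw [E.next_of_mem _ h]
    exact Q.isRigid.next_four (Q.crossed_inner _ (Q.crossed_flip _ h))
  have hF : ∀ a, E.glueFun θ (G.glue.flip a) = Q.map.flip (E.glueFun θ a) := by
    rintro (d | ⟨j, e⟩ | ⟨j, d⟩ | ⟨j, d⟩)
    · exact E.map_flip d
    · exact hflip j e
    · exact key d
    · have := key ((G.base.faceNext _).symm d)
      rw [Equiv.apply_symm_apply] at this
      rw [this, Q.map.flip_flip]
      rfl
  refine ⟨RootedMap.bijective_of_root_fiber Q.planar.1 _ hN hF E.map_root ?_, hN, hF, E.map_root⟩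
  have hrc : Q.map.root ∉ Q.crossed := fun h => Q.crossed_inner _ h rfl
  rintro (d | ⟨j, e⟩ | ⟨j, d⟩ | ⟨j, d⟩) h
  · rw [E.injective (h.trans E.map_root.symm)]
  · exact (hroot j e h).elim
  · refine (hrc ?_).elim
    rw [← h]
    exact E.next_mem_of_side hholes d
  · refine (hrc ?_).elim
    rw [← h]
    exact Q.rigid _ (E.next_mem_of_side hholes d)

include hholes in
theorem glueFun_mem_crossed_iff (cr : ∀ j, Set (G.disk j).Dart)
    (hcr : ∀ j e, e ∈ cr j ↔ θ j e ∈ Q.crossed) (a : G.Dart) :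
    a ∈ G.crossed cr ↔ E.glueFun θ a ∈ Q.crossed := by
  rcases a with d | ⟨j, e⟩ | ⟨j, d⟩ | ⟨j, d⟩
  · exact iff_of_false id (E.notMem d)
  · exact hcr j e
  · exact iff_of_true trivial (E.next_mem_of_side hholes d)
  · exact iff_of_true trivial (Q.rigid _ (E.next_mem_of_side hholes d))

end Glue

/-! #### The disk inside a loop -/

section Disk

variable (j : E.holes)

abbrev Side : Type := {d // M.faceOf d = j.1}

theorem side_mem (d : E.Side j) : Q.map.next (E.toFun d.1) ∈ Q.crossed := by
  rw [← E.faceOf_mem_holes_iff, d.2]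
  exact j.2

theorem side_inner (d : E.Side j) : Q.map.faceOf (E.toFun d.1) ≠ Q.map.outerFace :=
  faceOf_ne_outer (E.side_mem j d)

/-- The darts crossed by the loop in contact with a hole. -/
def rim : Set Q.map.Dart :=
  {a | ∃ d : E.Side j, a = Q.map.next (E.toFun d.1) ∨
    a = Q.map.next (Q.map.next (Q.map.next (E.toFun d.1)))}

theorem rim_subset {a : Q.map.Dart} (ha : a ∈ E.rim j) : a ∈ Q.crossed := by
  obtain ⟨d, rfl | rfl⟩ := ha
  · exact E.side_mem j d
  · exact Q.rigid _ (E.side_mem j d)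

theorem next_three_faceNext (d : E.Side j) :
    Q.map.next (Q.map.next (Q.map.next (E.toFun (M.faceNext _ d).1))) =
      Q.map.flip (Q.map.next (E.toFun d.1)) := by
  rw [RootedMap.faceNext_val, E.next_of_mem _ (E.side_mem j d)]
  exact Q.isRigid.next_four (Q.crossed_inner _ (Q.crossed_flip _ (E.side_mem j d)))

theorem flip_mem_rim {a : Q.map.Dart} (ha : a ∈ E.rim j) : Q.map.flip a ∈ E.rim j := by
  obtain ⟨d, rfl | rfl⟩ := ha
  · exact ⟨_, Or.inr (E.next_three_faceNext j d).symm⟩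
  · refine ⟨(M.faceNext _).symm d, Or.inl ?_⟩
    have := E.next_three_faceNext j ((M.faceNext _).symm d)
    rw [Equiv.apply_symm_apply] at this
    rw [this, Q.map.flip_flip]

theorem next_next_mem_rim {a : Q.map.Dart} (ha : a ∈ E.rim j) :
    Q.map.next (Q.map.next a) ∈ E.rim j := by
  obtain ⟨d, rfl | rfl⟩ := ha
  · exact ⟨d, Or.inr rfl⟩
  · refine ⟨d, Or.inl ?_⟩
    rw [Q.isRigid.next_four (E.side_inner j d)]

theorem rot_notMem_rim {a : Q.map.Dart} (ha : a ∈ E.rim j) : Q.map.rot a ∉ E.rim j :=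
  fun h => Q.isRigid.rot_notMem (E.rim_subset j ha) (E.rim_subset j h)

/-- The Jordan curve theorem for a loop: it separates the vertices into two sides. -/
theorem exists_side_coloring : ∃ u : Q.map.Dart → ZMod 2, (∀ d, u (Q.map.rot d) = u d) ∧
    (∀ d ∉ E.rim j, u (Q.map.flip d) = u d) ∧ ∀ d ∈ E.rim j, u (Q.map.flip d) = u d + 1 := by
  classical
  have := Fintype.ofFinite Q.map.Dart
  obtain ⟨c, hc⟩ := Q.planar.exists_coloring (fun d => if d ∈ E.rim j then 1 else 0)
    (fun d => by
      simp only [RootedMap.flip_mem_iff (fun d => E.flip_mem_rim j)]) fun f => by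
    by_cases hf : f = Q.map.outerFace
    · refine Finset.sum_eq_zero fun d hd => if_neg fun h => ?_
      exact Q.crossed_inner _ (E.rim_subset j h) ((Finset.mem_filter.1 hd).2.trans hf)
    -- In an inner face the rim darts come in opposite pairs, exchanged by the fixed-point-free
    -- involution `next ∘ next`; so the rim meets every face an even number of times.
    refine Finset.sum_involution (fun d _ => Q.map.next (Q.map.next d)) ?_ ?_ ?_ ?_
    · intro d hd
      by_cases h : d ∈ E.rim j
      · rw [if_pos h, if_pos (E.next_next_mem_rim j h)]
        exact CharTwo.add_self_eq_zero _
      · rw [if_neg h, if_neg, add_zero]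
        intro h'
        apply h
        have h1 := Q.crossed_inner _ (E.rim_subset j h')
        rw [Q.map.faceOf_next, Q.map.faceOf_next] at h1
        rw [← Q.isRigid.next_four h1]
        exact E.next_next_mem_rim j h'
    · intro d hd h
      have h1 : d ∈ E.rim j := by
        by_contra h1
        exact h (if_neg h1)
      exact Q.isRigid.next_two_ne (Q.crossed_inner _ (E.rim_subset j h1))
    · intro d hd
      simpa using hd
    · intro d hd
      exact Q.isRigid.next_four (by rwa [(Finset.mem_filter.1 hd).2])
  refine ⟨fun d => c (Q.map.vertexOf d), fun d => by simp, fun d hd => ?_, fun d hd => ?_⟩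
  · exact (hc d).trans (by rw [if_neg hd, add_zero])
  · exact (hc d).trans (by rw [if_pos hd])

/-- The gasket is connected without crossing the rim, so it has the colour of the root. The dart
opposite to a side of the hole is one rim edge away from it, hence has the other colour. -/
theorem exists_interior_coloring (hM : M.IsConnected) : ∃ u : Q.map.Dart → ZMod 2,
    (∀ d, u (Q.map.rot d) = u d) ∧ (∀ d ∉ E.rim j, u (Q.map.flip d) = u d) ∧
    (∀ d, u (E.toFun d) = u Q.map.root) ∧
    ∀ d : E.Side j, u (Q.map.next (Q.map.next (E.toFun d.1))) ≠ u Q.map.root := by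
  obtain ⟨u, h1, h2, h3⟩ := E.exists_side_coloring j
  have h4 := E.map_rot_induction u h1 (fun d hd => h2 d fun h => hd (E.rim_subset j h)) hM
  refine ⟨u, h1, h2, h4, fun d => ?_⟩
  have hnext : ∀ d, u (Q.map.next d) = u (Q.map.flip d) := fun d => h1 _
  rw [hnext, h3 _ ⟨d, Or.inl rfl⟩, hnext, h2 _ fun h => E.notMem _ (E.rim_subset j h), h4]
  simp

def holeSide : E.Side j := ⟨Quotient.out j.1, Quotient.out_eq j.1⟩

theorem next_two_notMem_crossed (d : E.Side j) :
    Q.map.next (Q.map.next (E.toFun d.1)) ∉ Q.crossed :=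
  fun h => E.notMem d.1 ((rigid_iff (E.side_inner j d)).1 h)

/-- The disk inside the loop in contact with a hole. -/
def disk : RootedMap :=
  Q.map.component (E.rim j) (Q.map.next (Q.map.next (E.toFun (E.holeSide j).1)))
    (fun _ => E.flip_mem_rim j)
    (fun h => E.next_two_notMem_crossed j _ (E.rim_subset j h))

def diskVal (e : (E.disk j).Dart) : Q.map.Dart := RootedMap.component.val e

theorem diskVal_injective : Function.Injective (E.diskVal j) :=
  RootedMap.component.val_injective

theorem disk_isConnected : (E.disk j).IsConnected :=
  RootedMap.component.isConnected fun _ => E.rot_notMem_rim j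

theorem diskVal_next_of_notMem (e) (h : Q.map.next (E.diskVal j e) ∉ E.rim j) :
    E.diskVal j ((E.disk j).next e) = Q.map.next (E.diskVal j e) :=
  RootedMap.component.next_of_notMem e h

theorem diskVal_next_of_mem (e) (h : Q.map.next (E.diskVal j e) ∈ E.rim j) :
    E.diskVal j ((E.disk j).next e) = Q.map.next (Q.map.flip (Q.map.next (E.diskVal j e))) :=
  RootedMap.component.next_of_mem (fun _ => E.rot_notMem_rim j) e h

/-- The colour is constant on what is reachable without crossing the rim. This keeps the disk
disjoint from the gasket, and in particular away from the root. -/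
theorem diskVal_color (hM : M.IsConnected) : ∃ u : Q.map.Dart → ZMod 2,
    (∀ d, u (E.toFun d) = u Q.map.root) ∧ ∀ e, u (E.diskVal j e) ≠ u Q.map.root := by
  obtain ⟨u, h1, h2, h3, h4⟩ := E.exists_interior_coloring j hM
  refine ⟨u, h3, fun e => ?_⟩
  intro he
  exact h4 _ (((RootedMap.component.reach e).apply_eq h1 h2).symm.trans he)

/-- Inner sides of consecutive quadrangles of the rim share a vertex, the inner end of their common
crossed edge. Walking around the loop thus connects all of them to the root of the disk. -/
theorem reach_next_two (d : E.Side j) : Q.map.Reach (E.rim j)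
    (Q.map.next (Q.map.next (E.toFun (E.holeSide j).1)))
    (Q.map.next (Q.map.next (E.toFun d.1))) := by
  have key : ∀ d : E.Side j, Q.map.Reach (E.rim j)
      (Q.map.next (Q.map.next (E.toFun (E.holeSide j).1)))
      (Q.map.next (Q.map.next (E.toFun ((M.faceNext _) d).1))) → Q.map.Reach (E.rim j)
      (Q.map.next (Q.map.next (E.toFun (E.holeSide j).1)))
      (Q.map.next (Q.map.next (E.toFun d.1))) := by
    intro d hd
    have h1 := hd.flip fun h => E.next_two_notMem_crossed j _ (E.rim_subset j h)
    have h2 := h1.rot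
    rw [← RootedMap.next_apply, E.next_three_faceNext j d] at h2
    have h3 := h2.rot
    rwa [← RootedMap.next_apply] at h3
  have h := RootedMap.eq_of_faceNext (u := fun d : E.Side j => Q.map.Reach (E.rim j)
      (Q.map.next (Q.map.next (E.toFun (E.holeSide j).1)))
      (Q.map.next (Q.map.next (E.toFun d.1)))) (fun d => propext ⟨key d, fun hd => ?_⟩)
    (E.holeSide j) d
  · exact h ▸ RootedMap.Reach.base
  -- `key` only goes backwards along the contour; on a finite cycle this gives the forward
  -- direction.
  · refine Equiv.Perm.mem_of_apply_mem (M.faceNext _)⁻¹ (S := {d : E.Side j | Q.map.Reach (E.rim j)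
      (Q.map.next (Q.map.next (E.toFun (E.holeSide j).1)))
      (Q.map.next (Q.map.next (E.toFun d.1)))}) (fun d hd => ?_) (d := M.faceNext _ d) ?_
    · refine key _ ?_
      have : M.faceNext j.1 ((M.faceNext j.1)⁻¹ d) = d := (M.faceNext j.1).apply_symm_apply d
      rw [this]
      exact hd
    · have : (M.faceNext j.1)⁻¹ (M.faceNext j.1 d) = d := (M.faceNext j.1).symm_apply_apply d
      rw [this]
      exact hd

def seamDart (d : E.Side j) : (E.disk j).Dart :=
  ⟨Q.map.next (Q.map.next (E.toFun d.1)),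
    fun h => E.next_two_notMem_crossed j _ (E.rim_subset j h), E.reach_next_two j d⟩

theorem diskVal_seamDart (d : E.Side j) :
    E.diskVal j (E.seamDart j d) = Q.map.next (Q.map.next (E.toFun d.1)) := rfl

theorem next_seamDart (d : E.Side j) :
    (E.disk j).next (E.seamDart j (M.faceNext _ d)) = E.seamDart j d := by
  apply E.diskVal_injective j
  have h := E.next_three_faceNext j d
  rw [E.diskVal_next_of_mem, diskVal_seamDart, diskVal_seamDart, h, Q.map.flip_flip]
  exact ⟨_, Or.inr rfl⟩

theorem faceOf_seamDart (d : E.Side j) :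
    (E.disk j).faceOf (E.seamDart j d) = (E.disk j).outerFace := by
  have := RootedMap.eq_of_faceNext (u := fun d => (E.disk j).faceOf (E.seamDart j d))
    (fun d => by rw [← E.next_seamDart j d, RootedMap.faceOf_next]) d (E.holeSide j)
  exact this

/-- As for the gasket, being followed by a rim dart is invariant along contours of the disk. A rim
dart is preceded in its quadrangle by the side on the gasket or by the opposite one; the colouring
excludes the first, so the outer face consists of the inner sides of the rim and nothing else. -/
theorem faceOf_eq_outerFace_iff (hM : M.IsConnected) (e : (E.disk j).Dart) :
    ((E.disk j).faceOf e = (E.disk j).outerFace ↔ Q.map.next (E.diskVal j e) ∈ E.rim j) ∧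
      ((E.disk j).faceOf e = (E.disk j).outerFace → ∃ d, E.seamDart j d = e) := by
  have hinv : ∀ e : (E.disk j).Dart, (Q.map.next (E.diskVal j ((E.disk j).next e)) ∈ E.rim j) =
      (Q.map.next (E.diskVal j e) ∈ E.rim j) := by
    intro e
    refine propext ?_
    by_cases h : Q.map.next (E.diskVal j e) ∈ E.rim j
    · rw [E.diskVal_next_of_mem j e h]
      exact iff_of_true (E.next_next_mem_rim j (E.flip_mem_rim j h)) h
    · rw [E.diskVal_next_of_notMem j e h]
      refine iff_of_false (fun h' => RootedMap.component.notMem e ?_) h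
      have h1 := faceOf_ne_outer (E.rim_subset j h')
      rw [Q.map.faceOf_next] at h1
      have h2 := E.next_next_mem_rim j h'
      rwa [Q.isRigid.next_four h1] at h2
  have h1 : (E.disk j).faceOf e = (E.disk j).outerFace → Q.map.next (E.diskVal j e) ∈ E.rim j := by
    intro h
    have := (((E.disk j).faceOf_eq_iff_sameCycle _ _).1 h).apply_eq
      (f := fun e => Q.map.next (E.diskVal j e) ∈ E.rim j) hinv
    simp only [this]
    exact ⟨E.holeSide j, Or.inr rfl⟩
  have h2 : Q.map.next (E.diskVal j e) ∈ E.rim j → ∃ d, E.seamDart j d = e := by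
    rintro ⟨d, h | h⟩
    · exfalso
      obtain ⟨u, hu1, hu2⟩ := E.diskVal_color j hM
      exact hu2 e (by rw [Q.map.next.injective h, hu1])
    · exact ⟨d, E.diskVal_injective j (Q.map.next.injective h.symm)⟩
  refine ⟨⟨h1, fun h => ?_⟩, fun h => h2 (h1 h)⟩
  obtain ⟨d, rfl⟩ := h2 h
  exact E.faceOf_seamDart j d

def diskSeam (hM : M.IsConnected) :
    E.Side j ≃ {e // (E.disk j).faceOf e = (E.disk j).outerFace} :=
  Equiv.ofBijective (fun d => ⟨E.seamDart j d, E.faceOf_seamDart j d⟩) <| by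
    constructor
    · intro d d' h
      have h' := congrArg (fun e => E.diskVal j e.1) h
      exact Subtype.ext (E.injective (Q.map.next.injective (Q.map.next.injective h')))
    · rintro ⟨e, he⟩
      obtain ⟨d, rfl⟩ := (E.faceOf_eq_outerFace_iff j hM e).2 he
      exact ⟨d, rfl⟩

end Disk

/-! #### The decomposition -/

section Decomposition

variable (hM : M.IsConnected)

abbrev glueData : GlueData where
  base := M
  holes := E.holes
  outer_notMem := E.outerFace_notMem_holes
  disk := E.disk
  seam j := E.diskSeam j hM
  seam_next j := E.next_seamDart j

def diskCrossed (j : E.holes) : Set (E.disk j).Dart := {e | E.diskVal j e ∈ Q.crossed}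

include hM in
theorem diskCrossed_inner (j : E.holes) (e) (he : e ∈ E.diskCrossed j) :
    (E.disk j).faceOf e ≠ (E.disk j).outerFace := by
  intro h
  obtain ⟨d, rfl⟩ := (E.faceOf_eq_outerFace_iff j hM e).2 h
  exact E.next_two_notMem_crossed j d he

/-- The gluing is of bare rooted maps, since the pieces are only known to be connected so far. Their
planarity and the rigidity of their configurations are then read off from `Q` through this
isomorphism. -/
theorem exists_rawIso : ∃ e : RootedMap.Iso (E.glueData hM).glue Q.map,
    ∀ a, a ∈ (E.glueData hM).crossed E.diskCrossed ↔ e.toEquiv a ∈ Q.crossed := by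
  have h := glueFun_bijective (G := E.glueData hM) E rfl E.diskVal (fun _ _ => rfl)
    (fun j e he => E.diskVal_next_of_notMem j e fun h =>
      he ((E.faceOf_eq_outerFace_iff j hM e).1.2 h)) (fun j d => rfl)
    (fun j e h => by
      obtain ⟨u, -, hu⟩ := E.diskVal_color j hM
      exact hu e (congrArg u h))
  refine ⟨RootedMap.isoOfBijective _ h.1 h.2.1 h.2.2.1 h.2.2.2, fun a => ?_⟩
  exact glueFun_mem_crossed_iff (G := E.glueData hM) E rfl E.diskVal E.diskCrossed
    (fun _ _ => Iff.rfl) a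

include hM in
theorem isPlanar : M.IsPlanar ∧ ∀ j, (E.disk j).IsPlanar := by
  obtain ⟨e, -⟩ := E.exists_rawIso hM
  exact (E.glueData hM).isPlanar_of_glue (e.symm.isPlanar Q.planar) hM E.disk_isConnected

include E hM in
theorem boundaryLength : M.boundaryLength = p := by
  obtain ⟨e, -⟩ := E.exists_rawIso hM
  rw [← Q.boundary, ← e.boundaryLength]
  exact (E.glueData hM).glue_boundaryLength.symm

theorem glue_isRigid : (E.glueData hM).glue.IsRigid ((E.glueData hM).crossed E.diskCrossed) := by
  obtain ⟨e, he⟩ := E.exists_rawIso hM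
  refine Q.isRigid.of_iso e.symm fun d => ?_
  rw [he]
  exact iff_of_eq (congrArg (· ∈ Q.crossed) (e.toEquiv.apply_symm_apply d).symm)

/-- The disk inside the loop in contact with a hole, with the loops it contains. -/
def diskQuadrangulation (j : E.holes) : LoopQuadrangulation (M.degree j.1) :=
  LoopQuadrangulation.ofIsRigid (E.disk j) ((E.isPlanar hM).2 j)
    (Nat.card_congr (E.diskSeam j hM)).symm (E.diskCrossed j)
    ((E.glueData hM).disk_isRigid_of_glue E.diskCrossed (E.glue_isRigid hM) j
      (E.diskCrossed_inner hM j))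

include hM in
theorem degree_eq_four (f : M.Face) (hf : f ∉ E.holes) (hf' : f ≠ M.outerFace) :
    M.degree f = 4 :=
  (E.glueData hM).base_degree_of_glue_isRigid E.diskCrossed (E.glue_isRigid hM) f hf hf'

include E hM in
-- All degrees are even: `p` for the outer face, 4 for the unvisited quadrangles, and for a hole the
-- boundary length of a quadrangulation.
theorem isBipartite (hp : Even p) : M.IsBipartite := by
  refine (E.isPlanar hM).1.isBipartite fun f => ?_
  by_cases hf : f = M.outerFace
  · subst hf
    have := E.boundaryLength hM
    rw [RootedMap.boundaryLength] at this
    rwa [this]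
  by_cases hf' : f ∈ E.holes
  · have := (E.diskQuadrangulation hM ⟨f, hf'⟩).map.boundaryLength_even_of_quad
      (E.diskQuadrangulation hM ⟨f, hf'⟩).quad
    rwa [(E.diskQuadrangulation hM ⟨f, hf'⟩).boundary] at this
  · rw [E.degree_eq_four hM f hf' hf]
    decide

end Decomposition

end GasketEmbedding

/-! ### Filling the inner faces of a bipartite map -/

/-- The ways to fill each inner face of a map: as a plain quadrangle, or with a loop surrounding a
loop-decorated quadrangulation. -/
abbrev RootedMap.Filling (M : RootedMap) : Type 1 :=
  ∀ f : M.InnerFace, PLift (M.degree f.1 = 4) ⊕ LoopQuadrangulationClass (M.degree f.1)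

namespace BipartiteDisk

variable {p : ℕ} (B : BipartiteDisk p) (ξ : B.map.Filling)

def fillHoles : Set B.map.Face := {f | ∃ h : f ≠ B.map.outerFace, (ξ ⟨f, h⟩).isRight}

def fillClass (j : B.fillHoles ξ) : LoopQuadrangulationClass (B.map.degree j.1) :=
  (ξ ⟨j.1, j.2.fst⟩).getRight j.2.snd

theorem fillClass_eq_iff (j : B.fillHoles ξ) (h : j.1 ≠ B.map.outerFace)
    (x : LoopQuadrangulationClass (B.map.degree j.1)) :
    B.fillClass ξ j = x ↔ ξ ⟨j.1, h⟩ = Sum.inr x :=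
  Sum.getRight_eq_iff _

def fillDisk (j : B.fillHoles ξ) : LoopQuadrangulation (B.map.degree j.1) :=
  Quotient.out (B.fillClass ξ j)

theorem mk_fillDisk (j : B.fillHoles ξ) :
    (Quotient.mk _ (B.fillDisk ξ j) : LoopQuadrangulationClass _) = B.fillClass ξ j :=
  Quotient.out_eq _

/-- A hole has no root of its own, so the root of the disk is glued to an arbitrary dart of the
hole. The choice `Quotient.out j.1` depends on the face and not on the filling, which makes the
contents recoverable. -/
theorem exists_fillSeam (j : B.fillHoles ξ) :
    ∃ e : {d // B.map.faceOf d = j.1} ≃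
        {e // (B.fillDisk ξ j).map.faceOf e = (B.fillDisk ξ j).map.outerFace},
      e ⟨Quotient.out j.1, Quotient.out_eq j.1⟩ = ⟨(B.fillDisk ξ j).map.root, rfl⟩ ∧
        ∀ d, (B.fillDisk ξ j).map.next (e (B.map.faceNext j.1 d)).1 = (e d).1 :=
  B.map.exists_seam j.1 ⟨Quotient.out j.1, Quotient.out_eq j.1⟩ (B.fillDisk ξ j).map
    (B.fillDisk ξ j).boundary

/-- The loop-decorated quadrangulation with given gasket and given contents of the loops. -/
abbrev fill : RigidGlueData p where
  base := B.map
  planar := B.planar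
  boundary := B.boundary
  holes := B.fillHoles ξ
  outer_notMem := fun h => h.fst rfl
  quad f hf hf' := by
    rcases h : ξ ⟨f, hf'⟩ with x | x
    · exact x.down
    · exact (hf ⟨hf', by rw [h]; rfl⟩).elim
  disk := B.fillDisk ξ
  seam j := (B.exists_fillSeam ξ j).choose
  seam_next j := (B.exists_fillSeam ξ j).choose_spec.2

theorem fill_seam_root (j : B.fillHoles ξ) :
    ((B.fill ξ).seam j ⟨Quotient.out j.1, Quotient.out_eq j.1⟩).1 = (B.fillDisk ξ j).map.root :=
  congrArg Subtype.val (B.exists_fillSeam ξ j).choose_spec.1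

/-! #### Surjectivity -/

variable {ξ}

/-- Each hole is filled with the class of the disk cut out of `Q`. The representative of that class
is only isomorphic to the disk, and `θ` transports it into `Q`. -/
theorem exists_fill {Q : LoopQuadrangulation p} (E : GasketEmbedding B.map Q) :
    ∃ ξ, Nonempty (LoopQuadrangulation.Iso (B.fill ξ).glue Q) := by
  classical
  have hM := B.planar.1
  let ξ : B.map.Filling := fun f =>
    if h : f.1 ∈ E.holes then Sum.inr (Quotient.mk _ (E.diskQuadrangulation hM ⟨f.1, h⟩))
    else Sum.inl ⟨E.degree_eq_four hM f.1 h f.2⟩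
  have hξ : ∀ f (h : f ≠ B.map.outerFace) (h' : f ∈ E.holes), ξ ⟨f, h⟩ =
      Sum.inr (Quotient.mk _ (E.diskQuadrangulation hM ⟨f, h'⟩)) := fun f h h' => dif_pos h'
  have hholes : B.fillHoles ξ = E.holes := by
    ext f
    constructor
    · rintro ⟨h, h1⟩
      by_contra h2
      have : ξ ⟨f, h⟩ = Sum.inl ⟨E.degree_eq_four hM f h2 h⟩ := dif_neg h2
      rw [this] at h1
      exact Bool.false_ne_true h1
    · intro h
      have h1 : f ≠ B.map.outerFace := fun h1 => E.outerFace_notMem_holes (h1 ▸ h)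
      refine ⟨h1, ?_⟩
      rw [hξ f h1 h]
      rfl
  have hdisk : ∀ j : B.fillHoles ξ, Nonempty (LoopQuadrangulation.Iso
      (E.diskQuadrangulation hM ⟨j.1, hholes ▸ j.2⟩) (B.fillDisk ξ j)) := by
    intro j
    have h := (B.fillClass_eq_iff ξ j j.2.fst _).2 (hξ _ _ (hholes ▸ j.2))
    rw [← mk_fillDisk] at h
    exact Quotient.exact h.symm
  let i := fun j => Classical.choice (hdisk j)
  let θ : ∀ j : B.fillHoles ξ, (B.fillDisk ξ j).map.Dart → Q.map.Dart := fun j e =>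
    E.diskVal ⟨j.1, hholes ▸ j.2⟩ ((i j).toIso.symm.toEquiv e)
  have hθseam : ∀ (j : B.fillHoles ξ) d, θ j ((B.fill ξ).seam j d).1 =
      Q.map.next (Q.map.next (E.toFun d.1)) := by
    intro j d
    let j' : E.holes := ⟨j.1, hholes ▸ j.2⟩
    -- Both seams send the chosen dart of the hole to the root of the disk and reverse the contour,
    -- so they agree everywhere.
    have hinv := RootedMap.eq_of_faceNext (u := fun d => (i j).toIso.symm.toEquiv
      ((B.fill ξ).seam j d).1 = E.seamDart j' d) (fun d => propext ?_)
      ⟨Quotient.out j.1, Quotient.out_eq j.1⟩ d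
    · have h0 : (i j).toIso.symm.toEquiv ((B.fill ξ).seam j d).1 = E.seamDart j' d := by
        refine hinv ▸ ?_
        rw [fill_seam_root]
        exact (i j).toIso.symm.map_root
      exact congrArg (E.diskVal j') h0
    · have h1 := (i j).toIso.symm.map_next ((B.fill ξ).seam j (B.map.faceNext _ d)).1
      have h2 := (B.fill ξ).seam_next j d
      rw [h2] at h1
      rw [h1, ← E.next_seamDart j' d]
      exact ((E.disk j').next.apply_eq_iff_eq).symm
  have h := GasketEmbedding.glueFun_bijective (G := (B.fill ξ).toGlueData) E hholes θ
    (fun j e => by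
      have := (i j).toIso.symm.map_flip e
      exact congrArg (E.diskVal _) this)
    (fun j e he => by
      have h1 := (i j).toIso.symm.map_next e
      refine (congrArg (E.diskVal _) h1).trans (E.diskVal_next_of_notMem _ _ fun h2 => he ?_)
      have h3 := (E.faceOf_eq_outerFace_iff _ hM _).1.2 h2
      have h4 : (E.disk ⟨j.1, hholes ▸ j.2⟩).faceOf ((i j).toIso.symm.toEquiv e) =
        (E.disk ⟨j.1, hholes ▸ j.2⟩).faceOf
          ((i j).toIso.symm.toEquiv (B.fillDisk ξ j).map.root) := by
        rw [h3, (i j).toIso.symm.map_root]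
        rfl
      exact ((i j).toIso.symm.faceOf_eq_iff _ _).1 h4)
    hθseam
    (fun j e h => by
      obtain ⟨u, -, hu⟩ := E.diskVal_color ⟨j.1, hholes ▸ j.2⟩ hM
      exact hu _ (congrArg u h))
  refine ⟨ξ, ⟨⟨RootedMap.isoOfBijective _ h.1 h.2.1 h.2.2.1 h.2.2.2, fun a => ?_⟩⟩⟩
  exact GasketEmbedding.glueFun_mem_crossed_iff (G := (B.fill ξ).toGlueData) E hholes θ
    (fun j => (B.fillDisk ξ j).crossed) (fun j e => (i j).symm.map_crossed e) a

/-! #### Injectivity -/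

theorem next_base_mem_crossed_iff (R : RigidGlueData p) (d : R.base.Dart) :
    R.toGlueData.glue.next (.base d) ∈ R.crossed ↔ R.base.faceOf d ∈ R.holes := by
  rw [GlueData.glue_next]
  by_cases h : R.base.faceOf d ∈ R.holes
  · rw [R.toGlueData.nextFun_base_of_mem ⟨_, h⟩ rfl]
    exact iff_of_true trivial h
  · rw [GlueData.nextFun_base_of_notMem _ h]
    exact iff_of_false id h

theorem next_flip_next_base (R : RigidGlueData p) (d : R.base.Dart)
    (h : R.base.faceOf d ∈ R.holes) :
    R.toGlueData.glue.next (R.toGlueData.glue.flip (R.toGlueData.glue.next (.base d))) =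
      .base (R.base.next d) := by
  have h1 : R.toGlueData.glue.next (.base d) = .rimIn ⟨_, h⟩ ⟨d, rfl⟩ := by
    rw [GlueData.glue_next, R.toGlueData.nextFun_base_of_mem ⟨_, h⟩ rfl]
  rw [h1, GlueData.glue_next]
  rfl

variable {ξ' : B.map.Filling} (e : LoopQuadrangulation.Iso (B.fill ξ).glue (B.fill ξ').glue)

/-- From the root, all base darts are reached by `flip` and by the contours of the base, which are
read off from the glued map and its crossed darts; an isomorphism preserves these data. -/
theorem fill_iso_base (d : B.map.Dart) : e.toEquiv (.base d) = .base d := by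
  refine B.planar.1.induction_next (S := {d | e.toEquiv (.base d) = .base d}) B.map.root e.map_root
    (fun d hd => ?_) (fun d hd => ?_) d
  · have h1 : e.toEquiv ((B.fill ξ).toGlueData.glue.next (.base d)) =
        (B.fill ξ').toGlueData.glue.next (.base d) :=
      (e.map_next (.base d)).trans (congrArg _ hd)
    have h2 := e.map_crossed ((B.fill ξ).toGlueData.glue.next (.base d))
    rw [h1] at h2
    have h3 := (next_base_mem_crossed_iff (B.fill ξ) d).symm.trans
      (h2.trans (next_base_mem_crossed_iff (B.fill ξ') d))
    change e.toEquiv (.base (B.map.next d)) = _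
    by_cases h : B.map.faceOf d ∈ B.fillHoles ξ
    · have h4 := next_flip_next_base (B.fill ξ) d h
      have h5 := next_flip_next_base (B.fill ξ') d (h3.1 h)
      rw [← h4, ← h5]
      refine (e.map_next _).trans (congrArg _ ?_)
      refine (e.map_flip _).trans (congrArg _ ?_)
      exact h1
    · rw [GlueData.glue_next, GlueData.glue_next, GlueData.nextFun_base_of_notMem _ h,
        GlueData.nextFun_base_of_notMem _ (fun h' => h (h3.2 h'))] at h1
      exact h1
  · exact (e.map_flip (.base d)).trans (congrArg (B.fill ξ').toGlueData.glue.flip hd)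

include e in
theorem fillHoles_eq_of_iso : B.fillHoles ξ = B.fillHoles ξ' := by
  ext f
  obtain ⟨d, rfl⟩ := B.map.faceOf_surjective f
  have h1 : e.toEquiv ((B.fill ξ).toGlueData.glue.next (.base d)) =
      (B.fill ξ').toGlueData.glue.next (.base d) :=
    (e.map_next (.base d)).trans (congrArg _ (B.fill_iso_base e d))
  have h2 := e.map_crossed ((B.fill ξ).toGlueData.glue.next (.base d))
  rw [h1] at h2
  exact (next_base_mem_crossed_iff (B.fill ξ) d).symm.trans
    (h2.trans (next_base_mem_crossed_iff (B.fill ξ') d))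

theorem fill_iso_seam (f : B.map.Face) (h : f ∈ B.fillHoles ξ) (h' : f ∈ B.fillHoles ξ')
    (d : {d // B.map.faceOf d = f}) :
    e.toEquiv (.inner ⟨f, h⟩ ((B.fill ξ).seam ⟨f, h⟩ d).1) =
      .inner ⟨f, h'⟩ ((B.fill ξ').seam ⟨f, h'⟩ d).1 := by
  have h1 : (B.fill ξ).toGlueData.glue.next ((B.fill ξ).toGlueData.glue.next (.base d.1)) =
      .inner ⟨f, h⟩ ((B.fill ξ).seam ⟨f, h⟩ d).1 := by
    rw [GlueData.glue_next, GlueData.glue_next, GlueData.nextFun_base_of_mem _ ⟨f, h⟩ d.2]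
    rfl
  have h2 : (B.fill ξ').toGlueData.glue.next ((B.fill ξ').toGlueData.glue.next (.base d.1)) =
      .inner ⟨f, h'⟩ ((B.fill ξ').seam ⟨f, h'⟩ d).1 := by
    rw [GlueData.glue_next, GlueData.glue_next, GlueData.nextFun_base_of_mem _ ⟨f, h'⟩ d.2]
    rfl
  rw [← h1, ← h2]
  refine (e.map_next _).trans (congrArg _ ?_)
  exact (e.map_next _).trans (congrArg _ (B.fill_iso_base e d.1))

include e in
-- The isomorphism fixes the base, hence matches the seams and the roots of the two disks. It then
-- propagates inside: across edges by `flip`, along inner faces by `next` of the glued map, and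
-- along the outer face, which no longer exists there, by the seams.
theorem fillDisk_iso (f : B.map.Face) (h : f ∈ B.fillHoles ξ) (h' : f ∈ B.fillHoles ξ') :
    Nonempty (LoopQuadrangulation.Iso (B.fillDisk ξ ⟨f, h⟩) (B.fillDisk ξ' ⟨f, h'⟩)) := by
  let X := (B.fillDisk ξ ⟨f, h⟩).map
  let X' := (B.fillDisk ξ' ⟨f, h'⟩).map
  have hseam : ∀ a : X.Dart, X.faceOf a = X.outerFace →
      ∃ d, ((B.fill ξ).seam ⟨f, h⟩ d).1 = a := fun a ha =>
    ⟨((B.fill ξ).seam ⟨f, h⟩).symm ⟨a, ha⟩, by rw [Equiv.apply_symm_apply]⟩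
  have hseam' : ∀ a : X'.Dart, X'.faceOf a = X'.outerFace →
      ∃ d, ((B.fill ξ').seam ⟨f, h'⟩ d).1 = a := fun a ha =>
    ⟨((B.fill ξ').seam ⟨f, h'⟩).symm ⟨a, ha⟩, by rw [Equiv.apply_symm_apply]⟩
  have hs := B.fill_iso_seam e f h h'
  have hroot : e.toEquiv (.inner ⟨f, h⟩ X.root) = .inner ⟨f, h'⟩ X'.root := by
    have := hs ⟨Quotient.out f, Quotient.out_eq f⟩
    rwa [B.fill_seam_root ξ ⟨f, h⟩, B.fill_seam_root ξ' ⟨f, h'⟩] at this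
  -- Every boundary dart of the second disk is already the image of a boundary dart of the first.
  have hne : ∀ (a : X.Dart) (a' : X'.Dart), e.toEquiv (.inner ⟨f, h⟩ a) = .inner ⟨f, h'⟩ a' →
      X.faceOf a ≠ X.outerFace → X'.faceOf a' ≠ X'.outerFace := by
    intro a a' ha h1 h2
    obtain ⟨d, rfl⟩ := hseam' a' h2
    rw [← hs] at ha
    have := e.toEquiv.injective ha
    simp only [GlueData.Dart.inner.injEq, heq_eq_eq, true_and] at this
    exact h1 (this ▸ ((B.fill ξ).seam ⟨f, h⟩ d).2)
  have hstep : ∀ (a : X.Dart) (a' : X'.Dart), e.toEquiv (.inner ⟨f, h⟩ a) = .inner ⟨f, h'⟩ a' →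
      e.toEquiv (.inner ⟨f, h⟩ (X.next a)) = .inner ⟨f, h'⟩ (X'.next a') := by
    intro a a' ha
    by_cases h1 : X.faceOf a = X.outerFace
    · obtain ⟨d, rfl⟩ := hseam a h1
      rw [hs] at ha
      simp only [GlueData.Dart.inner.injEq, heq_eq_eq, true_and] at ha
      have h2 := (B.fill ξ).seam_next ⟨f, h⟩ ((B.map.faceNext f).symm d)
      have h3 := (B.fill ξ').seam_next ⟨f, h'⟩ ((B.map.faceNext f).symm d)
      rw [Equiv.apply_symm_apply] at h2 h3
      rw [ha] at h3
      rw [h2, h3]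
      exact hs _
    · have h2 := e.map_next (.inner ⟨f, h⟩ a)
      rw [ha] at h2
      have h3 : (B.fill ξ).toGlueData.glue.next (.inner ⟨f, h⟩ a) = .inner ⟨f, h⟩ (X.next a) := by
        rw [GlueData.glue_next, GlueData.nextFun_inner_of_ne _ h1]
      have h4 : (B.fill ξ').toGlueData.glue.next (.inner ⟨f, h'⟩ a') =
          .inner ⟨f, h'⟩ (X'.next a') := by
        rw [GlueData.glue_next, GlueData.nextFun_inner_of_ne _ (hne a a' ha h1)]
      rw [← h3, ← h4]
      exact h2
  have hflip : ∀ (a : X.Dart) (a' : X'.Dart), e.toEquiv (.inner ⟨f, h⟩ a) = .inner ⟨f, h'⟩ a' →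
      e.toEquiv (.inner ⟨f, h⟩ (X.flip a)) = .inner ⟨f, h'⟩ (X'.flip a') := fun a a' ha =>
    (e.map_flip (.inner ⟨f, h⟩ a)).trans (congrArg (B.fill ξ').toGlueData.glue.flip ha)
  have hex : ∀ a : X.Dart, ∃ a' : X'.Dart, e.toEquiv (.inner ⟨f, h⟩ a) = .inner ⟨f, h'⟩ a' :=
    (B.fillDisk ξ ⟨f, h⟩).planar.1.induction_next
      (S := {a | ∃ a' : X'.Dart, e.toEquiv (.inner ⟨f, h⟩ a) = .inner ⟨f, h'⟩ a'}) X.root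
      ⟨_, hroot⟩ (fun a ⟨a', ha⟩ => ⟨_, hstep a a' ha⟩) (fun a ⟨a', ha⟩ => ⟨_, hflip a a' ha⟩)
  choose φ hφ using hex
  have hinj : ∀ {a b : X'.Dart}, (GlueData.Dart.inner ⟨f, h'⟩ a : (B.fill ξ').toGlueData.Dart) =
      .inner ⟨f, h'⟩ b → a = b := fun h => by
    simpa only [GlueData.Dart.inner.injEq, heq_eq_eq, true_and] using h
  have h1 : ∀ a, φ (X.next a) = X'.next (φ a) := fun a =>
    hinj ((hφ _).symm.trans (hstep a _ (hφ a)))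
  have h2 : ∀ a, φ (X.flip a) = X'.flip (φ a) := fun a =>
    hinj ((hφ _).symm.trans (hflip a _ (hφ a)))
  have h3 : φ X.root = X'.root := hinj ((hφ _).symm.trans hroot)
  have h4 := RootedMap.bijective_of_root_fiber (B.fillDisk ξ' ⟨f, h'⟩).planar.1 φ h1 h2 h3
    fun a ha => by
      have := hφ a
      rw [ha, ← hroot] at this
      have := e.toEquiv.injective this
      exact (by simpa only [GlueData.Dart.inner.injEq, heq_eq_eq, true_and] using this)
  refine ⟨⟨RootedMap.isoOfBijective φ h4 h1 h2 h3, fun a => ?_⟩⟩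
  have := e.map_crossed (.inner ⟨f, h⟩ a)
  rw [hφ] at this
  exact this

theorem fill_injective (hξ : Nonempty (LoopQuadrangulation.Iso (B.fill ξ).glue (B.fill ξ').glue)) :
    ξ = ξ' := by
  obtain ⟨e⟩ := hξ
  have hh := B.fillHoles_eq_of_iso e
  funext f'
  obtain ⟨f, hf⟩ := f'
  by_cases h : f ∈ B.fillHoles ξ
  · have h' := hh ▸ h
    have h1 := Quotient.sound (s := LoopQuadrangulation.setoid _) (B.fillDisk_iso e f h h')
    have h2 := (B.fillClass_eq_iff ξ ⟨f, h⟩ hf _).1 rfl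
    have h3 := (B.fillClass_eq_iff ξ' ⟨f, h'⟩ hf _).1 rfl
    rw [h2, h3, ← mk_fillDisk, ← mk_fillDisk]
    exact congrArg Sum.inr h1
  · have h' : f ∉ B.fillHoles ξ' := hh ▸ h
    rcases h1 : ξ ⟨f, hf⟩ with x | x
    · rcases h2 : ξ' ⟨f, hf⟩ with y | y
      · exact congrArg Sum.inl (Subsingleton.elim x y)
      · exact (h' ⟨hf, by rw [h2]; rfl⟩).elim
    · exact (h ⟨hf, by rw [h1]; rfl⟩).elim

end BipartiteDisk

/-! ### Partition functions -/

/-- Distributivity of a finite product over infinite sums, by induction on the index type; no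
summability is needed in `ℝ≥0∞`. -/
theorem ENNReal.tsum_pi_prod {ι : Type} [Fintype ι] {A : ι → Type 1} (f : ∀ i, A i → ℝ≥0∞) :
    ∑' x : ∀ i, A i, ∏ i, f i (x i) = ∏ i, ∑' a, f i a := by
  classical
  revert A
  refine Fintype.induction_empty_option (P := fun ι _ => ∀ {A : ι → Type 1} (f : ∀ i, A i → ℝ≥0∞),
    ∑' x : ∀ i, A i, ∏ i, f i (x i) = ∏ i, ∑' a, f i a) ?_ ?_ ?_ ι
  · intro α β _ e h A f
    let := Fintype.ofEquiv β e.symm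
    rw [← Equiv.prod_comp e, ← (Equiv.piCongrLeft A e).tsum_eq]
    refine Eq.trans (tsum_congr fun x => ?_) (h fun a => f (e a))
    rw [← Equiv.prod_comp e]
    simp [Equiv.piCongrLeft_apply_apply]
  · intro A f
    rw [tsum_eq_single (fun i => i.elim) fun x hx => (hx (funext fun i => i.elim)).elim]
    simp
  · intro α _ h A f
    rw [← (Equiv.piOptionEquivProd (β := A)).symm.tsum_eq, ENNReal.tsum_prod', Fintype.prod_option,
      ← h, ← ENNReal.tsum_mul_right]
    refine tsum_congr fun a => ?_
    rw [← ENNReal.tsum_mul_left]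
    refine tsum_congr fun x => ?_
    rw [Fintype.prod_option]
    rfl

/-- The weight of the filling of a face. -/
def fillingWeight (n g h : ℝ≥0) (k : ℕ) :
    PLift (k = 4) ⊕ LoopQuadrangulationClass k → ℝ≥0∞
  | Sum.inl _ => g
  | Sum.inr q => n * (h : ℝ≥0∞) ^ k * q.weight n g h

theorem tsum_fillingWeight (n g h : ℝ≥0) (k : ℕ) :
    ∑' x, fillingWeight n g h k x = effectiveWeight n g h k := by
  rw [ENNReal.summable.tsum_sum ENNReal.summable, effectiveWeight]
  refine congrArg₂ _ ?_ ?_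
  · simp only [fillingWeight]
    split_ifs with hk
    · rw [tsum_eq_single (PLift.up hk) fun x hx => (hx (Subsingleton.elim _ _)).elim]
    · have : IsEmpty (PLift (k = 4)) := ⟨fun x => hk x.down⟩
      exact tsum_empty
  · exact ENNReal.tsum_mul_left

theorem RootedMap.tsum_filling (M : RootedMap) [Fintype M.InnerFace] (n g h : ℝ≥0) :
    ∑' ξ : M.Filling, ∏ f, fillingWeight n g h _ (ξ f) =
      M.boltzmannWeight (effectiveWeight n g h) := by
  refine (ENNReal.tsum_pi_prod (A := fun f : M.InnerFace =>
    PLift (M.degree f.1 = 4) ⊕ LoopQuadrangulationClass (M.degree f.1))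
    fun f => fillingWeight n g h (M.degree f.1)).trans ?_
  rw [boltzmannWeight, finprod_eq_prod_of_fintype]
  exact Finset.prod_congr rfl fun f _ => tsum_fillingWeight n g h _

namespace BipartiteDisk

variable {p : ℕ} (B : BipartiteDisk p)

theorem weight_fill [Fintype B.map.InnerFace] (ξ : B.map.Filling) (n g h : ℝ≥0) :
    (B.fill ξ).glue.weight n g h = ∏ f, fillingWeight n g h _ (ξ f) := by
  classical
  have := Fintype.ofFinite (B.fill ξ).holes
  -- The product over inner faces is split into holes and plain quadrangles, the latter giving the
  -- power of `g`.
  rw [(B.fill ξ).weight_glue,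
    ← Fintype.prod_subtype_mul_prod_subtype (fun f : B.map.InnerFace => f.1 ∈ B.fillHoles ξ),
    mul_comm]
  refine congrArg₂ _ ?_ ?_
  · let e : B.fillHoles ξ ≃ {f : B.map.InnerFace // f.1 ∈ B.fillHoles ξ} :=
      { toFun := fun j => ⟨⟨j.1, j.2.fst⟩, j.2⟩
        invFun := fun f => ⟨f.1.1, f.2⟩
        left_inv := fun _ => rfl
        right_inv := fun _ => rfl }
    refine Fintype.prod_equiv e _ _ fun j => ?_
    have h1 := (B.fillClass_eq_iff ξ j j.2.fst _).1 rfl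
    change _ = fillingWeight n g h _ (ξ ⟨j.1, j.2.fst⟩)
    rw [h1, ← mk_fillDisk]
    rfl
  · rw [Nat.card_eq_fintype_card, ← Finset.card_univ, ← Finset.prod_const]
    refine Finset.prod_congr rfl fun f _ => ?_
    rcases h1 : ξ f.1 with x | x
    · rfl
    · exact (f.2 ⟨f.1.2, (congrArg Sum.isRight h1).trans rfl⟩).elim

end BipartiteDisk

/-! ### The bijection on isomorphism classes and the resulting identity of sums. -/

def BipartiteDiskClass.rep {p : ℕ} (B : BipartiteDiskClass p) : BipartiteDisk p :=
  Quotient.out (s := BipartiteDisk.setoid p) B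

theorem BipartiteDiskClass.mk_rep {p : ℕ} (B : BipartiteDiskClass p) :
    (Quotient.mk (BipartiteDisk.setoid p) B.rep : BipartiteDiskClass p) = B :=
  Quotient.out_eq (s := BipartiteDisk.setoid p) B

/-- The bijection between bipartite maps with filled inner faces and loop-decorated
quadrangulations. -/
def fillClassMap (p : ℕ) :
    (Σ B : BipartiteDiskClass p, B.rep.map.Filling) → LoopQuadrangulationClass p :=
  fun x => Quotient.mk _ (x.1.rep.fill x.2).glue

theorem gasket_fillClassMap {p : ℕ}
    (x : Σ B : BipartiteDiskClass p, B.rep.map.Filling) :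
    (fillClassMap p x).gasket = x.1.toRootedMapClass := by
  have h1 : (fillClassMap p x).gasket =
      (Quotient.mk _ x.1.rep.map : RootedMapClass) :=
    Quotient.sound ⟨(x.1.rep.fill x.2).gasketIso.symm⟩
  rw [h1]
  conv_rhs => rw [← x.1.mk_rep]
  rfl

theorem toRootedMapClass_injective (p : ℕ) :
    Function.Injective (BipartiteDiskClass.toRootedMapClass (p := p)) := by
  rintro ⟨B⟩ ⟨B'⟩ h
  exact Quotient.sound (Quotient.exact h : B.map ≈ B'.map)

/-- The gasket determines the class of the base, and `fill_injective` the filling. For surjectivity,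
the base is the component of the root once all crossed edges are erased; `p` even is needed to make
it bipartite. That this component is the gasket follows afterwards from `gasket_fillClassMap`. -/
theorem fillClassMap_bijective {p : ℕ} (hp : Even p) : Function.Bijective (fillClassMap p) := by
  constructor
  · intro x y hxy
    have h1 : x.1 = y.1 := toRootedMapClass_injective p (by
      rw [← gasket_fillClassMap, ← gasket_fillClassMap, hxy])
    obtain ⟨B, ξ⟩ := x
    obtain ⟨B', ξ'⟩ := y
    obtain rfl : B = B' := h1
    exact congrArg (Sigma.mk B) (B.rep.fill_injective (Quotient.exact hxy))
  · rintro ⟨Q⟩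
    let E₁ := GasketEmbedding.ofQuadrangulation Q
    have hM : RootedMap.IsConnected _ :=
      RootedMap.component.isConnected (M := Q.map) (C := Q.crossed) (r := Q.map.root)
        (hC := Q.crossed_flip) (hr := fun h => Q.crossed_inner _ h rfl)
        fun _ => Q.isRigid.rot_notMem
    let B : BipartiteDisk p := ⟨_, (E₁.isPlanar hM).1, E₁.isBipartite hM hp, E₁.boundaryLength hM⟩
    let B' : BipartiteDiskClass p := Quotient.mk (BipartiteDisk.setoid p) B
    obtain ⟨e⟩ : Nonempty (RootedMap.Iso B'.rep.map B.map) := Quotient.exact B'.mk_rep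
    obtain ⟨ξ, hξ⟩ := B'.rep.exists_fill (E₁.ofIso e)
    exact ⟨⟨B', ξ⟩, Quotient.sound hξ⟩

/-- Sums over the loop-decorated quadrangulations, organised according to the gasket. -/
theorem tsum_weight_eq {p : ℕ} (hp : Even p) (n g h : ℝ≥0) (u : RootedMapClass → ℝ≥0∞) :
    ∑' Q : LoopQuadrangulationClass p, Q.weight n g h * u Q.gasket =
      ∑' B : BipartiteDiskClass p,
        B.weight (effectiveWeight n g h) * u B.toRootedMapClass := by
  rw [← (Equiv.ofBijective _ (fillClassMap_bijective hp)).tsum_eq, ENNReal.tsum_sigma']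
  refine tsum_congr fun B => ?_
  have := Fintype.ofFinite B.rep.map.InnerFace
  have h1 : B.weight (effectiveWeight n g h) =
      B.rep.map.boltzmannWeight (effectiveWeight n g h) := by
    conv_lhs => rw [← B.mk_rep]
    rfl
  rw [h1, ← RootedMap.tsum_filling, ← ENNReal.tsum_mul_right]
  refine tsum_congr fun ξ => ?_
  rw [Equiv.ofBijective_apply, gasket_fillClassMap, ← BipartiteDisk.weight_fill]
  rfl

theorem diskZ_eq_boltzmannF {p : ℕ} (hp : Even p) (n g h : ℝ≥0) :
    diskZ n g h p = boltzmannF (effectiveWeight n g h) p := by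
  have := tsum_weight_eq hp n g h fun _ => 1
  simp only [mul_one] at this
  exact this

/-! ### Positivity -/

section Star

variable (m : ℕ)

/-- The tree with `m + 1` edges sharing a vertex. -/
abbrev starMap : RootedMap where
  Dart := ZMod (m + 1) × Bool
  finite_dart := inferInstance
  rot :=
    { toFun := fun a => (if a.2 then a.1 else a.1 + 1, a.2)
      invFun := fun a => (if a.2 then a.1 else a.1 - 1, a.2)
      left_inv := by rintro ⟨i, _ | _⟩ <;> simp
      right_inv := by rintro ⟨i, _ | _⟩ <;> simp }
  flip := (Equiv.refl _).prodCongr Equiv.boolNot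
  flip_flip := by rintro ⟨i, _ | _⟩ <;> rfl
  flip_ne := by rintro ⟨i, _ | _⟩ h <;> simp at h
  root := (0, false)

theorem starMap_center (n : ℕ) (i : ZMod (m + 1)) :
    ((starMap m).rot ^ n) (i, false) = (i + n, false) := by
  induction n with
  | zero => simp
  | succ n ih =>
    rw [pow_succ', Equiv.Perm.mul_apply, ih]
    change (i + n + 1, false) = _
    push_cast
    rw [add_assoc]

/-- The contour of the tree returns to the centre every two steps, moving on to the next edge; it
therefore visits all darts, and there is a single face. -/
theorem starMap_face (n : ℕ) : ((starMap m).next ^ (2 * n)) (0, false) = ((n : ZMod (m + 1)), false) := by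
  induction n with
  | zero => simp
  | succ n ih =>
    rw [mul_add, mul_one, add_comm, pow_add, Equiv.Perm.mul_apply, ih]
    change ((n : ZMod (m + 1)) + 1, false) = _
    push_cast
    rfl

theorem starMap_sameCycle (a : (starMap m).Dart) :
    (starMap m).next.SameCycle (0, false) a := by
  obtain ⟨i, b⟩ := a
  have h : (starMap m).next.SameCycle (0, false) (i, false) := by
    refine ⟨(2 * i.val : ℕ), ?_⟩
    rw [zpow_natCast, starMap_face, ZMod.natCast_zmod_val]
  cases b
  · exact h
  · exact h.trans (Equiv.Perm.sameCycle_apply_self _ _)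

theorem starMap_faceOf (a : (starMap m).Dart) :
    (starMap m).faceOf a = (starMap m).outerFace :=
  ((starMap m).faceOf_eq_iff_sameCycle _ _).2 (starMap_sameCycle m a).symm

theorem starMap_isPlanar : (starMap m).IsPlanar := by
  constructor
  · refine RootedMap.isConnected_of fun S h1 h2 h3 => ?_
    have h4 : ∀ n : ℕ, (((n : ZMod (m + 1)), false) : (starMap m).Dart) ∈ S := by
      intro n
      induction n with
      | zero => simpa using h1
      | succ n ih =>
        have := h2 _ ih
        push_cast
        exact this
    have h5 : ∀ i : ZMod (m + 1), ((i, false) : (starMap m).Dart) ∈ S := fun i => by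
      have := h4 i.val
      rwa [ZMod.natCast_zmod_val] at this
    rintro ⟨i, _ | _⟩
    · exact h5 i
    · exact h3 _ (h5 i)
  · have hV : Nat.card (starMap m).Vertex = m + 2 := by
      have e := (starMap m).rot.cyclesEquiv
        (fun a => if a.2 then some a.1 else (none : Option (ZMod (m + 1)))) ?_ ?_ ?_
      · refine (Nat.card_congr e).trans ?_
        rw [Finite.card_option, Nat.card_zmod]
      · rintro (_ | i)
        · exact ⟨(0, false), rfl⟩
        · exact ⟨(i, true), rfl⟩
      · rintro ⟨i, _ | _⟩ <;> rfl
      · rintro ⟨i, _ | _⟩ ⟨j, _ | _⟩ h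
        · refine ⟨((j - i).val : ℕ), ?_⟩
          rw [zpow_natCast, starMap_center, ZMod.natCast_zmod_val]
          simp
        · simp at h
        · simp at h
        · obtain rfl : i = j := by simpa using h
          exact .rfl
    have hF : Nat.card (starMap m).Face = 1 := by
      rw [Nat.card_eq_one_iff_unique]
      refine ⟨⟨fun f f' => ?_⟩, ⟨(starMap m).outerFace⟩⟩
      obtain ⟨a, rfl⟩ := (starMap m).faceOf_surjective f
      obtain ⟨b, rfl⟩ := (starMap m).faceOf_surjective f'
      rw [starMap_faceOf, starMap_faceOf]
    have hD := (starMap m).card_dart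
    have hD' : Nat.card (starMap m).Dart = (m + 1) * 2 := by
      change Nat.card (ZMod (m + 1) × Bool) = (m + 1) * 2
      rw [Nat.card_prod, Nat.card_zmod, Nat.card_eq_fintype_card, Fintype.card_bool]
    omega

/-- The star, seen as a quadrangulation without inner faces. -/
def starQuadrangulation : LoopQuadrangulation (2 * (m + 1)) :=
  LoopQuadrangulation.ofIsRigid (starMap m) (starMap_isPlanar m)
    (by
      rw [RootedMap.boundaryLength, RootedMap.degree,
        Nat.card_congr (Equiv.subtypeUnivEquiv (starMap_faceOf m)), Nat.card_prod, Nat.card_zmod,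
        Nat.card_eq_fintype_card, Fintype.card_bool, mul_comm])
    ∅
    { quad := by
        rintro ⟨f, hf⟩
        obtain ⟨a, rfl⟩ := (starMap m).faceOf_surjective f
        exact (hf (starMap_faceOf m a)).elim
      crossed_flip := fun _ h => h.elim
      crossed_two := fun _ h => h.elim
      crossed_inner := fun _ h => h.elim
      rigid := fun _ h => h.elim }

theorem weight_starQuadrangulation (n g h : ℝ≥0) :
    (starQuadrangulation m).weight n g h = 1 := by
  have h1 : (starQuadrangulation m).numLoops = 0 := by
    have : IsEmpty (starQuadrangulation m).Loop := ⟨fun l => by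
      obtain ⟨a, -⟩ := Quot.exists_rep l
      exact a.2.elim⟩
    exact Nat.card_of_isEmpty
  have h2 : (starQuadrangulation m).numUnvisited = 0 := by
    have : IsEmpty {f : (starQuadrangulation m).map.InnerFace //
        ¬ (starQuadrangulation m).IsVisited f.1} := ⟨fun f => by
      obtain ⟨a, ha⟩ := (starMap m).faceOf_surjective f.1.1
      exact f.1.2 (ha.symm.trans (starMap_faceOf m a))⟩
    exact Nat.card_of_isEmpty
  have h3 : (starQuadrangulation m).numVisited = 0 := by
    have : IsEmpty {f : (starQuadrangulation m).map.Face //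
        (starQuadrangulation m).IsVisited f} := ⟨fun f => by
      obtain ⟨a, ha, -⟩ := f.2
      exact ha.elim⟩
    exact Nat.card_of_isEmpty
  rw [LoopQuadrangulation.weight, h1, h2, h3]
  simp

end Star

/-- The star with `p / 2` edges contributes a term equal to 1, even if `n`, `g` or `h` vanishes,
thanks to `0 ^ 0 = 1`. -/
theorem diskZ_ne_zero {p : ℕ} (hp : 2 ≤ p) (hp' : Even p) (n g h : ℝ≥0) : diskZ n g h p ≠ 0 := by
  obtain ⟨m, rfl⟩ : ∃ m, p = 2 * (m + 1) := by
    obtain ⟨k, rfl⟩ := hp'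
    exact ⟨k - 1, by omega⟩
  intro h0
  have h1 := ENNReal.tsum_eq_zero.1 h0 (Quotient.mk _ (starQuadrangulation m))
  have h2 : (starQuadrangulation m).weight n g h = 0 := h1
  rw [weight_starQuadrangulation] at h2
  exact one_ne_zero h2

/-! ### The law of the gasket. -/

theorem loopModelLaw_apply {p : ℕ} (n g h : ℝ≥0) (hZ₀ : diskZ n g h p ≠ 0)
    (hZ : diskZ n g h p ≠ ∞) (Q : LoopQuadrangulationClass p) :
    loopModelLaw n g h p hZ₀ hZ Q = Q.weight n g h * (diskZ n g h p)⁻¹ :=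
  PMF.normalize_apply _ _ _

theorem boltzmannLaw_apply {p : ℕ} (z : ℕ → ℝ≥0∞) (h₀ : boltzmannF z p ≠ 0)
    (h₁ : boltzmannF z p ≠ ∞) (B : BipartiteDiskClass p) :
    boltzmannLaw z p h₀ h₁ B = B.weight z * (boltzmannF z p)⁻¹ :=
  PMF.normalize_apply _ _ _

theorem map_gasket_loopModelLaw {p : ℕ} (hp : Even p) (n g h : ℝ≥0) (hZ₀ : diskZ n g h p ≠ 0)
    (hZ : diskZ n g h p ≠ ∞) (hF₀ : boltzmannF (effectiveWeight n g h) p ≠ 0)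
    (hF : boltzmannF (effectiveWeight n g h) p ≠ ∞) :
    (loopModelLaw n g h p hZ₀ hZ).map LoopQuadrangulationClass.gasket =
      (boltzmannLaw (effectiveWeight n g h) p hF₀ hF).map
        BipartiteDiskClass.toRootedMapClass := by
  classical
  ext m
  -- Testing against the indicator of `m` divided by the common partition function turns the
  -- weighted identity into the equality of the masses at `m`.
  have key := tsum_weight_eq hp n g h fun m' => if m = m' then (diskZ n g h p)⁻¹ else 0
  rw [PMF.map_apply, PMF.map_apply]
  refine Eq.trans (tsum_congr fun Q => ?_) (key.trans (tsum_congr fun B => ?_))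
  · rw [loopModelLaw_apply, mul_ite, mul_zero]
  · rw [boltzmannLaw_apply, mul_ite, mul_zero, diskZ_eq_boltzmannF hp n g h]

end

theorem mainTheorem6 (n g h : ℝ≥0) :
    (∀ p : ℕ, 2 ≤ p → Even p →
      diskZ n g h p = boltzmannF (effectiveWeight n g h) p) ∧
    (∀ p : ℕ, 2 ≤ p → Even p → ∀ hZ : IsAdmissible n g h p,
      ∃ (hZ₀ : diskZ n g h p ≠ 0)
        (hF₀ : boltzmannF (effectiveWeight n g h) p ≠ 0)
        (hF : boltzmannF (effectiveWeight n g h) p ≠ ∞),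
        (loopModelLaw n g h p hZ₀ hZ).map LoopQuadrangulationClass.gasket =
          (boltzmannLaw (effectiveWeight n g h) p hF₀ hF).map
            BipartiteDiskClass.toRootedMapClass) := by
  refine ⟨fun p _ hp' => diskZ_eq_boltzmannF hp' n g h, fun p hp hp' hZ => ?_⟩
  have hZ₀ := diskZ_ne_zero hp hp' n g h
  have hF := diskZ_eq_boltzmannF hp' n g h
  exact ⟨hZ₀, hF ▸ hZ₀, hF ▸ hZ, map_gasket_loopModelLaw hp' n g h hZ₀ hZ _ _⟩
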